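/- Let $Q(\mathbb A_D) \,{:-}\, R_1(\mathbb A_1),\dots,R_m(\mathbb A_m)$ be a full conjunctive query without self-joins with $k=|\bigcup_i \mathbb A_i|$ attributes, evaluated under bag semantics on a database $D$ with $n$ tuples in total. A hyperedge $h$ of a hypergraph is an ear if its vertices that belong to some other hyperedge all lie in one other hyperedge; a hypergraph (a join of relations, with the attribute sets as hyperedges) is acyclic if removing ears one after the other (a GYO decomposition) reduces it to the empty hypergraph. Attaching each removed relation to a remaining relation that contains all attributes it shares with the remaining ones gives a rooted join tree $\mathcal T$, with $p(R_i)$ the parent and $C(R_i)$ the set of children of $R_i$. The query is doubly acyclic if it is acyclic and has such a join tree $\mathcal T$ in which, for every node $R_i$, the join of its parent and its children is acyclic. For a tuple $t$ over $\mathbb A_i$, its tuple sensitivity is the larger of the sizes of the (bag) symmetric differences of $Q(D)$ with the query results after inserting $t$ into $R_i$ (upward) and after deleting one copy of $t$ from $R_i$ (downward). The local sensitivity $LS(Q,D)$ is the maximum of the tuple sensitivities over all $i$ and all tuples $t$ over $\mathbb A_i$. The algorithm is given $\mathcal T$ and $D$. With $\gamma_{\mathbb A}$ the group-by on $\mathbb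 A$ that adds counts and $\tilde\bowtie$ the natural join that multiplies counts, it computes, from the leaves to the root, the botjoins $\bot(R_i)=\gamma_{\mathbb A_i\cap\mathbb A_{p(R_i)}}\tilde\bowtie(R_i,\{\bot(R_j): R_j\in C(R_i)\})$ (grouped by $\mathbb A_i$ at the root) and, from the root to the leaves, the topjoins $\top(R_i)=\gamma_{\mathbb A_i\cap\mathbb A_{p(R_i)}}\tilde\bowtie(p(R_i),\top(p(R_i)),\{\bot(R_j): R_j\in C(p(R_i)),\,j\ne i\})$ (without $\top(p(R_i))$ if $p(R_i)$ is the root). The multiplicity table $T^i$ assigns to a tuple $t$ over $\mathbb A_i$ its multiplicity in $\tilde\bowtie(\top(R_i),\{\bot(R_j):R_j\in C(R_i)\})$ (without $\top(R_i)$ at the root), where attributes that occur in no other relation are ignored. The tables $T^i$ are kept in the form of these joins and are not written out; the algorithm finds a largest entry of all the $T^i$ along GYO decompositions of these joins, and returns it with its tuple $t^*$. Sorting is by merge sort and joins with botjoins and topjoins are sort-merge joins. One step is one operation on tuples or attribute sets, one arithmetic operation on two counts or one access to a table or node. Let $\mathcal T$ be a join tree of $Q$ that witnesses that $Q$ is doubly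 acyclic. Then: 1. For each node $R_i$ the join that defines $T^i$ is acyclic, i.e. the hypergraph with hyperedges $\mathbb A_i\cap\mathbb A_j$, where $R_j$ is the parent or a child of $R_i$, is acyclic. 2. For every database $D$ the algorithm returns $LS(Q,D)$ and a tuple $t^*$ whose tuple sensitivity is $LS(Q,D)$, and $T^i(t)$ is the upward tuple sensitivity of $t$, for all $i$ and all $t$ over $\mathbb A_i$. There is an absolute constant $K$ such that for $n\ge 2$ the whole algorithm takes at most $K\,m\,n\log n$ steps; if each node of $\mathcal T$ has degree at most $d$ and $m\le n$, it also takes at most $K(d+1)^2\,n\log n$ steps. The algorithm is polynomial in combined complexity: even if each operation on tuples or attribute sets is charged the number of attributes involved and each arithmetic operation the product of the bit lengths of its operands, the cost is bounded by a fixed polynomial in $m$, $k$ and $n$. 3. For $m\ge1$ the path query $R_1(A_0,A_1),R_2(A_1,A_2),\dots,R_m(A_{m-1},A_m)$ is doubly acyclic, with a join tree of degree at most $2$. -/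

import Mathlib

namespace JoinLS

/-! ## Programs with an explicit cost

A `Timed` computation carries its result together with two counters: `steps` is the number of
elementary operations (one tuple operation, one comparison of two tuples, one arithmetic operation
on two counts, one access to a table or to a node of the tree), and `work` is the finer cost
in which an operation on tuples is charged the number of attributes that it touches
and an operation on two counts is charged the product of their bit lengths. -/

structure Timed (β : Type) where
  val : β
  steps : ℕ
  work : ℕ

instance : Monad Timed where
  pure x := ⟨x, 0, 0⟩
  bind x f := ⟨(f x.val).val, x.steps + (f x.val).steps, x.work + (f x.val).work⟩

/-- One elementary operation, of finer cost `w + 1`. -/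
def tick (w : ℕ) : Timed Unit := ⟨(), 1, w + 1⟩

/-- `q` elementary operations, of finer cost `1` each. -/
def ticks (q : ℕ) : Timed Unit := ⟨(), q, q⟩

/-- The finer cost of one addition, multiplication or comparison of two counts. -/
def arith (a b : ℕ) : ℕ := (Nat.size a + 1) * (Nat.size b + 1)

/-- Apply `f` to every entry of a list. -/
def mapT {β γ : Type} (f : β → Timed γ) : List β → Timed (List γ)
  | [] => do
      tick 0
      pure []
  | b :: l => do
      tick 0
      let c ← f b
      let r ← mapT f l
      pure (c :: r)

/-- A loop over a list that updates a state. -/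
def foldT {β σ : Type} (f : σ → β → Timed σ) : List β → σ → Timed σ
  | [], s => do
      tick 0
      pure s
  | b :: l, s => do
      tick 0
      let s' ← f s b
      foldT f l s'

/-! ## Hypergraphs and GYO decompositions -/

section Hypergraph

variable {α ι : Type} [DecidableEq α] [DecidableEq ι]

/-- Among the hyperedges `E j`, `j ∈ s`, the hyperedge `E i` is an ear: each of its vertices
belongs to no other hyperedge, or else lies in one fixed other hyperedge `E w`
(in the first case there may be no vertices of the second kind at all, and no `w`). -/
def IsEar (E : ι → Finset α) (s : Finset ι) (i : ι) : Prop :=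
  i ∈ s ∧ ((∀ j ∈ s, j ≠ i → Disjoint (E i) (E j)) ∨
    ∃ w ∈ s, w ≠ i ∧ ∀ j ∈ s, j ≠ i → E i ∩ E j ⊆ E w)

/-- The hypergraph with hyperedges `E j`, `j ∈ s`, is reduced to the empty hypergraph by
repeatedly removing ears. -/
inductive GYOAcyclic (E : ι → Finset α) : Finset ι → Prop
  | empty : GYOAcyclic E ∅
  | ear (s : Finset ι) (i : ι) (hi : IsEar E s i) (h : GYOAcyclic E (s.erase i)) : GYOAcyclic E s

end Hypergraph

/-! ## Queries and join trees

A full conjunctive query without self-joins, `Q :- R_1(A_1), ..., R_m(A_m)`, is the family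
`A : Fin m → Finset α` of the attribute sets of its relations. -/

/-- A rooted join tree constructed from a GYO decomposition: `elim s` is the relation that is
removed in step `s`; the parent of a removed relation is a relation that is still
present and contains all the attributes that it shares with the relations still present. -/
structure JoinTree {α : Type} [DecidableEq α] {m : ℕ} (A : Fin m → Finset α) where
  elim : Equiv.Perm (Fin m)
  root : Fin m
  parent : Fin m → Option (Fin m)
  parent_eq_none : ∀ i, parent i = none ↔ i = root
  parent_later : ∀ i p, parent i = some p → elim.symm i < elim.symm p
  ear : ∀ i p, parent i = some p → ∀ j, elim.symm i < elim.symm j → A i ∩ A j ⊆ A p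

namespace JoinTree

variable {α : Type} [DecidableEq α] {m : ℕ} {A : Fin m → Finset α}

/-- The nodes from the leaves to the root: children come before their parent. -/
def postOrder (T : JoinTree A) : List (Fin m) := List.ofFn T.elim

/-- The children of a node. -/
def children (T : JoinTree A) (i : Fin m) : List (Fin m) :=
  T.postOrder.filter fun c => T.parent c = some i

/-- The parent (if any) and the children of a node. -/
def nbrs (T : JoinTree A) (i : Fin m) : List (Fin m) := (T.parent i).toList ++ T.children i

/-- The attributes of the botjoin and of the topjoin of node `i`: those shared with its parent,
and all attributes of `i` if `i` is the root. -/
def sep (T : JoinTree A) (i : Fin m) : Finset α :=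
  match T.parent i with
  | some p => A i ∩ A p
  | none => A i

/-- For every node, the join of its parent and its children is acyclic. -/
def NbrsAcyclic (T : JoinTree A) : Prop := ∀ i, GYOAcyclic A (T.nbrs i).toFinset

end JoinTree

/-- Doubly acyclic join queries. -/
def DoublyAcyclic {α : Type} [DecidableEq α] {m : ℕ} (A : Fin m → Finset α) : Prop :=
  GYOAcyclic A Finset.univ ∧ ∃ T : JoinTree A, T.NbrsAcyclic

/-- The path query `R_1(A_0, A_1), R_2(A_1, A_2), ..., R_m(A_{m-1}, A_m)`. -/
def pathQuery (m : ℕ) (i : Fin m) : Finset (Fin (m + 1)) := {i.castSucc, i.succ}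

/-! ## Bag semantics and local sensitivity -/

/-- Tuples over the attribute set `S`. -/
abbrev Tup {α : Type} (dom : α → Type) (S : Finset α) : Type := ∀ a : S, dom a

section Semantics

variable {α : Type} [DecidableEq α] {dom : α → Type} [∀ a, DecidableEq (dom a)] {m : ℕ}
  {A : Fin m → Finset α}

/-- All attributes of the query. -/
def allAttrs (A : Fin m → Finset α) : Finset α := Finset.univ.biUnion A

theorem subset_allAttrs (A : Fin m → Finset α) (i : Fin m) : A i ⊆ allAttrs A :=
  Finset.subset_biUnion_of_mem A (Finset.mem_univ i)

/-- The query result `Q(D)` as a bag: the multiplicity of an output tuple `s` is the product over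
the relations of the multiplicity of the projection of `s`. -/
def result (D : ∀ i, Multiset (Tup dom (A i))) (s : Tup dom (allAttrs A)) : ℕ :=
  ∏ i, (D i).count (Finset.restrict₂ (subset_allAttrs A i) s)

/-- The query result is a finite bag, so that the sum in `symmDiffCard` is a finite one. -/
theorem finite_support_result (D : ∀ i, Multiset (Tup dom (A i))) :
    (Function.support (result D)).Finite := by
  have hfin : (Set.univ.pi fun i => {t : Tup dom (A i) | t ∈ D i}).Finite :=
    Set.Finite.pi fun i => (D i).toFinset.finite_toSet.subset fun t ht => by simpa using ht
  refine Set.Finite.of_finite_image (f := fun s i => Finset.restrict₂ (subset_allAttrs A i) s)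
    (hfin.subset ?_) ?_
  · rintro _ ⟨s, hs, rfl⟩ i -
    by_contra h
    exact hs (Finset.prod_eq_zero (Finset.mem_univ i) (Multiset.count_eq_zero.2 h))
  · intro s _ s' _ h
    funext ⟨a, ha⟩
    obtain ⟨i, -, hi⟩ := Finset.mem_biUnion.1 ha
    exact congrFun (congrFun h i) ⟨a, hi⟩

/-- The size of the symmetric difference of two bags. -/
noncomputable def symmDiffCard {β : Type} (f g : β → ℕ) : ℕ :=
  ∑ᶠ s, ((f s - g s) + (g s - f s))

/-- Upward tuple sensitivity of the tuple `t` of the domain of relation `i`. -/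
noncomputable def upSens (D : ∀ i, Multiset (Tup dom (A i))) (i : Fin m) (t : Tup dom (A i)) : ℕ :=
  symmDiffCard (result (Function.update D i (t ::ₘ D i))) (result D)

/-- Downward tuple sensitivity. -/
noncomputable def downSens (D : ∀ i, Multiset (Tup dom (A i))) (i : Fin m)
    (t : Tup dom (A i)) : ℕ :=
  symmDiffCard (result D) (result (Function.update D i ((D i).erase t)))

/-- Tuple sensitivity. -/
noncomputable def tupleSens (D : ∀ i, Multiset (Tup dom (A i))) (i : Fin m)
    (t : Tup dom (A i)) : ℕ :=
  max (upSens D i t) (downSens D i t)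

/-- `ls` is the local sensitivity: the maximum of the tuple sensitivities over all tuples of the
domains of all relations. -/
def IsLocalSensitivity (D : ∀ i, Multiset (Tup dom (A i))) (ls : ℕ) : Prop :=
  IsGreatest {x | ∃ (i : Fin m) (t : Tup dom (A i)), tupleSens D i t = x} ls

end Semantics

/-! ## Tables

A table over the attribute set `S` is a list of rows `(v, c)` with a count `c`; the tuple is stored
as an assignment `v` of values to all attributes, of which only those to `S` are ever read. -/

noncomputable section Tables

variable {α : Type} [LinearOrder α] {dom : α → Type} [∀ a, LinearOrder (dom a)]

/-- The projection of `v` to `S`, in the lexicographic order. -/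
def key (S : Finset α) (v : ∀ a, dom a) : Lex (∀ a : S, dom a) := toLex (S.restrict v)

/-- Merge two lists of rows that are sorted by their projections to `S`. -/
def mergeRows {X : Type} (S : Finset α) :
    List ((∀ a, dom a) × X) → List ((∀ a, dom a) × X) → Timed (List ((∀ a, dom a) × X))
  | [], l => do
      tick 0
      pure l
  | x :: l, [] => do
      tick 0
      pure (x :: l)
  | x :: l, y :: l' => do
      tick S.card
      if key S x.1 ≤ key S y.1 then
        let r ← mergeRows S l (y :: l')
        pure (x :: r)
      else
        let r ← mergeRows S (x :: l) l'
        pure (y :: r)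
termination_by l l' => l.length + l'.length

/-- Merge sort of a list of rows by their projections to `S`. -/
def sortRows {X : Type} (S : Finset α) (l : List ((∀ a, dom a) × X)) :
    Timed (List ((∀ a, dom a) × X)) :=
  if _h : l.length ≤ 1 then do
    tick 0
    pure l
  else do
    ticks l.length
    let x ← sortRows S (l.take (l.length / 2))
    let y ← sortRows S (l.drop (l.length / 2))
    mergeRows S x y
termination_by l.length
decreasing_by
  · simp only [List.length_take]; omega
  · simp only [List.length_drop]; omega

/-- Combine neighbouring rows with the same projection to `S` by means of `f`. -/
def collapse (S : Finset α) (f : (∀ a, dom a) × ℕ → (∀ a, dom a) × ℕ → (∀ a, dom a) × ℕ) :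
    List ((∀ a, dom a) × ℕ) → Timed (List ((∀ a, dom a) × ℕ))
  | [] => do
      tick 0
      pure []
  | r :: l => do
      let out ← collapse S f l
      match out with
      | [] => do
          tick 0
          pure [r]
      | r' :: o => do
          tick (S.card + arith r.2 r'.2)
          if key S r.1 = key S r'.1 then pure (f r r' :: o) else pure (r :: r' :: o)

/-- Group by the attributes in `S`, where rows of the same group are combined by `f`. -/
def groupBy (S : Finset α) (f : (∀ a, dom a) × ℕ → (∀ a, dom a) × ℕ → (∀ a, dom a) × ℕ)
    (l : List ((∀ a, dom a) × ℕ)) : Timed (List ((∀ a, dom a) × ℕ)) := do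
  let l' ← sortRows S l
  collapse S f l'

/-- Add the counts. -/
def addRow (r r' : (∀ a, dom a) × ℕ) : (∀ a, dom a) × ℕ := (r.1, r.2 + r'.2)

/-- Keep a row with the larger count. -/
def maxRow (r r' : (∀ a, dom a) × ℕ) : (∀ a, dom a) × ℕ := if r'.2 ≤ r.2 then r else r'

/-- One pass over two lists of rows sorted by their projections to `S`, the projections of the
second list being distinct: each row of the first list is paired with the row of the second list
that joins with it, if there is one. -/
def mergeLookup {X : Type} (S : Finset α) :
    List ((∀ a, dom a) × X) → List ((∀ a, dom a) × ℕ) →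
      Timed (List (((∀ a, dom a) × X) × Option ((∀ a, dom a) × ℕ)))
  | [], _ => do
      tick 0
      pure []
  | x :: l, [] => do
      tick 0
      let r ← mergeLookup S l []
      pure ((x, none) :: r)
  | x :: l, y :: tbl => do
      tick S.card
      if key S x.1 = key S y.1 then
        let r ← mergeLookup S l (y :: tbl)
        pure ((x, some y) :: r)
      else if key S x.1 ≤ key S y.1 then
        let r ← mergeLookup S l (y :: tbl)
        pure ((x, none) :: r)
      else
        mergeLookup S (x :: l) tbl
termination_by l tbl => l.length + tbl.length

/-- Sort-merge join of arbitrary rows with the output of a group-by over `S`. -/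
def lookupJoin {X : Type} (S : Finset α) (rows : List ((∀ a, dom a) × X))
    (tbl : List ((∀ a, dom a) × ℕ)) :
    Timed (List (((∀ a, dom a) × X) × Option ((∀ a, dom a) × ℕ))) := do
  let rows' ← sortRows S rows
  mergeLookup S rows' tbl

/-- The count of the joining row, `0` if there is none. -/
def countOf (r : Option ((∀ a, dom a) × ℕ)) : ℕ :=
  match r with
  | none => 0
  | some y => y.2

/-- The multiplicity of the projection of `v` to `S` in a table over `S`. -/
def tableCount (S : Finset α) (tbl : List ((∀ a, dom a) × ℕ)) (v : ∀ a, dom a) : ℕ :=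
  ((tbl.filter fun r => key S r.1 = key S v).map fun r => r.2).sum

/-- For counts `x_1, ..., x_d`: the list of the products of `pre` and of all `x_i` but one,
and the product of all `x_i`. -/
def others (pre : ℕ) : List ℕ → Timed (List ℕ × ℕ)
  | [] => do
      tick 0
      pure ([], 1)
  | x :: l => do
      tick (arith pre x)
      let r ← others (pre * x) l
      tick (arith pre r.2)
      tick (arith x r.2)
      pure (pre * r.2 :: r.1, x * r.2)

/-- A row with the largest count. -/
def bestRow : List ((∀ a, dom a) × ℕ) → Timed (Option ((∀ a, dom a) × ℕ))
  | [] => do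
      tick 0
      pure none
  | r :: l => do
      let b ← bestRow l
      match b with
      | none => do
          tick 0
          pure (some r)
      | some r' => do
          tick (arith r.2 r'.2)
          pure (some (maxRow r r'))

/-! ## Computing a GYO decomposition -/

section Gyo

variable {ι : Type} [DecidableEq ι]

/-- The vertices of `e` that lie in one of the listed hyperedges. -/
def sharedPart (E : ι → Finset α) (e : Finset α) : List ι → Timed (Finset α)
  | [] => do
      tick 0
      pure ∅
  | w :: l => do
      tick (e.card + (E w).card)
      let r ← sharedPart E e l
      pure ((e ∩ E w) ∪ r)

/-- One of the listed hyperedges that contains `s`. -/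
def findWitness (E : ι → Finset α) (s : Finset α) : List ι → Timed (Option ι)
  | [] => do
      tick 0
      pure none
  | w :: l => do
      tick (s.card + (E w).card)
      if s ⊆ E w then pure (some w) else findWitness E s l

/-- If the hyperedge `j` is an ear, the other hyperedges being those listed: the hyperedge that
contains its shared vertices, or `some none` if it has no shared vertices. -/
def earWitness (E : ι → Finset α) (j : ι) (l : List ι) : Timed (Option (Option ι)) := do
  let s ← sharedPart E (E j) l
  if s = ∅ then pure (some none)
  else do
    let w ← findWitness E s l
    match w with
    | none => pure none
    | some w => pure (some (some w))

/-- A GYO decomposition of the hyperedges in `L`, as the list of the ears in the order of their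
removal together with their witnesses. The first list holds the hyperedges that have still
to be tested; the removal of an ear can turn only its witness into a new ear.
The number bounds the number of tests. -/
def gyo (E : ι → Finset α) : ℕ → List ι → List ι → Timed (List (ι × Option ι))
  | 0, _, _ => do
      tick 0
      pure []
  | _ + 1, [], _ => do
      tick 0
      pure []
  | q + 1, j :: cs, L => do
      ticks (L.length + 1)
      if j ∈ L then do
        let x ← earWitness E j (L.erase j)
        match x with
        | none => gyo E q cs L
        | some w => do
            let rest ← gyo E q (w.toList ++ cs) (L.erase j)
            pure ((j, w) :: rest)
      else gyo E q cs L

end Gyo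

variable {m : ℕ} {A : Fin m → Finset α}

/-! ## The algorithm -/

section Algorithm

variable [∀ a, Inhabited (dom a)]

/-- A tuple over `S` as a row. -/
def extend (S : Finset α) (t : Tup dom S) : ∀ a, dom a :=
  fun a => if h : a ∈ S then t ⟨a, h⟩ else default

/-- The tuples of relation `i`, each with count `1` and an empty list of further counts. -/
def readRel (D : ∀ i, List (Tup dom (A i))) (i : Fin m) :
    Timed (List ((∀ a, dom a) × (ℕ × List ℕ))) :=
  mapT (fun t => do
    tick (A i).card
    pure (extend (A i) t, (1, []))) (D i)

/-- Join the rows of a relation with the botjoins of the listed children one by one, recording in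
each row the list of the counts found. -/
def joinChildren (T : JoinTree A) (bot : Fin m → List ((∀ a, dom a) × ℕ)) :
    List (Fin m) → List ((∀ a, dom a) × (ℕ × List ℕ)) →
      Timed (List ((∀ a, dom a) × (ℕ × List ℕ)))
  | [], rows => do
      tick 0
      pure rows
  | c :: cs, rows => do
      let rows' ← joinChildren T bot cs rows
      let j ← lookupJoin (T.sep c) rows' (bot c)
      mapT (fun r => do
        tick 0
        pure (r.1.1, (r.1.2.1, countOf r.2 :: r.1.2.2))) j

/-- Step I at node `i`: the botjoin of `i`, from the botjoins of its children. -/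
def botStep (T : JoinTree A) (D : ∀ i, List (Tup dom (A i)))
    (bot : Fin m → List ((∀ a, dom a) × ℕ)) (i : Fin m) :
    Timed (Fin m → List ((∀ a, dom a) × ℕ)) := do
  let rows ← readRel D i
  let rows ← joinChildren T bot (T.children i) rows
  let rows ← mapT (fun r => do
    let x ← others r.2.1 r.2.2
    pure (r.1, x.2)) rows
  let b ← groupBy (T.sep i) addRow rows
  tick 0
  pure (Function.update bot i b)

/-- The `q`-th count of each row belongs to the `q`-th child: group by, for each of the children. -/
def distribute (T : JoinTree A) :
    List (Fin m) → List ((∀ a, dom a) × List ℕ) → (Fin m → List ((∀ a, dom a) × ℕ)) →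
      Timed (Fin m → List ((∀ a, dom a) × ℕ))
  | [], _, top => do
      tick 0
      pure top
  | c :: cs, rows, top => do
      let col ← mapT (fun r => do
        tick 0
        pure (r.1, r.2.headD 0)) rows
      let rest ← mapT (fun r => do
        tick 0
        pure (r.1, r.2.tail)) rows
      let g ← groupBy (T.sep c) addRow col
      distribute T cs rest (Function.update top c g)

/-- Step II at node `p`: the topjoins of all the children of `p`, from `p`, the topjoin of `p`
(unless `p` is the root) and the botjoins of the children of `p` other than the one at hand. -/
def topStep (T : JoinTree A) (D : ∀ i, List (Tup dom (A i)))
    (bot top : Fin m → List ((∀ a, dom a) × ℕ)) (p : Fin m) :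
    Timed (Fin m → List ((∀ a, dom a) × ℕ)) := do
  let rows ← readRel D p
  let rows ← match T.parent p with
    | none => do
        tick 0
        pure rows
    | some _ => do
        let j ← lookupJoin (T.sep p) rows (top p)
        mapT (fun r => do
          tick 0
          pure (r.1.1, (countOf r.2, r.1.2.2))) j
  let rows ← joinChildren T bot (T.children p) rows
  let rows ← mapT (fun r => do
    let x ← others r.2.1 r.2.2
    pure (r.1, x.1)) rows
  distribute T (T.children p) rows top

/-- The state of step III at a node: the tables that are still to be joined with the attributes
that their rows assign, and a partial result with the attributes that it assigns. -/
structure MaxState (m : ℕ) (dom : α → Type) where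
  tbl : Fin m → List ((∀ a, dom a) × ℕ)
  reg : Fin m → Finset α
  best : (∀ a, dom a) × ℕ
  bestReg : Finset α

/-- Step III at node `i`, one ear `e` of the acyclic join of the topjoin of `i` and the botjoins of
its children: for each value of the attributes shared with its witness only the row of `e`
with the largest count matters, and it is joined into the table of the witness. -/
def maxStep (A : Fin m → Finset α) (i : Fin m) (s : MaxState m dom)
    (e : Fin m × Option (Fin m)) : Timed (MaxState m dom) :=
  match e.2 with
  | some w => do
      let msg ← groupBy (A i ∩ A e.1 ∩ A w) maxRow (s.tbl e.1)
      let j ← lookupJoin (A i ∩ A e.1 ∩ A w) (s.tbl w) msg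
      let rows ← mapT (fun r => do
        match r.2 with
        | none => do
            tick 0
            pure none
        | some y => do
            tick ((A i).card + arith r.1.2 y.2)
            pure (some ((s.reg w).piecewise r.1.1 y.1, r.1.2 * y.2))) j
      ticks rows.length
      tick (A i).card
      pure { s with
        tbl := Function.update s.tbl w rows.reduceOption
        reg := Function.update s.reg w (s.reg w ∪ s.reg e.1) }
  | none => do
      let b ← bestRow (s.tbl e.1)
      match b with
      | none => do
          tick 0
          pure { s with best := (s.best.1, 0) }
      | some y => do
          tick ((A i).card + arith s.best.2 y.2)
          pure { s with
            best := (s.bestReg.piecewise s.best.1 y.1, s.best.2 * y.2)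
            bestReg := s.bestReg ∪ s.reg e.1 }

/-- Step III at node `i`: a row of the multiplicity table of `i` with the largest count. The
multiplicity table itself is not written out, it is kept as the join of the topjoin of `i` and the
botjoins of the children of `i`; this join is over the attribute sets `A i ∩ A j`, where `j`
is the parent or a child of `i`, and is processed along a GYO decomposition. -/
def nodeMax (T : JoinTree A) (bot top : Fin m → List ((∀ a, dom a) × ℕ)) (i : Fin m) :
    Timed ((∀ a, dom a) × ℕ) := do
  ticks (T.nbrs i).length
  let P ← gyo (fun j => A i ∩ A j) (2 * (T.nbrs i).length) (T.nbrs i) (T.nbrs i)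
  let s ← foldT (maxStep A i) P
    { tbl := fun j => if T.parent i = some j then top i else bot j
      reg := fun j => A i ∩ A j
      best := (fun _ => default, 1)
      bestReg := ∅ }
  pure s.best

/-- The result of the algorithm: the local sensitivity, a most sensitive tuple and its relation,
and the botjoins and topjoins. -/
structure Output (A : Fin m → Finset α) (dom : α → Type) where
  ls : ℕ
  rel : Fin m
  tuple : Tup dom (A rel)
  bot : Fin m → List ((∀ a, dom a) × ℕ)
  top : Fin m → List ((∀ a, dom a) × ℕ)

/-- Steps III and IV: the largest entry of all the multiplicity tables, with its relation. -/
def selectMax (T : JoinTree A) (bot top : Fin m → List ((∀ a, dom a) × ℕ)) :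
    Timed (Fin m × ((∀ a, dom a) × ℕ)) :=
  foldT (fun b i => do
    let r ← nodeMax T bot top i
    tick (arith b.2.2 r.2)
    if b.2.2 < r.2 then pure (i, r) else pure b)
    T.postOrder (T.root, ((fun _ => default), 0))

/-- The algorithm: botjoins from the leaves to the root, topjoins from the root to the leaves,
then the largest entry of the multiplicity tables. If there are fewer than `m - 1` tuples, then two
relations are empty, and all the multiplicity tables are. -/
def lsAcyclicJoin (T : JoinTree A) (D : ∀ i, List (Tup dom (A i))) : Timed (Output A dom) := do
  let bot ← foldT (botStep T D) T.postOrder fun _ => []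
  let top ← foldT (topStep T D bot) T.postOrder.reverse fun _ => []
  ticks (m + ∑ i, (D i).length)
  let b ← if m ≤ (∑ i, (D i).length) + 1 then selectMax T bot top
    else pure (T.root, ((fun _ => default), 0))
  tick (A b.1).card
  pure ⟨b.2.2, b.1, (A b.1).restrict b.2.1, bot, top⟩

/-- The multiplicity table of node `i`: the multiplicity of the tuple `t` in the join of the topjoin
of `i` (unless `i` is the root) and the botjoins of the children of `i`. -/
def multTable (T : JoinTree A) (bot top : Fin m → List ((∀ a, dom a) × ℕ)) (i : Fin m)
    (t : Tup dom (A i)) : ℕ :=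
  (if T.parent i = none then 1 else tableCount (T.sep i) (top i) (extend (A i) t)) *
    ((T.children i).map fun c => tableCount (T.sep c) (bot c) (extend (A i) t)).prod

end Algorithm

end Tables

end JoinLS

/-! Sensitivities. Without self-joins the multiplicity of an output tuple is a product with one
factor per relation, hence linear in the multiplicity of its projection to `A i`. Inserting `t`
adds, and deleting a present copy removes, the same bag: the output tuples that project to `t`,
weighted by the other relations. Deleting an absent tuple changes nothing. So the tuple sensitivity
is the upward one (`tupleSens_eq_upSens`), and it counts the ways to choose one tuple from each
other relation such that these agree with each other and with `t`. This number is `joinCount`, a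
count by nested loops. It does not depend on the order of the loops (`joinCount_perm`), and it
factors over groups of relations that share only attributes whose values are already fixed
(`joinCount_append`).

The tree. Cutting the edge above `c` separates the relations into two groups that share only the
attributes of that edge (`JoinTree.inter_subset_of_desc`). Hence the counts factor at every node.
The botjoin of a node holds the counts of its subtree, the topjoin those of the complement
(`joinCount_sub`, `joinCount_subCompl`), and their product at `i`, over all neighbours, counts all
the relations except `i` (`joinCount_erase`).

The maximum. The multiplicity table of `i` is thus a product of one factor per neighbour `j`, and
this factor depends only on `A i ∩ A j`. Intersecting with `A i` preserves ears
(`GYOAcyclic.inter_left`), so double acyclicity makes this product acyclic, and it can be maximised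
by eliminating ears: the best row of an ear, for given values of the attributes shared with its
witness, is multiplied into the table of the witness (`maxStep_some_spec`). No table grows. The ears
are found greedily: any ear may be removed first (`GYOAcyclic.erase`), and only the witness of a
removed ear can become a new ear (`IsEar.of_erase`), so the number of tests is linear in the degree.

The cost. A node of degree `δ` costs about `δ + 1` sorts of its own tuples or of its neighbours'
tables, and `(δ + 1) ^ 2` steps for the GYO decomposition. Adjacency is symmetric, so sums over
neighbours can be charged to the neighbours; `DegreeBound` records what is needed of the degrees.
The quadratic term could exceed the bound only when `m` is large compared with `n`; but for `m > n +
1` some relation other than `i` is empty, for every `i`, and all sensitivities vanish. Finally, all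
counts have polynomially many bits, so one number `W` bounds the finer cost of each step. -/

set_option linter.unusedSectionVars false

namespace JoinLS

/-! ## Reasoning about timed programs -/

/-- The result of `x` satisfies `P`, `x` takes at most `t` steps, and no step costs more
than `W`. -/
structure Timed.Spec {β : Type} (x : Timed β) (P : β → Prop) (t W : ℕ) : Prop where
  val : P x.val
  steps : x.steps ≤ t
  work : x.work ≤ W * x.steps

namespace Timed.Spec

variable {β γ σ : Type} {W : ℕ}

theorem mono {x : Timed β} {P Q : β → Prop} {t t' : ℕ} (h : x.Spec P t W)
    (hPQ : ∀ b, P b → Q b) (ht : t ≤ t') : x.Spec Q t' W :=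
  ⟨hPQ _ h.val, h.steps.trans ht, h.work⟩

theorem le {x : Timed β} {P : β → Prop} {t t' : ℕ} (h : x.Spec P t W)
    (ht : t ≤ t') : x.Spec P t' W := h.mono (fun _ => id) ht

theorem pure {b : β} {P : β → Prop} (h : P b) : (pure b : Timed β).Spec P 0 W :=
  ⟨h, le_rfl, Nat.zero_le _⟩

/-- Bounding the work by `W` per step, rather than by a separate total, makes the same `W` survive
composition, so that only steps have to be counted from here on. -/
theorem bind {x : Timed β} {f : β → Timed γ} {P : β → Prop} {Q : γ → Prop} {t t' : ℕ}
    (hx : x.Spec P t W) (hf : ∀ b, P b → (f b).Spec Q t' W) : (x >>= f).Spec Q (t + t') W := by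
  have h := hf _ hx.val
  refine ⟨h.val, Nat.add_le_add hx.steps h.steps, ?_⟩
  change x.work + (f x.val).work ≤ W * (x.steps + (f x.val).steps)
  rw [mul_add]
  exact Nat.add_le_add hx.work h.work

theorem tick {w : ℕ} (h : w + 1 ≤ W) : (tick w).Spec (fun _ => True) 1 W :=
  ⟨trivial, le_rfl, by simpa [JoinLS.tick] using h⟩

theorem tick_pure {w : ℕ} (h : w + 1 ≤ W) (b : β) :
    (do JoinLS.tick w; Pure.pure b : Timed β).Spec (· = b) 1 W :=
  (tick h).bind fun _ _ => pure (P := (· = b)) rfl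

theorem ticks {q : ℕ} (h : 1 ≤ W) : (ticks q).Spec (fun _ => True) q W :=
  ⟨trivial, le_rfl, by simpa [JoinLS.ticks] using Nat.mul_le_mul_right q h⟩

theorem mapT {f : β → Timed γ} {g : β → γ} {t : ℕ} (hW : 1 ≤ W) :
    ∀ l : List β, (∀ b ∈ l, (f b).Spec (· = g b) t W) →
      (mapT f l).Spec (· = l.map g) (l.length * (t + 1) + 1) W
  | [], _ => by
      refine ((tick (w := 0) hW).bind fun _ _ => pure ?_).le (Nat.le_add_left _ _)
      rfl
  | b :: l, h => by
      refine ((tick (w := 0) hW).bind fun _ _ => (h b (by simp)).bind fun c hc =>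
        (mapT hW l fun b hb => h b (by simp [hb])).bind fun r hr => pure ?_).le ?_
      · rw [hc, hr, List.map_cons]
      · simp only [List.length_cons]; linarith

/-- The invariant refers to the processed prefix, and a step is given the splitting of `l` at the
current element. In a traversal of the tree this tells which nodes have been handled. -/
theorem foldT {f : σ → β → Timed σ} {cost : β → ℕ} (hW : 1 ≤ W) (I : List β → σ → Prop) :
    ∀ (l pre : List β) (s : σ),
      (∀ p b r, l = p ++ b :: r → ∀ s, I (pre ++ p) s →
        (f s b).Spec (I (pre ++ p ++ [b])) (cost b) W) → I pre s →
      (foldT f l s).Spec (I (pre ++ l)) ((l.map fun b => cost b + 1).sum + 1) W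
  | [], pre, s, _, h0 =>
      ((tick (w := 0) hW).bind fun _ _ => pure (by simpa using h0)).le (by simp)
  | b :: l, pre, s, h, h0 => by
      refine ((tick (w := 0) hW).bind fun _ _ => (h [] b l rfl s (by simpa using h0)).bind
        (t' := (l.map fun b => cost b + 1).sum + 1) fun s' hs' => ?_).le ?_
      · have := foldT hW I l (pre ++ [b]) s' (fun p b' r hl s hs => by
          have := h (b :: p) b' r (by simp [hl]) s (by simpa using hs)
          simpa using this) (by simpa using hs')
        simpa using this
      · simp only [List.map_cons, List.sum_cons]; omega

end Timed.Spec

/-! ## Acyclic hypergraphs -/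

section Hypergraph

variable {α ι : Type} [DecidableEq α] [DecidableEq ι] {E : ι → Finset α}

theorem IsEar.inter_left {s : Finset ι} {i : ι} (h : IsEar E s i) (X : Finset α) :
    IsEar (fun j => X ∩ E j) s i := by
  refine ⟨h.1, h.2.imp (fun h j hj hji => ?_) ?_⟩
  · exact (h j hj hji).mono Finset.inter_subset_right Finset.inter_subset_right
  · rintro ⟨w, hw, hwi, h⟩
    refine ⟨w, hw, hwi, fun j hj hji a ha => ?_⟩
    simp only [Finset.mem_inter] at ha ⊢
    exact ⟨ha.1.1, h j hj hji (Finset.mem_inter.2 ⟨ha.1.2, ha.2.2⟩)⟩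

/-- The same ears in the same order, with the same witnesses, remain valid. This is what turns
double acyclicity into the acyclicity of the join that defines a multiplicity table. -/
theorem GYOAcyclic.inter_left {s : Finset ι} (h : GYOAcyclic E s) (X : Finset α) :
    GYOAcyclic (fun j => X ∩ E j) s := by
  induction h with
  | empty => exact .empty
  | ear s i hi _ ih => exact .ear s i (hi.inter_left X) ih

/-- A witness of `i` other than `j` survives the removal of `j`. If it is `j`, then a witness of `j`
takes over, or `i` becomes isolated if `j` has none. The only obstruction is that `i` and `j` are
witnesses of each other, and then they meet every other hyperedge in the same set. -/
theorem IsEar.erase_of_ne {s : Finset ι} {i j : ι} (hi : IsEar E s i) (hj : IsEar E s j)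
    (hij : i ≠ j) :
    IsEar E (s.erase j) i ∨ ∀ k ∈ s, k ≠ i → k ≠ j → E i ∩ E k = E j ∩ E k := by
  obtain ⟨his, hi | ⟨w, hw, hwi, hi⟩⟩ := hi
  · exact .inl ⟨Finset.mem_erase.2 ⟨hij, his⟩, .inl fun k hk hki =>
      hi k (Finset.mem_of_mem_erase hk) hki⟩
  by_cases hwj : w = j
  · subst hwj
    obtain ⟨hjs, hj | ⟨w', hw', hwj', hj⟩⟩ := hj
    · refine .inl ⟨Finset.mem_erase.2 ⟨hij, his⟩, .inl fun k hk hki => ?_⟩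
      obtain ⟨hkw, hk⟩ := Finset.mem_erase.1 hk
      refine Finset.disjoint_left.2 fun a ha ha' => ?_
      exact Finset.disjoint_left.1 (hj k hk hkw) (hi k hk hki (Finset.mem_inter.2 ⟨ha, ha'⟩)) ha'
    · by_cases hwi' : w' = i
      · subst hwi'
        refine .inr fun k hk hki hkw => ?_
        ext a
        simp only [Finset.mem_inter]
        exact ⟨fun h => ⟨hi k hk hki (Finset.mem_inter.2 h), h.2⟩,
          fun h => ⟨hj k hk hkw (Finset.mem_inter.2 h), h.2⟩⟩
      · refine .inl ⟨Finset.mem_erase.2 ⟨hij, his⟩, .inr ⟨w', Finset.mem_erase.2 ⟨hwj', hw'⟩, hwi',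
          fun k hk hki a ha => ?_⟩⟩
        obtain ⟨hkw, hk⟩ := Finset.mem_erase.1 hk
        exact hj k hk hkw (Finset.mem_inter.2 ⟨hi k hk hki ha, (Finset.mem_inter.1 ha).2⟩)
  · exact .inl ⟨Finset.mem_erase.2 ⟨hij, his⟩, .inr ⟨w, Finset.mem_erase.2 ⟨hwj, hw⟩, hwi,
      fun k hk hki => hi k (Finset.mem_of_mem_erase hk) hki⟩⟩

/-- A hyperedge may be replaced by one that meets the others in the same way. -/
theorem GYOAcyclic.replace {u : Finset ι} (h : GYOAcyclic E u) {i j : ι} :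
    ∀ {t : Finset ι}, i ∉ t → j ∉ t → (∀ k ∈ t, E i ∩ E k = E j ∩ E k) → u = insert j t →
      GYOAcyclic E (insert i t) := by
  induction h with
  | empty => intro t _ _ _ h; exact absurd h.symm (Finset.insert_ne_empty _ _)
  | ear s x hx hs ih =>
    rintro t hi hj ht rfl
    -- If the ear removed first is `j`, then `i` is an ear in its place. Any other ear stays one,
    -- with `i` instead of `j` as its witness if need be.
    by_cases hxj : x = j
    · subst hxj
      rw [Finset.erase_insert hj] at hs
      refine .ear _ i ⟨by simp, ?_⟩ (by rwa [Finset.erase_insert hi])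
      refine hx.2.imp (fun h k hk hki => ?_) ?_
      · have hk' : k ∈ t := (Finset.mem_insert.1 hk).resolve_left hki
        have := h k (by simp [hk']) (by rintro rfl; exact hj hk')
        rw [Finset.disjoint_iff_inter_eq_empty] at this ⊢
        rw [ht k hk', this]
      · rintro ⟨w, hw, hwx, h⟩
        have hw' : w ∈ t := (Finset.mem_insert.1 hw).resolve_left hwx
        refine ⟨w, by simp [hw'], by rintro rfl; exact hi hw', fun k hk hki => ?_⟩
        have hk' : k ∈ t := (Finset.mem_insert.1 hk).resolve_left hki
        rw [ht k hk']
        exact h k (by simp [hk']) (by rintro rfl; exact hj hk')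
    · have hxt : x ∈ t := (Finset.mem_insert.1 hx.1).resolve_left hxj
      have hxi : x ≠ i := by rintro rfl; exact hi hxt
      have key : E x ∩ E i = E x ∩ E j := by
        rw [Finset.inter_comm, ht x hxt, Finset.inter_comm]
      refine .ear _ x ⟨by simp [hxt], ?_⟩ ?_
      · obtain ⟨-, h | ⟨w, hw, hwx, h⟩⟩ := hx
        · refine .inl fun k hk hkx => ?_
          rcases Finset.mem_insert.1 hk with rfl | hk
          · rw [Finset.disjoint_iff_inter_eq_empty, key,
              ← Finset.disjoint_iff_inter_eq_empty]
            exact h j (by simp) (Ne.symm hxj)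
          · exact h k (by simp [hk]) hkx
        · rcases Finset.mem_insert.1 hw with rfl | hw
          · refine .inr ⟨i, by simp, hxi.symm, fun k hk hkx a ha => ?_⟩
            rcases Finset.mem_insert.1 hk with rfl | hk
            · exact (Finset.mem_inter.1 ha).2
            · have h1 := h k (by simp [hk]) hkx ha
              have h2 : a ∈ E x ∩ E w := Finset.mem_inter.2 ⟨(Finset.mem_inter.1 ha).1, h1⟩
              rw [← key] at h2
              exact (Finset.mem_inter.1 h2).2
          · refine .inr ⟨w, by simp [hw], hwx, fun k hk hkx => ?_⟩
            rcases Finset.mem_insert.1 hk with rfl | hk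
            · rw [key]; exact h j (by simp) (Ne.symm hxj)
            · exact h k (by simp [hk]) hkx
      · rw [Finset.erase_insert_of_ne (Ne.symm hxi)]
        refine ih (t := t.erase x) (fun h => hi (Finset.mem_of_mem_erase h))
          (fun h => hj (Finset.mem_of_mem_erase h))
          (fun k hk => ht k (Finset.mem_of_mem_erase hk)) ?_
        rw [Finset.erase_insert_of_ne (Ne.symm hxj)]

/-- The removal of an arbitrary ear preserves acyclicity. -/
theorem GYOAcyclic.erase {s : Finset ι} (h : GYOAcyclic E s) {i : ι} (hi : IsEar E s i) :
    GYOAcyclic E (s.erase i) := by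
  induction h with
  | empty => simp [IsEar] at hi
  | ear s j hj hs ih =>
    by_cases hij : i = j
    · rwa [hij]
    have hcomm : (s.erase i).erase j = (s.erase j).erase i := Finset.erase_right_comm
    -- Confluence: either each of the two ears survives the removal of the other and the removals
    -- commute, or the two hyperedges meet the rest equally and can be exchanged by `replace`.
    rcases hi.erase_of_ne hj hij with h | h
    · rcases hj.erase_of_ne hi (Ne.symm hij) with h' | h'
      · exact .ear _ j h' (hcomm ▸ ih h)
      · have := hs.replace (i := j) (j := i) (t := (s.erase i).erase j) (by simp) (by simp)
          (fun k hk => by simp at hk; exact h' k hk.2.2 hk.1 hk.2.1)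
          (by rw [hcomm, Finset.insert_erase (Finset.mem_erase.2 ⟨hij, hi.1⟩)])
        rwa [Finset.insert_erase (Finset.mem_erase.2 ⟨Ne.symm hij, hj.1⟩)] at this
    · have := hs.replace (i := j) (j := i) (t := (s.erase i).erase j) (by simp) (by simp)
          (fun k hk => by simp at hk; exact (h k hk.2.2 hk.2.1 hk.1).symm)
          (by rw [hcomm, Finset.insert_erase (Finset.mem_erase.2 ⟨hij, hi.1⟩)])
      rwa [Finset.insert_erase (Finset.mem_erase.2 ⟨Ne.symm hij, hj.1⟩)] at this

theorem GYOAcyclic.exists_isEar {s : Finset ι} (h : GYOAcyclic E s) (hs : s ≠ ∅) :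
    ∃ i, IsEar E s i := by
  cases h with
  | empty => exact absurd rfl hs
  | ear s i hi _ => exact ⟨i, hi⟩

/-- With at most one other hyperedge, that one is a witness. This settles path queries, whose nodes
have at most two neighbours. -/
theorem gyoAcyclic_of_card_le_two {s : Finset ι} (h : s.card ≤ 2) : GYOAcyclic E s := by
  induction s using Finset.strongInduction with
  | H s ih =>
    rcases s.eq_empty_or_nonempty with rfl | ⟨i, hi⟩
    · exact .empty
    refine .ear s i ⟨hi, ?_⟩ (ih _ (Finset.erase_ssubset hi)
      ((Finset.card_le_card (Finset.erase_subset _ _)).trans h))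
    by_cases hw : ∃ w ∈ s, w ≠ i
    · obtain ⟨w, hw, hwi⟩ := hw
      refine .inr ⟨w, hw, hwi, fun j hj hji => ?_⟩
      obtain rfl : j = w := by
        by_contra hjw
        have : ({i, j, w} : Finset ι) ⊆ s := by
          intro x hx; simp at hx; rcases hx with rfl | rfl | rfl <;> assumption
        have := Finset.card_le_card this
        rw [Finset.card_insert_of_notMem (by simp [Ne.symm hji, Ne.symm hwi]),
          Finset.card_pair hjw] at this
        omega
      exact Finset.inter_subset_right
    · push Not at hw
      exact .inl fun j hj hji => absurd (hw j hj) hji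

end Hypergraph

end JoinLS

namespace JoinLS

/-! ## Tables -/

section Tables

variable {α : Type} [LinearOrder α] {dom : α → Type} [∀ a, LinearOrder (dom a)] {W : ℕ}

open Timed

theorem key_eq_iff {S : Finset α} {v v' : ∀ a, dom a} :
    key S v = key S v' ↔ ∀ a ∈ S, v a = v' a := by
  constructor
  · intro h a ha
    exact congrFun (toLex.injective h) ⟨a, ha⟩
  · intro h
    exact congrArg toLex (funext fun a => h a a.2)

theorem key_eq_mono {S S' : Finset α} (hS : S ⊆ S') {v v' : ∀ a, dom a}
    (h : key S' v = key S' v') : key S v = key S v' :=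
  key_eq_iff.2 fun a ha => key_eq_iff.1 h a (hS ha)

/-- The rows are sorted by their projections to `S`. -/
def SortedBy {X : Type} (S : Finset α) (l : List ((∀ a, dom a) × X)) : Prop :=
  l.Pairwise fun x y => key S x.1 ≤ key S y.1

/-- The rows are sorted by their projections to `S`, which are distinct. -/
def StrictBy {X : Type} (S : Finset α) (l : List ((∀ a, dom a) × X)) : Prop :=
  l.Pairwise fun x y => key S x.1 < key S y.1

theorem mergeRows_spec {X : Type} (S : Finset α) (hW : S.card + 1 ≤ W) :
    ∀ l l' : List ((∀ a, dom a) × X), (mergeRows S l l').Spec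
      (fun r => r.Perm (l ++ l') ∧ (SortedBy S l → SortedBy S l' → SortedBy S r))
      (l.length + l'.length + 1) W
  | [], l => by
      rw [mergeRows]
      refine ((Spec.tick (w := 0) (by omega)).bind fun _ _ => Spec.pure ?_).le (by omega)
      exact ⟨.refl _, fun _ h => h⟩
  | x :: l, [] => by
      rw [mergeRows]
      refine ((Spec.tick (w := 0) (by omega)).bind fun _ _ => Spec.pure ?_).le (by simp)
      exact ⟨by simp, fun h _ => h⟩
  | x :: l, y :: l' => by
      rw [mergeRows]
      refine ((Spec.tick hW).bind (t' := l.length + l'.length + 2) fun _ _ => ?_).le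
        (by simp; omega)
      split_ifs with h
      · refine ((mergeRows_spec S hW l (y :: l')).bind fun r hr => Spec.pure ?_).le
          (by simp; omega)
        refine ⟨by simpa using hr.1, fun h1 h2 => ?_⟩
        obtain ⟨h1x, h1⟩ := List.pairwise_cons.1 h1
        refine List.pairwise_cons.2 ⟨fun z hz => ?_, hr.2 h1 h2⟩
        obtain ⟨h2y, -⟩ := List.pairwise_cons.1 h2
        rcases List.mem_append.1 (hr.1.mem_iff.1 hz) with hz | hz
        · exact h1x z hz
        · rcases List.mem_cons.1 hz with rfl | hz
          · exact h
          · exact h.trans (h2y z hz)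
      · refine ((mergeRows_spec S hW (x :: l) l').bind fun r hr => Spec.pure ?_).le
          (by simp; omega)
        refine ⟨?_, fun h1 h2 => ?_⟩
        · exact (hr.1.cons y).trans List.perm_middle.symm
        obtain ⟨h2x, h2⟩ := List.pairwise_cons.1 h2
        refine List.pairwise_cons.2 ⟨fun z hz => ?_, hr.2 h1 h2⟩
        obtain ⟨h1y, -⟩ := List.pairwise_cons.1 h1
        rcases List.mem_append.1 (hr.1.mem_iff.1 hz) with hz | hz
        · rcases List.mem_cons.1 hz with rfl | hz
          · exact (not_le.1 h).le
          · exact (not_le.1 h).le.trans (h1y z hz)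
        · exact h2x z hz
termination_by l l' => l.length + l'.length

theorem sortRows_spec_clog {X : Type} (S : Finset α) (hW : S.card + 1 ≤ W)
    (l : List ((∀ a, dom a) × X)) : (sortRows S l).Spec
      (fun r => r.Perm l ∧ SortedBy S r) (4 * (l.length * Nat.clog 2 l.length) + 1) W := by
  rw [sortRows]
  split_ifs with h
  · refine ((Spec.tick (w := 0) (by omega)).bind fun _ _ => Spec.pure ⟨.refl _, ?_⟩).le (by omega)
    match l, h with
    | [], _ => exact .nil
    | [x], _ => exact List.pairwise_singleton _ _
  · have hl : 2 ≤ l.length := by omega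
    refine ((Spec.ticks (by omega)).bind fun _ _ =>
      (sortRows_spec_clog S hW (l.take (l.length / 2))).bind fun x hx =>
      (sortRows_spec_clog S hW (l.drop (l.length / 2))).bind (t' := l.length + 1) fun y hy =>
      ((mergeRows_spec S hW x y).mono ?_ ?_)).le ?_
    · rintro r ⟨h1, h2⟩
      refine ⟨h1.trans ((hx.1.append hy.1).trans ?_), h2 hx.2 hy.2⟩
      rw [List.take_append_drop]
    · rw [hx.1.length_eq, hy.1.length_eq]
      simp only [List.length_take, List.length_drop]; omega
    · have e1 : (l.take (l.length / 2)).length = l.length / 2 := by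
        simp only [List.length_take]; omega
      have e2 : (l.drop (l.length / 2)).length = l.length - l.length / 2 := by
        simp only [List.length_drop]
      rw [e1, e2]
      -- The larger half has `⌈n/2⌉` rows, for which `Nat.clog` is smaller by one; this frees `4 n`
      -- steps, enough for splitting and merging.
      have h0 : Nat.clog 2 l.length = Nat.clog 2 ((l.length + 1) / 2) + 1 := by
        rw [Nat.clog_of_two_le (by omega) hl]
        congr 3
      have h1 : Nat.clog 2 (l.length / 2) ≤ Nat.clog 2 ((l.length + 1) / 2) :=
        Nat.clog_mono_right _ (by omega)
      have h2 : l.length - l.length / 2 = (l.length + 1) / 2 := by omega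
      rw [h0, h2]
      set c := Nat.clog 2 ((l.length + 1) / 2)
      have h3 := Nat.mul_le_mul_left (l.length / 2) h1
      have h4 : l.length * (c + 1) = (l.length / 2) * c + ((l.length + 1) / 2) * c + l.length := by
        rw [mul_add, ← add_mul]; congr 2 <;> omega
      rw [h4]
      omega
termination_by l.length
decreasing_by
  · simp only [List.length_take]; omega
  · simp only [List.length_drop]; omega

theorem sortRows_spec {X : Type} (S : Finset α) (hW : S.card + 1 ≤ W)
    (l : List ((∀ a, dom a) × X)) {Λ : ℕ} (hΛ : Nat.clog 2 l.length ≤ Λ) : (sortRows S l).Spec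
      (fun r => r.Perm l ∧ SortedBy S r) (4 * (l.length * Λ) + 1) W :=
  (sortRows_spec_clog S hW l).le (by gcongr)

/-! ### Group-by -/

theorem tableCount_cons (S : Finset α) (r : (∀ a, dom a) × ℕ) (l : List ((∀ a, dom a) × ℕ))
    (v : ∀ a, dom a) :
    tableCount S (r :: l) v = (if key S r.1 = key S v then r.2 else 0) + tableCount S l v := by
  unfold tableCount
  by_cases h : key S r.1 = key S v <;> simp [h]

theorem tableCount_perm {S : Finset α} {l l' : List ((∀ a, dom a) × ℕ)} (h : l.Perm l')
    (v : ∀ a, dom a) : tableCount S l v = tableCount S l' v :=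
  ((h.filter _).map _).sum_eq

theorem tableCount_eq_zero {S : Finset α} {l : List ((∀ a, dom a) × ℕ)} {v : ∀ a, dom a}
    (h : ∀ r ∈ l, key S r.1 ≠ key S v) : tableCount S l v = 0 := by
  unfold tableCount
  rw [List.filter_eq_nil_iff.2 (by simpa using h)]
  rfl

theorem tableCount_eq_of_mem {S : Finset α} {l : List ((∀ a, dom a) × ℕ)} (hl : StrictBy S l)
    {r : (∀ a, dom a) × ℕ} (hr : r ∈ l) {v : ∀ a, dom a} (h : key S r.1 = key S v) :
    tableCount S l v = r.2 := by
  induction l with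
  | nil => simp at hr
  | cons x l ih =>
    obtain ⟨h1, h2⟩ := List.pairwise_cons.1 hl
    rw [tableCount_cons]
    rcases List.mem_cons.1 hr with rfl | hr
    · rw [if_pos h, tableCount_eq_zero, add_zero]
      intro y hy
      rw [← h]
      exact (h1 y hy).ne'
    · rw [if_neg, zero_add, ih h2 hr]
      rw [← h]
      exact (h1 r hr).ne

/-- The properties of the output `g` of a group-by with combination `f` that do not depend
on `f`. -/
structure Grouped (S : Finset α) (l g : List ((∀ a, dom a) × ℕ)) : Prop where
  strict : StrictBy S g
  length_le : g.length ≤ l.length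

/-- The last three clauses serve the induction only. Equality of the sums bounds the bit length of
the head of the collapsed tail, nonemptiness identifies the case of a single row, and lower bounds
on the keys pass from the input to the output, so that the new row does not lie above that head. -/
theorem collapse_add_spec (S : Finset α) {Z : ℕ} (hW : S.card + (Z + 1) ^ 2 + 1 ≤ W) :
    ∀ l : List ((∀ a, dom a) × ℕ), SortedBy S l → (l.map Prod.snd).sum.size ≤ Z →
      (collapse S addRow l).Spec
        (fun g => Grouped S l g ∧ (∀ v, tableCount S g v = tableCount S l v) ∧
          (g.map Prod.snd).sum = (l.map Prod.snd).sum ∧ (l ≠ [] → g ≠ []) ∧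
          ∀ b : Lex (∀ a : S, dom a), (∀ r ∈ l, b ≤ key S r.1) → ∀ r ∈ g, b ≤ key S r.1)
        (l.length + 1) W
  | [], _, _ => by
      rw [collapse]
      refine ((Spec.tick (w := 0) (by omega)).bind fun _ _ => Spec.pure ?_).le (by simp)
      exact ⟨⟨.nil, le_rfl⟩, by simp⟩
  | r :: l, hl, hs => by
      obtain ⟨hr, hl⟩ := List.pairwise_cons.1 hl
      have hs' : (l.map Prod.snd).sum.size ≤ Z :=
        (Nat.size_le_size (by simp)).trans hs
      have hr2 : r.2.size ≤ Z := (Nat.size_le_size (by simp)).trans hs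
      rw [collapse]
      refine ((collapse_add_spec S hW l hl hs').bind (t' := 1) fun out hout => ?_).le (by simp)
      obtain ⟨⟨h1, h2⟩, h3, h4, h5, h6⟩ := hout
      match out with
      | [] =>
        refine ((Spec.tick (w := 0) (by omega)).bind fun _ _ => Spec.pure ?_).le le_rfl
        have : l = [] := by by_contra h; exact h5 h rfl
        subst this
        exact ⟨⟨List.pairwise_singleton _ _, by simp⟩, by simp⟩
      | r' :: o =>
        have hr' : r'.2.size ≤ Z := by
          refine (Nat.size_le_size ?_).trans hs'
          rw [← h4]; simp
        have ha : arith r.2 r'.2 ≤ (Z + 1) ^ 2 := by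
          rw [arith, sq]; gcongr
        refine ((Spec.tick (by omega)).bind (t' := 0) fun _ _ => ?_).le le_rfl
        obtain ⟨g1, g2⟩ := List.pairwise_cons.1 h1
        have hrr' : key S r.1 ≤ key S r'.1 := h6 _ hr r' (by simp)
        split_ifs with h
        · refine Spec.pure ⟨⟨List.pairwise_cons.2 ⟨fun z hz => ?_, g2⟩, ?_⟩, fun v => ?_, ?_, ?_, ?_⟩
          · simpa [addRow, h] using g1 z hz
          · simp only [List.length_cons] at h2 ⊢; omega
          · rw [tableCount_cons, tableCount_cons, ← h3, tableCount_cons]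
            simp only [addRow, h]
            split_ifs <;> omega
          · simp only [List.map_cons, List.sum_cons, addRow] at h4 ⊢; omega
          · simp
          · intro b hb z hz
            rcases List.mem_cons.1 hz with rfl | hz
            · exact hb r (by simp)
            · exact h6 b (fun z hz => hb z (by simp [hz])) z (by simp [hz])
        · have hlt := lt_of_le_of_ne hrr' h
          refine Spec.pure ⟨⟨List.pairwise_cons.2 ⟨fun z hz => ?_, h1⟩, ?_⟩, fun v => ?_, ?_, ?_, ?_⟩
          · rcases List.mem_cons.1 hz with rfl | hz
            · exact hlt
            · exact hlt.trans (g1 z hz)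
          · simp only [List.length_cons] at h2 ⊢; omega
          · rw [tableCount_cons, h3, tableCount_cons]
          · simp only [List.map_cons, List.sum_cons] at h4 ⊢; omega
          · simp
          · intro b hb z hz
            rcases List.mem_cons.1 hz with rfl | hz
            · exact hb _ (by simp)
            · exact h6 b (fun z hz => hb z (by simp [hz])) z hz

theorem groupBy_add_spec (S : Finset α) {Z : ℕ} (hW : S.card + (Z + 1) ^ 2 + 1 ≤ W)
    (l : List ((∀ a, dom a) × ℕ)) (hs : (l.map Prod.snd).sum.size ≤ Z) {Λ : ℕ}
    (hΛ : Nat.clog 2 l.length ≤ Λ) :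
    (groupBy S addRow l).Spec
      (fun g => Grouped S l g ∧ ∀ v, tableCount S g v = tableCount S l v)
      (4 * (l.length * Λ) + l.length + 2) W := by
  refine ((sortRows_spec S (by omega) l hΛ).bind fun l' hl' =>
    (collapse_add_spec S hW l' hl'.2 ?_).mono (t' := l.length + 1) ?_ ?_).le (by omega)
  · rwa [(hl'.1.map Prod.snd).sum_eq]
  · rintro g ⟨⟨h1, h2⟩, h3, -⟩
    exact ⟨⟨h1, hl'.1.length_eq ▸ h2⟩, fun v => (h3 v).trans (tableCount_perm hl'.1 v)⟩
  · rw [hl'.1.length_eq]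

/-- Unlike sums, maxima are attained by rows of the input; the output is a subset of the input, so a
bound on the single counts suffices. -/
theorem collapse_max_spec (S : Finset α) {Z : ℕ} (hW : S.card + (Z + 1) ^ 2 + 1 ≤ W) :
    ∀ l : List ((∀ a, dom a) × ℕ), SortedBy S l → (∀ r ∈ l, r.2.size ≤ Z) →
      (collapse S maxRow l).Spec
        (fun g => Grouped S l g ∧ (∀ r ∈ g, r ∈ l) ∧
          (∀ r ∈ l, ∃ r' ∈ g, key S r'.1 = key S r.1 ∧ r.2 ≤ r'.2))
        (l.length + 1) W
  | [], _, _ => by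
      rw [collapse]
      refine ((Spec.tick (w := 0) (by omega)).bind fun _ _ => Spec.pure ?_).le (by simp)
      exact ⟨⟨.nil, le_rfl⟩, by simp⟩
  | r :: l, hl, hs => by
      obtain ⟨hr, hl⟩ := List.pairwise_cons.1 hl
      rw [collapse]
      refine ((collapse_max_spec S hW l hl fun x hx => hs x (by simp [hx])).bind (t' := 1)
        fun out hout => ?_).le (by simp)
      obtain ⟨⟨h1, h2⟩, h3, h4⟩ := hout
      match out with
      | [] =>
        refine ((Spec.tick (w := 0) (by omega)).bind fun _ _ => Spec.pure ?_).le le_rfl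
        have : l = [] := List.eq_nil_iff_forall_not_mem.2 fun x hx => by
          simpa using h4 x hx
        subst this
        exact ⟨⟨List.pairwise_singleton _ _, by simp⟩, by simp⟩
      | r' :: o =>
        have hr'l := h3 r' (by simp)
        have ha : arith r.2 r'.2 ≤ (Z + 1) ^ 2 := by
          have h1 := hs r (by simp)
          have h2 := hs r' (by simp [hr'l])
          rw [arith, sq]; gcongr
        refine ((Spec.tick (by omega)).bind (t' := 0) fun _ _ => ?_).le le_rfl
        obtain ⟨g1, g2⟩ := List.pairwise_cons.1 h1
        have hrr' : key S r.1 ≤ key S r'.1 := hr _ hr'l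
        split_ifs with h
        · have hm : key S (maxRow r r').1 = key S r'.1 := by
            unfold maxRow; split_ifs <;> simp [h]
          have hm1 : r.2 ≤ (maxRow r r').2 := by
            unfold maxRow; split_ifs <;> omega
          have hm2 : r'.2 ≤ (maxRow r r').2 := by
            unfold maxRow; split_ifs <;> omega
          have hm3 : maxRow r r' = r ∨ maxRow r r' = r' := by
            unfold maxRow; split_ifs <;> simp
          refine Spec.pure ⟨⟨List.pairwise_cons.2 ⟨fun z hz => ?_, g2⟩, ?_⟩, ?_, ?_⟩
          · rw [hm]; exact g1 z hz
          · simp only [List.length_cons] at h2 ⊢; omega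
          · intro z hz
            rcases List.mem_cons.1 hz with rfl | hz
            · rcases hm3 with h | h <;> rw [h] <;> simp [hr'l]
            · exact List.mem_cons_of_mem _ (h3 z (by simp [hz]))
          · intro z hz
            rcases List.mem_cons.1 hz with rfl | hz
            · exact ⟨_, by simp, by rw [hm, h], hm1⟩
            · obtain ⟨x, hx, hx1, hx2⟩ := h4 z hz
              rcases List.mem_cons.1 hx with rfl | hx
              · exact ⟨_, by simp, by rw [hm, hx1], hx2.trans hm2⟩
              · exact ⟨x, by simp [hx], hx1, hx2⟩
        · have hlt := lt_of_le_of_ne hrr' h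
          refine Spec.pure ⟨⟨List.pairwise_cons.2 ⟨fun z hz => ?_, h1⟩, ?_⟩, ?_, ?_⟩
          · rcases List.mem_cons.1 hz with rfl | hz
            · exact hlt
            · exact hlt.trans (g1 z hz)
          · simp only [List.length_cons] at h2 ⊢; omega
          · intro z hz
            rcases List.mem_cons.1 hz with rfl | hz
            · simp
            · exact List.mem_cons_of_mem _ (h3 z hz)
          · intro z hz
            rcases List.mem_cons.1 hz with rfl | hz
            · exact ⟨_, by simp, rfl, le_rfl⟩
            · obtain ⟨x, hx, hx'⟩ := h4 z hz
              exact ⟨x, by simp [hx], hx'⟩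

theorem groupBy_max_spec (S : Finset α) {Z : ℕ} (hW : S.card + (Z + 1) ^ 2 + 1 ≤ W)
    (l : List ((∀ a, dom a) × ℕ)) (hs : ∀ r ∈ l, r.2.size ≤ Z) {Λ : ℕ}
    (hΛ : Nat.clog 2 l.length ≤ Λ) :
    (groupBy S maxRow l).Spec
      (fun g => Grouped S l g ∧ (∀ r ∈ g, r ∈ l) ∧
        (∀ r ∈ l, ∃ r' ∈ g, key S r'.1 = key S r.1 ∧ r.2 ≤ r'.2))
      (4 * (l.length * Λ) + l.length + 2) W := by
  refine ((sortRows_spec S (by omega) l hΛ).bind fun l' hl' =>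
    (collapse_max_spec S hW l' hl'.2 ?_).mono (t' := l.length + 1) ?_ ?_).le (by omega)
  · exact fun r hr => hs r (hl'.1.mem_iff.1 hr)
  · rintro g ⟨⟨h1, h2⟩, h3, h4⟩
    exact ⟨⟨h1, hl'.1.length_eq ▸ h2⟩, fun r hr => hl'.1.mem_iff.1 (h3 r hr),
      fun r hr => h4 r (hl'.1.mem_iff.2 hr)⟩
  · rw [hl'.1.length_eq]

/-! ### Sort-merge join -/

/-- The row of `tbl` that joins with `v`. -/
noncomputable def lookup (S : Finset α) (tbl : List ((∀ a, dom a) × ℕ)) (v : ∀ a, dom a) :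
    Option ((∀ a, dom a) × ℕ) :=
  tbl.find? fun y => key S v = key S y.1

theorem countOf_lookup {S : Finset α} {tbl : List ((∀ a, dom a) × ℕ)} (h : StrictBy S tbl)
    (v : ∀ a, dom a) : countOf (lookup S tbl v) = tableCount S tbl v := by
  cases hv : lookup S tbl v with
  | none =>
    refine (tableCount_eq_zero fun r hr => ?_).symm
    have := List.find?_eq_none.1 hv r hr
    simpa [eq_comm] using this
  | some y =>
    refine (tableCount_eq_of_mem h (List.mem_of_find?_eq_some hv) ?_).symm
    simpa [eq_comm] using List.find?_some hv

/-- A table row is dropped only when it lies strictly below the first remaining row, hence below all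
of them. Conversely, if the first row lies strictly below the head of the table, it lies below the
whole table and has no partner. -/
theorem mergeLookup_spec {X : Type} (S : Finset α) (hW : S.card + 1 ≤ W) :
    ∀ (l : List ((∀ a, dom a) × X)) (tbl : List ((∀ a, dom a) × ℕ)),
      SortedBy S l → StrictBy S tbl →
      (mergeLookup S l tbl).Spec (· = l.map fun x => (x, lookup S tbl x.1))
        (l.length + tbl.length + 1) W
  | [], _, _, _ => by
      rw [mergeLookup]
      refine ((Spec.tick (w := 0) (by omega)).bind fun _ _ => Spec.pure ?_).le (by omega)
      rfl
  | x :: l, [], hl, ht => by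
      rw [mergeLookup]
      refine ((Spec.tick (w := 0) (by omega)).bind fun _ _ =>
        (mergeLookup_spec S hW l [] (List.pairwise_cons.1 hl).2 ht).bind fun r hr =>
          Spec.pure ?_).le (by simp; omega)
      rw [hr]; rfl
  | x :: l, y :: tbl, hl, ht => by
      obtain ⟨hx, hl'⟩ := List.pairwise_cons.1 hl
      obtain ⟨hy, ht'⟩ := List.pairwise_cons.1 ht
      rw [mergeLookup]
      refine ((Spec.tick hW).bind (t' := l.length + tbl.length + 2) fun _ _ => ?_).le
        (by simp; omega)
      split_ifs with h h'
      · refine ((mergeLookup_spec S hW l (y :: tbl) hl' ht).bind fun r hr =>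
          Spec.pure ?_).le (by simp; omega)
        rw [hr, List.map_cons]
        congr 2
        simp [lookup, h]
      · refine ((mergeLookup_spec S hW l (y :: tbl) hl' ht).bind fun r hr =>
          Spec.pure ?_).le (by simp; omega)
        rw [hr, List.map_cons]
        congr 2
        refine (List.find?_eq_none.2 fun z hz => ?_).symm
        have hlt := lt_of_le_of_ne h' h
        rcases List.mem_cons.1 hz with rfl | hz
        · simpa using h
        · simpa using (hlt.trans (hy z hz)).ne
      · refine ((mergeLookup_spec S hW (x :: l) tbl hl ht').mono ?_ (by simp; omega))
        rintro _ rfl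
        refine List.map_congr_left fun z hz => ?_
        have hne : key S z.1 ≠ key S y.1 := by
          rcases List.mem_cons.1 hz with rfl | hz
          · exact h
          · exact ((not_le.1 h').trans_le (hx z hz)).ne'
        simp [lookup, hne]
termination_by l tbl => l.length + tbl.length

theorem lookupJoin_spec {X : Type} (S : Finset α) (hW : S.card + 1 ≤ W)
    (rows : List ((∀ a, dom a) × X)) (tbl : List ((∀ a, dom a) × ℕ)) (ht : StrictBy S tbl)
    {Λ : ℕ} (hΛ : Nat.clog 2 rows.length ≤ Λ) :
    (lookupJoin S rows tbl).Spec (fun r => r.Perm (rows.map fun x => (x, lookup S tbl x.1)))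
      (4 * (rows.length * Λ) + rows.length + tbl.length + 2) W := by
  refine ((sortRows_spec S hW rows hΛ).bind fun l hl =>
    (mergeLookup_spec S hW l tbl hl.2 ht).mono (t' := rows.length + tbl.length + 1) ?_ ?_).le
      (by omega)
  · rintro _ rfl
    exact hl.1.map _
  · rw [hl.1.length_eq]

/-! ### Products and maxima of counts -/

theorem size_mul_le (a b : ℕ) : (a * b).size ≤ a.size + b.size := by
  rw [Nat.size_le, pow_add]
  exact Nat.mul_lt_mul'' (Nat.lt_size_self a) (Nat.lt_size_self b)

/-- Each leave-one-out product is a prefix product times a suffix product, so three multiplications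
per count give all of them, without division. The bound `Z` is kept because `z` bits move from the
remaining list to `pre` at each call; the extra bit is that of the empty product `1`. -/
theorem others_spec {Z z : ℕ} (hW : (Z + 1) ^ 2 + 1 ≤ W) {ι : Type} [DecidableEq ι] (f : ι → ℕ) :
    ∀ (cs : List ι) (pre : ℕ), cs.Nodup → (∀ c ∈ cs, (f c).size ≤ z) →
      pre.size + cs.length * z + 1 ≤ Z →
      (others pre (cs.map f)).Spec
        (fun r => r.1 = cs.map (fun c => pre * ((cs.erase c).map f).prod) ∧ r.2 = (cs.map f).prod ∧
          r.2.size ≤ cs.length * z + 1)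
        (3 * cs.length + 1) W
  | [], pre, _, _, _ => by
      rw [List.map_nil, others]
      refine ((Spec.tick (w := 0) (by omega)).bind fun _ _ => Spec.pure ?_).le (by simp)
      simp
  | c :: cs, pre, hnd, hf, hZ => by
      obtain ⟨hc, hnd⟩ := List.nodup_cons.1 hnd
      have hcz := hf c (by simp)
      have hlen : (c :: cs).length * z = cs.length * z + z := by simp [add_mul]
      rw [hlen] at hZ ⊢
      have harith : ∀ a b : ℕ, a.size ≤ Z → b.size ≤ Z → arith a b + 1 ≤ W := by
        intro a b ha hb
        have : arith a b ≤ (Z + 1) ^ 2 := by rw [arith, sq]; gcongr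
        omega
      rw [List.map_cons, others]
      refine ((Spec.tick (harith _ _ (by omega) (by omega))).bind fun _ _ =>
        (others_spec hW f cs (pre * f c) hnd (fun x hx => hf x (by simp [hx])) ?_).bind
          (t' := 2) fun r hr => ?_).le (by simp; omega)
      · have := size_mul_le pre (f c); omega
      obtain ⟨h1, h2, h3⟩ := hr
      refine ((Spec.tick (harith _ _ (by omega) (by omega))).bind fun _ _ =>
        (Spec.tick (harith _ _ (by omega) (by omega))).bind fun _ _ => Spec.pure ?_).le le_rfl
      refine ⟨?_, ?_, ?_⟩
      · simp only [List.map_cons, List.erase_cons_head, h1, h2]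
        congr 1
        refine List.map_congr_left fun x hx => ?_
        rw [List.erase_cons_tail (by simpa using fun h : c = x => hc (h ▸ hx)), List.map_cons,
          List.prod_cons, mul_assoc]
      · simp [h2]
      · have := size_mul_le (f c) r.2
        simp only
        omega

theorem bestRow_spec {Z : ℕ} (hW : (Z + 1) ^ 2 + 1 ≤ W) :
    ∀ l : List ((∀ a, dom a) × ℕ), (∀ r ∈ l, r.2.size ≤ Z) →
      (bestRow l).Spec (fun b => match b with
        | none => l = []
        | some r => r ∈ l ∧ ∀ r' ∈ l, r'.2 ≤ r.2) (l.length + 1) W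
  | [], _ => by
      rw [bestRow]
      refine ((Spec.tick (w := 0) (by omega)).bind fun _ _ => Spec.pure ?_).le (by simp)
      rfl
  | r :: l, hs => by
      rw [bestRow]
      refine ((bestRow_spec hW l fun x hx => hs x (by simp [hx])).bind (t' := 1)
        fun b hb => ?_).le (by simp)
      match b, hb with
      | none, hb =>
        refine ((Spec.tick (w := 0) (by omega)).bind fun _ _ => Spec.pure ?_).le le_rfl
        simp only at hb
        simp [hb]
      | some r', ⟨h1, h2⟩ =>
        have ha : arith r.2 r'.2 ≤ (Z + 1) ^ 2 := by
          have h1 := hs r (by simp)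
          have h2 := hs r' (by simp_all)
          rw [arith, sq]; gcongr
        refine ((Spec.tick (by omega)).bind fun _ _ => Spec.pure ?_).le le_rfl
        unfold maxRow
        split_ifs with h
        · refine ⟨by simp, fun x hx => ?_⟩
          rcases List.mem_cons.1 hx with rfl | hx
          · exact le_rfl
          · exact (h2 x hx).trans h
        · refine ⟨by simp [h1], fun x hx => ?_⟩
          rcases List.mem_cons.1 hx with rfl | hx
          · omega
          · exact h2 x hx

end Tables

end JoinLS

namespace JoinLS

/-! ## Counting by nested loops -/

section Count

variable {α : Type} [LinearOrder α] {dom : α → Type} [∀ a, LinearOrder (dom a)]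
  [∀ a, Inhabited (dom a)] {m : ℕ} {A : Fin m → Finset α}

theorem extend_apply {S : Finset α} (t : Tup dom S) {a : α} (h : a ∈ S) :
    extend S t a = t ⟨a, h⟩ := dif_pos h

theorem extend_restrict (S : Finset α) (v : ∀ a, dom a) {a : α} (h : a ∈ S) :
    extend S (S.restrict v) a = v a := extend_apply _ h

/-- The number of ways to choose one tuple from each of the listed relations such that these tuples
agree with each other, and with `v` on `S`. -/
noncomputable def joinCount (D : ∀ i, List (Tup dom (A i))) :
    List (Fin m) → Finset α → (∀ a, dom a) → ℕ
  | [], _, _ => 1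
  | j :: U, S, v => ((D j).map fun t =>
      if key (S ∩ A j) (extend (A j) t) = key (S ∩ A j) v then
        joinCount D U (S ∪ A j) (S.piecewise v (extend (A j) t)) else 0).sum

variable (D : ∀ i, List (Tup dom (A i)))

/-- The count depends only on the values of those attributes in `S` that occur in the listed
relations. -/
theorem joinCount_congr : ∀ (U : List (Fin m)) {S S' : Finset α} {v v' : ∀ a, dom a},
    (∀ j ∈ U, S ∩ A j = S' ∩ A j) → (∀ j ∈ U, ∀ a ∈ S ∩ A j, v a = v' a) →
    joinCount D U S v = joinCount D U S' v'
  | [], _, _, _, _, _, _ => rfl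
  | j :: U, S, S', v, v', hS, hv => by
      unfold joinCount
      congr 1
      refine List.map_congr_left fun t _ => ?_
      have hj := hS j (by simp)
      have hk : key (S ∩ A j) v = key (S ∩ A j) v' := key_eq_iff.2 (hv j (by simp))
      rw [hk, hj]
      refine if_ctx_congr Iff.rfl (fun h => ?_) fun _ => rfl
      have hS' : ∀ k ∈ U, ∀ a ∈ A k, (a ∈ S ↔ a ∈ S') := fun k hk a ha => by
        have := congrArg (a ∈ ·) (hS k (by simp [hk]))
        simpa [ha] using this
      refine joinCount_congr U (fun k hk => ?_) fun k hk a ha => ?_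
      · ext a
        simp only [Finset.mem_inter, Finset.mem_union]
        constructor
        · rintro ⟨h1, h2⟩; exact ⟨by rwa [← hS' k hk a h2], h2⟩
        · rintro ⟨h1, h2⟩; exact ⟨by rwa [hS' k hk a h2], h2⟩
      · have hak := (Finset.mem_inter.1 ha).2
        by_cases haS : a ∈ S
        · rw [Finset.piecewise_eq_of_mem _ _ _ haS,
            Finset.piecewise_eq_of_mem _ _ _ ((hS' k hk a hak).1 haS)]
          exact hv k (by simp [hk]) a (Finset.mem_inter.2 ⟨haS, hak⟩)
        · rw [Finset.piecewise_eq_of_notMem _ _ _ haS,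
            Finset.piecewise_eq_of_notMem _ _ _ (fun h => haS ((hS' k hk a hak).2 h))]

/-- Both sides are sums over pairs of tuples that agree with `v` on `S` and with each other on `A j
∩ A k`, a condition symmetric in the two relations. -/
theorem joinCount_swap (j k : Fin m) (U : List (Fin m)) (S : Finset α) (v : ∀ a, dom a) :
    joinCount D (j :: k :: U) S v = joinCount D (k :: j :: U) S v := by
  have expand : ∀ j k : Fin m, joinCount D (j :: k :: U) S v =
      ((D j).map fun t => ((D k).map fun t' =>
        if (∀ a ∈ S ∩ A j, extend (A j) t a = v a) ∧ (∀ a ∈ S ∩ A k, extend (A k) t' a = v a) ∧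
          (∀ a ∈ A j ∩ A k, extend (A j) t a = extend (A k) t' a) then
        joinCount D U (S ∪ (A j ∪ A k))
          (S.piecewise v ((A j).piecewise (extend (A j) t) (extend (A k) t'))) else 0).sum).sum := by
    intro j k
    rw [joinCount]
    congr 1
    refine List.map_congr_left fun t _ => ?_
    by_cases h : ∀ a ∈ S ∩ A j, extend (A j) t a = v a
    · rw [if_pos (key_eq_iff.2 h), joinCount]
      congr 1
      refine List.map_congr_left fun t' _ => ?_
      refine if_ctx_congr (key_eq_iff.trans ?_) (fun h' => ?_) fun _ => rfl
      · constructor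
        · intro h'
          refine ⟨h, fun a ha => ?_, fun a ha => ?_⟩
          · obtain ⟨h1, h2⟩ := Finset.mem_inter.1 ha
            rw [h' a (by simp [h1, h2]), Finset.piecewise_eq_of_mem _ _ _ h1]
          · obtain ⟨h1, h2⟩ := Finset.mem_inter.1 ha
            rw [h' a (by simp [h1, h2])]
            by_cases haS : a ∈ S
            · rw [Finset.piecewise_eq_of_mem _ _ _ haS, h a (by simp [haS, h1])]
            · rw [Finset.piecewise_eq_of_notMem _ _ _ haS]
        · rintro ⟨-, h1, h2⟩ a ha
          simp only [Finset.mem_inter, Finset.mem_union] at ha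
          by_cases haS : a ∈ S
          · rw [Finset.piecewise_eq_of_mem _ _ _ haS, h1 a (by simp [haS, ha.2])]
          · rw [Finset.piecewise_eq_of_notMem _ _ _ haS,
              h2 a (by simp [ha.1.resolve_left haS, ha.2])]
      · refine joinCount_congr D U (fun i _ => by rw [Finset.union_assoc]) fun i _ a _ => ?_
        by_cases haS : a ∈ S
        · simp [Finset.piecewise, haS]
        · simp [Finset.piecewise, haS]
    · rw [if_neg (mt key_eq_iff.1 h)]
      symm
      apply List.sum_eq_zero
      simp only [List.mem_map]
      rintro _ ⟨t', -, rfl⟩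
      exact if_neg fun h' => h h'.1
  rw [expand j k, expand k j]
  rw [← Multiset.sum_coe, ← Multiset.map_coe, ← Multiset.sum_coe, ← Multiset.map_coe]
  simp_rw [← Multiset.sum_coe, ← Multiset.map_coe]
  rw [Multiset.sum_map_sum_map]
  refine congrArg Multiset.sum (Multiset.map_congr rfl fun t' _ => ?_)
  refine congrArg Multiset.sum (Multiset.map_congr rfl fun t _ => ?_)
  refine if_ctx_congr ?_ (fun h' => ?_) fun _ => rfl
  · rw [Finset.inter_comm (A k) (A j)]
    constructor
    · rintro ⟨h1, h2, h3⟩; exact ⟨h2, h1, fun a ha => (h3 a ha).symm⟩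
    · rintro ⟨h1, h2, h3⟩; exact ⟨h2, h1, fun a ha => (h3 a ha).symm⟩
  -- On `A j ∩ A k` the two tuples agree, so it does not matter which one takes precedence in the
  -- combined assignment.
  · refine joinCount_congr D U (fun i _ => by rw [Finset.union_comm (A j)]) fun i _ a ha => ?_
    by_cases haS : a ∈ S
    · simp [Finset.piecewise, haS]
    · have hajk : a ∈ A j ∪ A k := by
        have := (Finset.mem_inter.1 ha).1
        simpa [haS] using this
      simp only [Finset.piecewise, haS, if_false]
      by_cases haj : a ∈ A j <;> by_cases hak : a ∈ A k
      · simp only [haj, hak, if_true]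
        exact (h'.2.2 a (by simp [haj, hak])).symm
      · simp [haj, hak]
      · simp [haj, hak]
      · simp [haj, hak] at hajk

theorem joinCount_perm {U U' : List (Fin m)} (h : U.Perm U') :
    ∀ (S : Finset α) (v : ∀ a, dom a), joinCount D U S v = joinCount D U' S v := by
  induction h with
  | nil => exact fun _ _ => rfl
  | cons j _ ih => intro S v; unfold joinCount; simp_rw [ih]
  | swap j k U => exact fun S v => joinCount_swap D k j U S v
  | trans _ _ h1 h2 => exact fun S v => (h1 S v).trans (h2 S v)

/-- The choices in `U` can affect `U'` only through shared attributes. These lie in `S`, where `v`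
has fixed the values, so the two groups of loops are independent. -/
theorem joinCount_append : ∀ (U U' : List (Fin m)) {S : Finset α} (v : ∀ a, dom a),
    (∀ j ∈ U, ∀ k ∈ U', A j ∩ A k ⊆ S) →
    joinCount D (U ++ U') S v = joinCount D U S v * joinCount D U' S v
  | [], _, _, _, _ => by simp [joinCount]
  | j :: U, U', S, v, h => by
      rw [List.cons_append, joinCount, joinCount, ← List.sum_map_mul_right]
      congr 1
      refine List.map_congr_left fun t _ => ?_
      split_ifs with hk
      · rw [joinCount_append U U' _ fun j hj k hk =>
          (h j (by simp [hj]) k hk).trans Finset.subset_union_left]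
        congr 1
        have hsub : ∀ k ∈ U', ∀ a ∈ A k, a ∈ A j → a ∈ S := fun k hk a ha haj =>
          h j (by simp) k hk (Finset.mem_inter.2 ⟨haj, ha⟩)
        refine joinCount_congr D U' (fun k hk => ?_) fun k hk a ha => ?_
        · ext a
          simp only [Finset.mem_inter, Finset.mem_union]
          have := hsub k hk a
          tauto
        · simp only [Finset.mem_inter, Finset.mem_union] at ha
          have : a ∈ S := ha.1.elim id (hsub k hk a ha.2)
          exact Finset.piecewise_eq_of_mem _ _ _ this
      · simp

theorem joinCount_flatMap (f : Fin m → List (Fin m)) {S : Finset α} (v : ∀ a, dom a) :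
    ∀ cs : List (Fin m), cs.Pairwise (fun c c' => ∀ j ∈ f c, ∀ k ∈ f c', A j ∩ A k ⊆ S) →
    joinCount D (cs.flatMap f) S v = (cs.map fun c => joinCount D (f c) S v).prod
  | [], _ => rfl
  | c :: cs, h => by
      obtain ⟨h1, h2⟩ := List.pairwise_cons.1 h
      rw [List.flatMap_cons, joinCount_append, joinCount_flatMap f v cs h2, List.map_cons,
        List.prod_cons]
      intro j hj k hk
      obtain ⟨c', hc', hk⟩ := List.mem_flatMap.1 hk
      exact h1 c' hc' j hj k hk

/-- When the chosen tuple assigns all of `S`, it supersedes `v`, and the rest of the count is a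
function of the tuple alone. This is the shape of a group-by over the rows of `j`. -/
theorem joinCount_cons (j : Fin m) (U : List (Fin m)) {S : Finset α}
    (v : ∀ a, dom a) (hS : S ⊆ A j) :
    joinCount D (j :: U) S v = ((D j).map fun t =>
      if key S (extend (A j) t) = key S v then
        joinCount D U (A j) (extend (A j) t) else 0).sum := by
  rw [joinCount]
  congr 1
  refine List.map_congr_left fun t _ => ?_
  rw [Finset.inter_eq_left.2 hS]
  refine if_ctx_congr Iff.rfl (fun hk => ?_) fun _ => rfl
  refine joinCount_congr D U (fun k hk => ?_) fun k _ a ha => ?_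
  · rw [Finset.union_eq_right.2 hS]
  · by_cases haS : a ∈ S
    · rw [Finset.piecewise_eq_of_mem _ _ _ haS]
      exact (key_eq_iff.1 hk a haS).symm
    · rw [Finset.piecewise_eq_of_notMem _ _ _ haS]

theorem joinCount_le {n : ℕ} (hn : ∀ j, (D j).length ≤ n) :
    ∀ (U : List (Fin m)) (S : Finset α) (v : ∀ a, dom a), joinCount D U S v ≤ n ^ U.length
  | [], _, _ => by simp [joinCount]
  | j :: U, S, v => by
      rw [joinCount, List.length_cons, pow_succ']
      calc _ ≤ ((D j).map fun _ => n ^ U.length).sum := by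
            refine List.sum_le_sum fun t _ => ?_
            split_ifs
            · exact joinCount_le hn U _ _
            · exact Nat.zero_le _
        _ = (D j).length * n ^ U.length := by simp
        _ ≤ _ := Nat.mul_le_mul_right _ (hn j)

theorem joinCount_eq_zero {j : Fin m} (hj : D j = []) : ∀ {U : List (Fin m)}, j ∈ U →
    ∀ (S : Finset α) (v : ∀ a, dom a), joinCount D U S v = 0
  | k :: U, h, S, v => by
      rw [joinCount]
      by_cases hjk : j = k
      · subst hjk; simp [hj]
      · have := joinCount_eq_zero hj ((List.mem_cons.1 h).resolve_left hjk)
        simp [this]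

/-! ### Sensitivities as counts -/

/-- `finsum` is additive only for finite supports, so finiteness has to be carried along with the
value. -/
theorem support_and_finsum_list_sum {β τ : Type} (g : τ → β → ℕ) (N : τ → ℕ) :
    ∀ l : List τ, (∀ t ∈ l, (Function.support (g t)).Finite ∧ ∑ᶠ s, g t s = N t) →
      (Function.support fun s => (l.map fun t => g t s).sum).Finite ∧
        ∑ᶠ s, (l.map fun t => g t s).sum = (l.map N).sum
  | [], _ => by simp
  | t :: l, h => by
      obtain ⟨h1, h2⟩ := h t (by simp)
      obtain ⟨h3, h4⟩ := support_and_finsum_list_sum g N l fun t ht => h t (by simp [ht])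
      simp only [List.map_cons, List.sum_cons]
      refine ⟨(h1.union h3).subset (Function.support_add _ _), ?_⟩
      rw [finsum_add_distrib h1 h3, h2, h4]

/-- The bridge from bag semantics, a sum over output tuples, to nested loops over input tuples. The
induction moves one relation at a time from the product to the constraint; when none is left, `S`
contains all attributes and a single output tuple meets the constraint. -/
theorem support_and_finsum_eq_joinCount (U : List (Fin m)) :
    ∀ (S : Finset α) (v : ∀ a, dom a), S ⊆ allAttrs A → (∀ a ∈ allAttrs A, a ∈ S ∨ ∃ j ∈ U, a ∈ A j) →
    (Function.support fun s : Tup dom (allAttrs A) => if key S (extend _ s) = key S v then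
      (U.map fun j => (D j).count (Finset.restrict₂ (subset_allAttrs A j) s)).prod else 0).Finite ∧
    (∑ᶠ s : Tup dom (allAttrs A), if key S (extend _ s) = key S v then
      (U.map fun j => (D j).count (Finset.restrict₂ (subset_allAttrs A j) s)).prod else 0)
      = joinCount D U S v := by
  induction U with
  | nil =>
    intro S v hS hall
    have hS' : S = allAttrs A := hS.antisymm fun a ha => by simpa using hall a ha
    subst hS'
    have h0 : ∀ s : Tup dom (allAttrs A), s ≠ (allAttrs A).restrict v →
        (if key (allAttrs A) (extend _ s) = key (allAttrs A) v then
          (([] : List (Fin m)).map fun j =>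
            (D j).count (Finset.restrict₂ (subset_allAttrs A j) s)).prod else 0) = 0 := by
      intro s hs
      refine if_neg fun h => hs ?_
      funext a
      have := key_eq_iff.1 h a a.2
      rwa [extend_apply _ a.2] at this
    constructor
    · refine (Set.finite_singleton ((allAttrs A).restrict v)).subset fun s hs => ?_
      by_contra hne
      exact hs (h0 s hne)
    · rw [finsum_eq_single _ _ h0, if_pos, joinCount]
      · simp
      · exact key_eq_iff.2 fun a ha => extend_restrict _ _ ha
  | cons j U ih =>
    intro S v hS hall
    have hstep : ∀ s : Tup dom (allAttrs A), (if key S (extend _ s) = key S v then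
        ((j :: U).map fun j =>
          (D j).count (Finset.restrict₂ (subset_allAttrs A j) s)).prod else 0) =
        ((D j).map fun t => if key (S ∩ A j) (extend (A j) t) = key (S ∩ A j) v then
          (if key (S ∪ A j) (extend _ s) = key (S ∪ A j) (S.piecewise v (extend (A j) t)) then
            (U.map fun j => (D j).count (Finset.restrict₂ (subset_allAttrs A j) s)).prod
            else 0) else 0).sum := by
      intro s
      set P := (U.map fun j => (D j).count (Finset.restrict₂ (subset_allAttrs A j) s)).prod with hP
      -- The multiplicity of the projection is expanded into a sum of indicators over the list, one
      -- term for each iteration of the loop over `D j`.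
      have hcount : ∀ l : List (Tup dom (A j)),
          l.count (Finset.restrict₂ (subset_allAttrs A j) s) * P =
          (l.map fun t => if t = Finset.restrict₂ (subset_allAttrs A j) s then P else 0).sum := by
        intro l
        induction l with
        | nil => simp
        | cons t l ihl =>
          rw [List.count_cons, add_mul, ihl, List.map_cons, List.sum_cons, add_comm]
          by_cases h : t = Finset.restrict₂ (subset_allAttrs A j) s <;> simp [h]
      rw [List.map_cons, List.prod_cons, ← hP, hcount]
      have hpush : ∀ (c : Prop) [Decidable c] (l : List (Tup dom (A j)))
          (g : Tup dom (A j) → ℕ), (if c then (l.map g).sum else 0) =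
            (l.map fun t => if c then g t else 0).sum := by
        intro c _ l g
        by_cases h : c <;> simp [h]
      rw [hpush]
      congr 1
      refine List.map_congr_left fun t _ => ?_
      have hs : t = Finset.restrict₂ (subset_allAttrs A j) s ↔
          ∀ a ∈ A j, extend (allAttrs A) s a = extend (A j) t a := by
        constructor
        · rintro rfl a ha
          rw [extend_apply _ ha, extend_apply _ (subset_allAttrs A j ha)]
          rfl
        · intro h
          funext a
          have := h a a.2
          rw [extend_apply _ a.2, extend_apply _ (subset_allAttrs A j a.2)] at this
          exact this.symm
      rw [← ite_and, ← ite_and]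
      refine if_ctx_congr ?_ (fun _ => rfl) fun _ => rfl
      rw [hs, key_eq_iff, key_eq_iff, key_eq_iff]
      constructor
      · rintro ⟨h1, h2⟩
        refine ⟨fun a ha => ?_, fun a ha => ?_⟩
        · obtain ⟨h3, h4⟩ := Finset.mem_inter.1 ha
          rw [← h2 a h4, h1 a h3]
        · by_cases haS : a ∈ S
          · rw [Finset.piecewise_eq_of_mem _ _ _ haS, h1 a haS]
          · rw [Finset.piecewise_eq_of_notMem _ _ _ haS]
            exact h2 a ((Finset.mem_union.1 ha).resolve_left haS)
      · rintro ⟨h1, h2⟩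
        have h3 : ∀ a ∈ S, extend (allAttrs A) s a = v a := fun a ha => by
          rw [h2 a (Finset.mem_union_left _ ha), Finset.piecewise_eq_of_mem _ _ _ ha]
        refine ⟨h3, fun a ha => ?_⟩
        by_cases haS : a ∈ S
        · rw [h3 a haS, h1 a (Finset.mem_inter.2 ⟨haS, ha⟩)]
        · rw [h2 a (Finset.mem_union_right _ ha), Finset.piecewise_eq_of_notMem _ _ _ haS]
    simp_rw [hstep]
    rw [joinCount]
    refine support_and_finsum_list_sum _ _ (D j) fun t _ => ?_
    split_ifs with h
    · refine ih (S ∪ A j) _ (Finset.union_subset hS (subset_allAttrs A j)) fun a ha => ?_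
      rcases hall a ha with h' | ⟨k, hk, h'⟩
      · exact .inl (by simp [h'])
      · rcases List.mem_cons.1 hk with rfl | hk
        · exact .inl (Finset.mem_union_right _ h')
        · exact .inr ⟨k, hk, h'⟩
    · simp

variable (bag : ∀ i, Multiset (Tup dom (A i)))

theorem result_update (i : Fin m) (x : Multiset (Tup dom (A i))) (s : Tup dom (allAttrs A)) :
    result (Function.update bag i x) s =
      x.count (Finset.restrict₂ (subset_allAttrs A i) s) * ∏ j ∈ Finset.univ.erase i,
        (bag j).count (Finset.restrict₂ (subset_allAttrs A j) s) := by
  rw [result, ← Finset.mul_prod_erase _ _ (Finset.mem_univ i), Function.update_self]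
  congr 1
  refine Finset.prod_congr rfl fun j hj => ?_
  rw [Function.update_of_ne (Finset.ne_of_mem_erase hj)]

/-- By linearity in the multiplicity of the projection to `A i`, insertion only adds output tuples,
namely those projecting to `t`. -/
theorem upSens_eq_finsum (i : Fin m) (t : Tup dom (A i)) :
    upSens bag i t = ∑ᶠ s : Tup dom (allAttrs A),
      if Finset.restrict₂ (subset_allAttrs A i) s = t then ∏ j ∈ Finset.univ.erase i,
        (bag j).count (Finset.restrict₂ (subset_allAttrs A j) s) else 0 := by
  unfold upSens symmDiffCard
  congr 1
  funext s
  rw [result_update]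
  have h0 := result_update bag i (bag i) s
  rw [Function.update_eq_self] at h0
  rw [h0, Multiset.count_cons, add_mul]
  split_ifs <;> simp

/-- If `t` is present, the deleted bag is the one that insertion would add, and equality holds; if
not, the deletion has no effect. -/
theorem downSens_le_upSens (i : Fin m) (t : Tup dom (A i)) :
    downSens bag i t ≤ upSens bag i t := by
  rw [upSens_eq_finsum]
  by_cases ht : t ∈ bag i
  · refine le_of_eq ?_
    unfold downSens symmDiffCard
    congr 1
    funext s
    rw [result_update]
    have h0 := result_update bag i (bag i) s
    rw [Function.update_eq_self] at h0
    rw [h0]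
    by_cases h : Finset.restrict₂ (subset_allAttrs A i) s = t
    · have := Multiset.count_pos.2 ht
      rw [h, Multiset.count_erase_self, if_pos rfl, ← Nat.sub_mul, ← Nat.sub_mul]
      have e1 : (bag i).count t - ((bag i).count t - 1) = 1 := by omega
      have e2 : (bag i).count t - 1 - (bag i).count t = 0 := by omega
      rw [e1, e2]; simp
    · rw [Multiset.count_erase_of_ne h, if_neg h]; simp
  · unfold downSens symmDiffCard
    rw [Multiset.erase_of_notMem ht, Function.update_eq_self]
    simp

theorem tupleSens_eq_upSens (i : Fin m) (t : Tup dom (A i)) :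
    tupleSens bag i t = upSens bag i t := max_eq_left (downSens_le_upSens bag i t)

theorem upSens_eq_joinCount (hbag : ∀ i, bag i = (D i : Multiset (Tup dom (A i)))) (i : Fin m)
    (t : Tup dom (A i)) :
    upSens bag i t = joinCount D (Finset.univ.erase i).toList (A i) (extend (A i) t) := by
  rw [upSens_eq_finsum, ← (support_and_finsum_eq_joinCount D (Finset.univ.erase i).toList (A i)
    (extend (A i) t) (subset_allAttrs A i) ?_).2]
  · congr 1
    funext s
    refine if_ctx_congr ?_ (fun _ => ?_) fun _ => rfl
    · rw [key_eq_iff]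
      constructor
      · rintro rfl a ha
        rw [extend_apply _ ha, extend_apply _ (subset_allAttrs A i ha)]
        rfl
      · intro h
        funext a
        have := h a a.2
        rwa [extend_apply _ a.2, extend_apply _ (subset_allAttrs A i a.2)] at this
    · rw [Finset.prod_map_toList]
      refine Finset.prod_congr rfl fun j _ => ?_
      rw [hbag, Multiset.coe_count]
  · intro a ha
    obtain ⟨j, -, hj⟩ := Finset.mem_biUnion.1 ha
    by_cases hji : j = i
    · exact .inl (hji ▸ hj)
    · exact .inr ⟨j, by simp [hji], hj⟩

end Count

end JoinLS

namespace JoinLS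

/-! ## Join trees -/

namespace JoinTree

variable {α : Type} [DecidableEq α] {m : ℕ} {A : Fin m → Finset α} (T : JoinTree A)

theorem mem_postOrder (i : Fin m) : i ∈ T.postOrder :=
  List.mem_ofFn.2 ⟨T.elim.symm i, by simp⟩

theorem nodup_postOrder : T.postOrder.Nodup := List.nodup_ofFn.2 T.elim.injective

theorem postOrder_pairwise :
    T.postOrder.Pairwise fun i j => T.elim.symm i < T.elim.symm j :=
  List.pairwise_ofFn.2 fun i j h => by simpa using h

theorem postOrder_perm : T.postOrder.Perm (Finset.univ : Finset (Fin m)).toList :=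
  (List.perm_ext_iff_of_nodup T.nodup_postOrder (Finset.nodup_toList _)).2 fun i => by
    simp [T.mem_postOrder]

theorem sum_map_postOrder (f : Fin m → ℕ) : (T.postOrder.map f).sum = ∑ i, f i := by
  rw [(T.postOrder_perm.map f).sum_eq, Finset.sum_map_toList]

theorem mem_children {i c : Fin m} : c ∈ T.children i ↔ T.parent c = some i := by
  simp [children, T.mem_postOrder]

theorem nodup_children (i : Fin m) : (T.children i).Nodup := T.nodup_postOrder.filter _

theorem mem_nbrs {i j : Fin m} : j ∈ T.nbrs i ↔ T.parent i = some j ∨ T.parent j = some i := by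
  simp [nbrs, T.mem_children]

theorem parent_pos {i p : Fin m} (h : T.parent i = some p) : T.elim.symm i < T.elim.symm p :=
  T.parent_later i p h

theorem nodup_nbrs (i : Fin m) : (T.nbrs i).Nodup := by
  refine List.Nodup.append ?_ (T.nodup_children i) ?_
  · cases T.parent i <;> simp
  · intro j hj hj'
    have h1 : T.parent i = some j := by simpa using hj
    exact lt_asymm (T.parent_pos h1) (T.parent_pos (T.mem_children.1 hj'))

theorem pos_root (i : Fin m) : T.elim.symm i ≤ T.elim.symm T.root := by
  induction h : m - T.elim.symm i using Nat.strong_induction_on generalizing i with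
  | _ k ih =>
    cases hp : T.parent i with
    | none => rw [(T.parent_eq_none i).1 hp]
    | some p =>
      have := T.parent_pos hp
      have h2 := (T.elim.symm p).2
      exact this.le.trans (ih _ (by omega) p rfl)

/-- `x` is `c` or a descendant of `c`. -/
def Desc (c x : Fin m) : Prop := Relation.ReflTransGen (fun y z => T.parent y = some z) x c

theorem desc_refl (c : Fin m) : T.Desc c c := .refl

variable {T}

theorem Desc.pos {c x : Fin m} (h : T.Desc c x) : T.elim.symm x ≤ T.elim.symm c := by
  induction h with
  | refl => exact le_rfl
  | tail _ h ih => exact ih.trans (T.parent_pos h).le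

theorem Desc.of_parent {c x y : Fin m} (h : T.Desc c y) (hx : T.parent x = some y) :
    T.Desc c x := .head hx h

theorem Desc.eq_or {c x : Fin m} (h : T.Desc c x) : x = c ∨ ∃ y, T.parent x = some y ∧ T.Desc c y :=
  (Relation.ReflTransGen.cases_head h).imp id fun ⟨y, h1, h2⟩ => ⟨y, h1, h2⟩

theorem Desc.eq_or_child {c x : Fin m} (h : T.Desc c x) :
    x = c ∨ ∃ y, T.parent y = some c ∧ T.Desc y x :=
  (Relation.ReflTransGen.cases_tail h).imp Eq.symm fun ⟨y, h1, h2⟩ => ⟨y, h2, h1⟩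

theorem Desc.parent {c x y : Fin m} (h : T.Desc c x) (hne : x ≠ c) (hx : T.parent x = some y) :
    T.Desc c y := by
  obtain ⟨z, hz, h⟩ := h.eq_or.resolve_left hne
  rw [hx] at hz
  exact Option.some.inj hz ▸ h

theorem not_desc_of_parent {c p : Fin m} (h : T.parent c = some p) : ¬ T.Desc c p :=
  fun hd => absurd hd.pos (not_le.2 (T.parent_pos h))

/-- Parents are unique, so the ancestors of a node form a chain. Consequently subtrees of siblings
are disjoint. -/
theorem Desc.total {c c' x : Fin m} (h : T.Desc c x) (h' : T.Desc c' x) :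
    T.Desc c c' ∨ T.Desc c' c := by
  induction h with
  | refl => exact .inr h'
  | tail _ hyz ih =>
    rcases ih with h | h
    · exact .inl (h.tail hyz)
    · rcases h.eq_or with rfl | ⟨w, hw, h⟩
      · exact .inl (.single hyz)
      · rw [hyz] at hw
        exact .inr (Option.some.inj hw ▸ h)

theorem not_desc_of_siblings {c c' p x : Fin m} (hc : T.parent c = some p)
    (hc' : T.parent c' = some p) (hne : c ≠ c') (h : T.Desc c x) : ¬ T.Desc c' x := by
  intro h'
  rcases h.total h' with h | h
  · exact not_desc_of_parent hc (h.parent (Ne.symm hne) hc')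
  · exact not_desc_of_parent hc' (h.parent hne hc)

variable (T)

theorem desc_root (x : Fin m) : T.Desc T.root x := by
  induction h : m - T.elim.symm x using Nat.strong_induction_on generalizing x with
  | _ k ih =>
    cases hp : T.parent x with
    | none => rw [(T.parent_eq_none x).1 hp]; exact T.desc_refl _
    | some p =>
      have := T.parent_pos hp
      have h2 := (T.elim.symm p).2
      exact (ih _ (by omega) p rfl).of_parent hp

variable {T}

/-- The running intersection property. -/
theorem inter_subset_of_desc {c p : Fin m} (hc : T.parent c = some p) {x y : Fin m}
    (hx : T.Desc c x) (hy : ¬ T.Desc c y) : A x ∩ A y ⊆ A c ∩ A p := by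
  induction h : (m - T.elim.symm x) + (m - T.elim.symm y) using Nat.strong_induction_on
    generalizing x y with
  | _ k ih =>
    intro a ha
    obtain ⟨hax, hay⟩ := Finset.mem_inter.1 ha
    have hxm := (T.elim.symm x).2
    have hym := (T.elim.symm y).2
    -- Whichever of `x` and `y` is eliminated first hands the shared attribute to its parent, by the
    -- ear property. Moving up this way, `y` never enters the subtree of `c`, and `x` leaves it only
    -- through `c`; at that moment the attribute is in `A c` and in `A p`.
    rcases lt_trichotomy (T.elim.symm x) (T.elim.symm y) with hlt | heq | hlt
    · cases hp : T.parent x with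
      | none =>
        rw [(T.parent_eq_none x).1 hp] at hlt
        exact absurd (T.pos_root y) (not_le.2 hlt)
      | some q =>
        have haq := T.ear x q hp y hlt ha
        by_cases hxc : x = c
        · subst hxc
          rw [hc] at hp
          exact Finset.mem_inter.2 ⟨hax, Option.some.inj hp ▸ haq⟩
        · have := T.parent_pos hp
          exact ih _ (by omega) (hx.parent hxc hp) hy rfl (Finset.mem_inter.2 ⟨haq, hay⟩)
    · rw [T.elim.symm.injective heq] at hx
      exact absurd hx hy
    · cases hp : T.parent y with
      | none =>
        rw [(T.parent_eq_none y).1 hp] at hlt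
        exact absurd (T.pos_root x) (not_le.2 hlt)
      | some q =>
        have haq := T.ear y q hp x hlt (by rwa [Finset.inter_comm])
        have := T.parent_pos hp
        exact ih _ (by omega) hx (fun h => hy (h.of_parent hp)) rfl
          (Finset.mem_inter.2 ⟨hax, haq⟩)

variable (T)

/-- The nodes of the subtree with root `c`. -/
noncomputable def sub (c : Fin m) : List (Fin m) :=
  open Classical in (Finset.univ.filter (T.Desc c)).toList

/-- The nodes outside the subtree with root `c`. -/
noncomputable def subCompl (c : Fin m) : List (Fin m) :=
  open Classical in (Finset.univ.filter fun x => ¬ T.Desc c x).toList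

theorem mem_sub {c x : Fin m} : x ∈ T.sub c ↔ T.Desc c x := by simp [sub]

theorem mem_subCompl {c x : Fin m} : x ∈ T.subCompl c ↔ ¬ T.Desc c x := by simp [subCompl]

theorem nodup_sub (c : Fin m) : (T.sub c).Nodup := Finset.nodup_toList _

theorem nodup_subCompl (c : Fin m) : (T.subCompl c).Nodup := Finset.nodup_toList _

theorem length_le_of_nodup {U : List (Fin m)} (h : U.Nodup) : U.length ≤ m := by
  simpa using h.length_le_card

theorem subCompl_root : T.subCompl T.root = [] :=
  List.eq_nil_iff_forall_not_mem.2 fun x hx => T.mem_subCompl.1 hx (T.desc_root x)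

theorem nodup_flatMap_sub {p : Fin m} {cs : List (Fin m)} (hcs : cs.Nodup)
    (h : ∀ c ∈ cs, T.parent c = some p) : (cs.flatMap T.sub).Nodup := by
  refine List.nodup_flatMap.2 ⟨fun c _ => T.nodup_sub c, ?_⟩
  refine List.Pairwise.imp_of_mem (fun {c c'} hc hc' hne => ?_) hcs
  intro x hx hx'
  exact not_desc_of_siblings (h c hc) (h c' hc') hne (T.mem_sub.1 hx) (T.mem_sub.1 hx')

theorem sub_perm (c : Fin m) : (T.sub c).Perm (c :: (T.children c).flatMap T.sub) := by
  refine (List.perm_ext_iff_of_nodup (T.nodup_sub c) ?_).2 fun x => ?_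
  · refine List.nodup_cons.2 ⟨fun h => ?_, T.nodup_flatMap_sub (T.nodup_children c)
      fun c' hc' => T.mem_children.1 hc'⟩
    obtain ⟨k, hk, h⟩ := List.mem_flatMap.1 h
    exact not_desc_of_parent (T.mem_children.1 hk) (T.mem_sub.1 h)
  · rw [mem_sub, List.mem_cons, List.mem_flatMap]
    simp only [mem_children, mem_sub]
    refine ⟨Desc.eq_or_child, ?_⟩
    rintro (rfl | ⟨y, hy, h⟩)
    · exact T.desc_refl _
    · exact h.tail hy

/-- This splitting mirrors the definition of the topjoin: the parent relation, its own topjoin, and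
the botjoins of the siblings. -/
theorem subCompl_perm {i p : Fin m} (hi : T.parent i = some p) :
    (T.subCompl i).Perm (p :: (T.subCompl p ++ ((T.children p).erase i).flatMap T.sub)) := by
  have hch : ∀ c ∈ (T.children p).erase i, T.parent c = some p := fun c hc =>
    T.mem_children.1 (List.mem_of_mem_erase hc)
  refine (List.perm_ext_iff_of_nodup (T.nodup_subCompl i) ?_).2 fun x => ?_
  · refine List.nodup_cons.2 ⟨fun h => ?_, (T.nodup_subCompl p).append
      (T.nodup_flatMap_sub ((T.nodup_children p).erase i) hch) ?_⟩
    · rcases List.mem_append.1 h with h | h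
      · exact T.mem_subCompl.1 h (T.desc_refl p)
      · obtain ⟨c, hc, h⟩ := List.mem_flatMap.1 h
        exact not_desc_of_parent (hch c hc) (T.mem_sub.1 h)
    · intro x hx hx'
      obtain ⟨c, hc, h⟩ := List.mem_flatMap.1 hx'
      exact T.mem_subCompl.1 hx ((T.mem_sub.1 h).tail (hch c hc))
  · rw [mem_subCompl, List.mem_cons, List.mem_append, mem_subCompl, List.mem_flatMap]
    constructor
    · intro hx
      by_cases hp : T.Desc p x
      · rcases hp.eq_or_child with rfl | ⟨y, hy, h⟩
        · exact .inl rfl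
        · refine .inr (.inr ⟨y, ?_, T.mem_sub.2 h⟩)
          rw [(T.nodup_children p).mem_erase_iff]
          exact ⟨by rintro rfl; exact hx h, T.mem_children.2 hy⟩
      · exact .inr (.inl hp)
    · rintro (rfl | h | ⟨c, hc, h⟩)
      · exact not_desc_of_parent hi
      · exact fun hx => h (hx.tail hi)
      · refine not_desc_of_siblings (hch c hc) hi ?_ (T.mem_sub.1 h)
        rintro rfl
        exact ((T.nodup_children p).mem_erase_iff.1 hc).1 rfl

theorem erase_perm (i : Fin m) : (Finset.univ.erase i).toList.Perm
    (T.subCompl i ++ (T.children i).flatMap T.sub) := by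
  refine (List.perm_ext_iff_of_nodup (Finset.nodup_toList _) ?_).2 fun x => ?_
  · refine (T.nodup_subCompl i).append (T.nodup_flatMap_sub (T.nodup_children i)
      fun c' hc' => T.mem_children.1 hc') fun x hx hx' => ?_
    obtain ⟨c, hc, h⟩ := List.mem_flatMap.1 hx'
    exact T.mem_subCompl.1 hx ((T.mem_sub.1 h).tail (T.mem_children.1 hc))
  · rw [List.mem_append, mem_subCompl, List.mem_flatMap]
    simp only [Finset.mem_toList, Finset.mem_erase, Finset.mem_univ, and_true]
    constructor
    · intro hx
      by_cases h : T.Desc i x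
      · obtain ⟨y, hy, h⟩ := h.eq_or_child.resolve_left hx
        exact .inr ⟨y, T.mem_children.2 hy, T.mem_sub.2 h⟩
      · exact .inl h
    · rintro (h | ⟨c, hc, h⟩) rfl
      · exact h (T.desc_refl _)
      · exact not_desc_of_parent (T.mem_children.1 hc) (T.mem_sub.1 h)

theorem sep_eq {i p : Fin m} (h : T.parent i = some p) : T.sep i = A i ∩ A p := by
  rw [sep, h]

theorem sep_subset (i : Fin m) : T.sep i ⊆ A i := by
  unfold sep
  split
  · exact Finset.inter_subset_left
  · exact subset_rfl

/-! ### Degrees -/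

/-- Adjacency is symmetric. This double counting charges the cost of reading neighbouring tables to
the relations that they come from. -/
theorem sum_nbrs_comm (f : Fin m → Fin m → ℕ) :
    ∑ i, ((T.nbrs i).map fun j => f i j).sum = ∑ j, ((T.nbrs j).map fun i => f i j).sum := by
  have h : ∀ (g : Fin m → ℕ) (i : Fin m), ((T.nbrs i).map g).sum =
      ∑ j, if j ∈ T.nbrs i then g j else 0 := by
    intro g i
    rw [← List.sum_toFinset _ (T.nodup_nbrs i), ← Finset.sum_filter]
    congr 1
    ext j; simp
  simp_rw [h]
  rw [Finset.sum_comm]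
  refine Finset.sum_congr rfl fun j _ => Finset.sum_congr rfl fun i _ => ?_
  simp only [mem_nbrs, or_comm]

/-- Each node has at most one parent, so the tree has at most `m` edges, and each edge is counted at
both ends. -/
theorem sum_length_nbrs_le : ∑ i, (T.nbrs i).length ≤ 2 * m := by
  have h1 : ∀ i, (T.nbrs i).length ≤ 1 + ∑ c, if T.parent c = some i then 1 else 0 := by
    intro i
    rw [nbrs, List.length_append]
    refine Nat.add_le_add ?_ ?_
    · cases T.parent i <;> simp
    · rw [← List.toFinset_card_of_nodup (T.nodup_children i), ← Finset.card_filter]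
      refine Finset.card_le_card fun c hc => ?_
      simpa [mem_children] using hc
  calc ∑ i, (T.nbrs i).length ≤ ∑ i, (1 + ∑ c, if T.parent c = some i then 1 else 0) :=
        Finset.sum_le_sum fun i _ => h1 i
    _ = m + ∑ c, ∑ i, (if T.parent c = some i then 1 else 0) := by
        rw [Finset.sum_add_distrib, Finset.sum_comm]; simp
    _ ≤ m + ∑ _c : Fin m, 1 := by
        refine Nat.add_le_add_left (Finset.sum_le_sum fun c _ => ?_) _
        cases T.parent c <;> simp [Finset.sum_ite_eq]
    _ = 2 * m := by simp; omega

theorem length_children_le (i : Fin m) : (T.children i).length ≤ (T.nbrs i).length := by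
  simp [nbrs]

theorem length_nbrs_lt (i : Fin m) : (T.nbrs i).length < m := by
  have h : (i :: T.nbrs i).Nodup := by
    refine List.nodup_cons.2 ⟨fun h => ?_, T.nodup_nbrs i⟩
    rcases T.mem_nbrs.1 h with h | h <;> exact lt_irrefl _ (T.parent_pos h)
  simpa using length_le_of_nodup h

theorem sum_children_le (i : Fin m) (f : Fin m → ℕ) :
    ((T.children i).map f).sum ≤ ((T.nbrs i).map f).sum := by
  simp [nbrs]

/-- A query with a join tree is acyclic. -/
theorem gyoAcyclic_univ (T : JoinTree A) : GYOAcyclic A Finset.univ := by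
  -- Induction on the last `s` relations of the elimination order. The first of them is an ear with
  -- its parent as witness; it can be the root only if it is alone, since the root is eliminated
  -- last.
  suffices h : ∀ s : ℕ, s ≤ m →
      GYOAcyclic A (Finset.univ.filter fun i => m - s ≤ T.elim.symm i) by
    have := h m le_rfl
    simpa using this
  intro s
  induction s with
  | zero =>
    intro _
    rw [Finset.filter_false_of_mem fun i _ => by have := (T.elim.symm i).2; omega]
    exact .empty
  | succ s ih =>
    intro hs
    let i : Fin m := T.elim ⟨m - (s + 1), by omega⟩
    have hi : T.elim.symm i = ⟨m - (s + 1), by omega⟩ := by simp [i]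
    refine .ear _ i ⟨by rw [Finset.mem_filter, hi]; exact ⟨Finset.mem_univ _, le_rfl⟩, ?_⟩ ?_
    · cases hp : T.parent i with
      | none =>
        refine .inl fun j hj hji => ?_
        have h1 := T.pos_root j
        rw [← (T.parent_eq_none i).1 hp, hi] at h1
        have h2 : T.elim.symm j = T.elim.symm i := by
          rw [hi]; ext
          have h3 : (T.elim.symm j : ℕ) ≤ m - (s + 1) := h1
          have h4 := (Finset.mem_filter.1 hj).2
          exact le_antisymm h3 h4
        exact absurd (T.elim.symm.injective h2) hji
      | some p =>
        have h1 := T.parent_pos hp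
        refine .inr ⟨p, ?_, by rintro rfl; exact lt_irrefl _ h1, fun j hj hji => ?_⟩
        · rw [hi] at h1
          have h3 : m - (s + 1) < (T.elim.symm p : ℕ) := h1
          simpa using h3.le
        · refine T.ear i p hp j (lt_of_le_of_ne ?_ fun h => hji (T.elim.symm.injective h).symm)
          rw [hi]
          exact (Finset.mem_filter.1 hj).2
    · convert ih (by omega) using 1
      ext j
      simp only [Finset.mem_erase, Finset.mem_filter, Finset.mem_univ, true_and]
      constructor
      · rintro ⟨h1, h2⟩
        have : (T.elim.symm j : ℕ) ≠ m - (s + 1) := fun h => h1 <| T.elim.symm.injective <| by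
          rw [hi]; exact Fin.ext h
        omega
      · intro h
        refine ⟨?_, by omega⟩
        rintro rfl
        rw [hi] at h
        simp only at h
        omega

end JoinTree

/-! ### Path queries -/

/-- The join tree of the path query whose root is the last relation. -/
def pathTree (m : ℕ) (hm : 1 ≤ m) : JoinTree (pathQuery m) where
  elim := Equiv.refl _
  root := ⟨m - 1, by omega⟩
  parent i := if h : (i : ℕ) + 1 < m then some ⟨i + 1, h⟩ else none
  parent_eq_none i := by
    have := i.2
    simp only [dite_eq_right_iff, reduceCtorEq, imp_false, Fin.ext_iff]
    omega
  parent_later i p h := by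
    split_ifs at h with h'
    obtain rfl := Option.some.inj h
    simp [Fin.lt_def]
  -- The only vertex that relation `i` can share with a later one is `i + 1`, and this vertex lies
  -- in the parent, relation `i + 1`.
  ear i p h j hij := by
    split_ifs at h with h'
    obtain rfl := Option.some.inj h
    intro a ha
    have hij : (i : ℕ) < j := hij
    simp only [pathQuery, Finset.mem_inter, Finset.mem_insert, Finset.mem_singleton, Fin.ext_iff,
      Fin.val_castSucc, Fin.val_succ] at ha ⊢
    omega

theorem length_nbrs_pathTree {m : ℕ} (hm : 1 ≤ m) (i : Fin m) :
    ((pathTree m hm).nbrs i).length ≤ 2 := by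
  rw [JoinTree.nbrs, List.length_append]
  refine Nat.add_le_add (b := 1) (d := 1) ?_ ?_
  · cases (pathTree m hm).parent i <;> simp
  · have hnd := (pathTree m hm).nodup_children i
    rw [← List.toFinset_card_of_nodup hnd, Finset.card_le_one]
    intro c hc c' hc'
    rw [List.mem_toFinset, JoinTree.mem_children] at hc hc'
    simp only [pathTree] at hc hc'
    split_ifs at hc hc'
    have h1 := congrArg Fin.val (Option.some.inj hc)
    have h2 := congrArg Fin.val (Option.some.inj hc')
    simp only at h1 h2
    exact Fin.ext (by omega)

theorem nbrsAcyclic_pathTree {m : ℕ} (hm : 1 ≤ m) : (pathTree m hm).NbrsAcyclic := fun i =>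
  gyoAcyclic_of_card_le_two ((List.toFinset_card_le _).trans (length_nbrs_pathTree hm i))

end JoinLS

namespace JoinLS

/-! ## Botjoins and topjoins -/

section Messages

variable {α : Type} [LinearOrder α] {dom : α → Type} [∀ a, LinearOrder (dom a)]
  [∀ a, Inhabited (dom a)] {m : ℕ} {A : Fin m → Finset α}

open Timed

section Recursion

variable (D : ∀ i, List (Tup dom (A i))) {T : JoinTree A}

/-- Seen from the parent, the relations in the subtree of `c` involve only the attributes of the
separator, by running intersection. Hence a tuple of the parent may be looked up in the botjoin by
its projection. -/
theorem joinCount_sub_parent {c i : Fin m} (hc : T.parent c = some i) (v : ∀ a, dom a) :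
    joinCount D (T.sub c) (A i) v = joinCount D (T.sub c) (T.sep c) v := by
  refine joinCount_congr D _ (fun j hj => ?_) fun _ _ _ _ => rfl
  rw [T.sep_eq hc]
  ext a
  have := @JoinTree.inter_subset_of_desc _ _ _ _ T _ _ hc _ _ (T.mem_sub.1 hj)
    (JoinTree.not_desc_of_parent hc) a
  simp only [Finset.mem_inter] at this ⊢
  tauto

theorem joinCount_subCompl_self (i : Fin m) (v : ∀ a, dom a) :
    joinCount D (T.subCompl i) (A i) v = joinCount D (T.subCompl i) (T.sep i) v := by
  cases hi : T.parent i with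
  | none => rw [(T.parent_eq_none i).1 hi, T.subCompl_root]; rfl
  | some p =>
    refine joinCount_congr D _ (fun j hj => ?_) fun _ _ _ _ => rfl
    rw [T.sep_eq hi]
    ext a
    have := @JoinTree.inter_subset_of_desc _ _ _ _ T _ _ hi _ _ (T.desc_refl i)
      (T.mem_subCompl.1 hj) a
    simp only [Finset.mem_inter] at this ⊢
    tauto

/-- Subtrees of different children share only attributes of their common parent, so the counts
multiply. -/
theorem joinCount_flatMap_sub {i : Fin m} {cs : List (Fin m)} (hcs : cs.Nodup)
    (h : ∀ c ∈ cs, T.parent c = some i) (v : ∀ a, dom a) :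
    joinCount D (cs.flatMap T.sub) (A i) v =
      (cs.map fun c => joinCount D (T.sub c) (T.sep c) v).prod := by
  rw [joinCount_flatMap]
  · congr 1
    exact List.map_congr_left fun c hc => joinCount_sub_parent D (h c hc) v
  · refine List.Pairwise.imp_of_mem (fun {c c'} hc hc' hne => ?_) hcs
    intro j hj k hk
    refine (JoinTree.inter_subset_of_desc (h c hc) (T.mem_sub.1 hj) fun hk' => ?_).trans
      Finset.inter_subset_right
    exact JoinTree.not_desc_of_siblings (h c hc) (h c' hc') hne hk' (T.mem_sub.1 hk)

theorem joinCount_subCompl_append {i : Fin m} {cs : List (Fin m)} (hcs : cs.Nodup)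
    (h : ∀ c ∈ cs, T.parent c = some i) (v : ∀ a, dom a) :
    joinCount D (T.subCompl i ++ cs.flatMap T.sub) (A i) v =
      joinCount D (T.subCompl i) (T.sep i) v *
        (cs.map fun c => joinCount D (T.sub c) (T.sep c) v).prod := by
  rw [joinCount_append, joinCount_subCompl_self, joinCount_flatMap_sub D hcs h]
  intro j hj k hk
  obtain ⟨c, hc, hk⟩ := List.mem_flatMap.1 hk
  cases hi : T.parent i with
  | none => rw [(T.parent_eq_none i).1 hi, T.subCompl_root] at hj; simp at hj
  | some p =>
    rw [Finset.inter_comm]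
    exact (JoinTree.inter_subset_of_desc hi ((T.mem_sub.1 hk).tail (h c hc))
      (T.mem_subCompl.1 hj)).trans Finset.inter_subset_left

/-- The recursion for the botjoins. -/
theorem joinCount_sub (i : Fin m) (v : ∀ a, dom a) :
    joinCount D (T.sub i) (T.sep i) v = ((D i).map fun t =>
      if key (T.sep i) (extend (A i) t) = key (T.sep i) v then
        ((T.children i).map fun c =>
          joinCount D (T.sub c) (T.sep c) (extend (A i) t)).prod else 0).sum := by
  rw [joinCount_perm D (T.sub_perm i), joinCount_cons D _ _ _ (T.sep_subset i)]
  simp_rw [joinCount_flatMap_sub D (T.nodup_children i) fun c hc => T.mem_children.1 hc]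

/-- The recursion for the topjoins. -/
theorem joinCount_subCompl {i p : Fin m} (hi : T.parent i = some p) (v : ∀ a, dom a) :
    joinCount D (T.subCompl i) (T.sep i) v = ((D p).map fun t =>
      if key (T.sep i) (extend (A p) t) = key (T.sep i) v then
        joinCount D (T.subCompl p) (T.sep p) (extend (A p) t) *
          (((T.children p).erase i).map fun c =>
            joinCount D (T.sub c) (T.sep c) (extend (A p) t)).prod else 0).sum := by
  rw [joinCount_perm D (T.subCompl_perm hi), joinCount_cons]
  · simp_rw [joinCount_subCompl_append D ((T.nodup_children p).erase i)
      fun c hc => T.mem_children.1 (List.mem_of_mem_erase hc)]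
  · rw [T.sep_eq hi]; exact Finset.inter_subset_right

/-- Deleting `i` splits the tree into one component for each neighbour, and these interact only
through `A i`. The left side is the sensitivity, the right side the entry of the multiplicity table.
-/
theorem joinCount_erase (T : JoinTree A) (i : Fin m) (v : ∀ a, dom a) :
    joinCount D (Finset.univ.erase i).toList (A i) v =
      joinCount D (T.subCompl i) (T.sep i) v *
        ((T.children i).map fun c => joinCount D (T.sub c) (T.sep c) v).prod := by
  rw [joinCount_perm D (T.erase_perm i), joinCount_subCompl_append D (T.nodup_children i)
    fun c hc => T.mem_children.1 hc]

end Recursion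

/-! ### Sizes of counts -/

theorem size_sum_le {s : ℕ} : ∀ l : List ℕ, (∀ x ∈ l, x.size ≤ s) → l.sum.size ≤ l.length + s := by
  intro l h
  have h1 : l.sum ≤ l.length * 2 ^ s := by
    have := List.sum_le_card_nsmul l (2 ^ s) fun x hx => (Nat.size_le.1 (h x hx)).le
    simpa using this
  rw [Nat.size_le, pow_add]
  exact h1.trans_lt (Nat.mul_lt_mul_of_pos_right Nat.lt_two_pow_self (by positivity))

theorem size_prod_le {s : ℕ} : ∀ l : List ℕ, (∀ x ∈ l, x.size ≤ s) →
    l.prod.size ≤ l.length * s + 1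
  | [], _ => by simp
  | x :: l, h => by
      have h1 := size_prod_le l fun y hy => h y (by simp [hy])
      have h2 := h x (by simp)
      have h3 := size_mul_le x l.prod
      simp only [List.prod_cons, List.length_cons, add_mul, one_mul]
      omega

/-- The bounds that the cost estimates depend on: `z` bounds the bit lengths of the entries of the
botjoins and topjoins, `Z` those of all counts, `W` the finer cost of a step, and `Λ` is
the logarithm of the number of tuples. -/
structure Bounds (D : ∀ i, List (Tup dom (A i))) (z Z W Λ : ℕ) : Prop where
  count : ∀ U : List (Fin m), U.Nodup → ∀ S v, (joinCount D U S v).size ≤ z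
  big : z * (m + 1) + ∑ i, (D i).length + 2 ≤ Z
  work : 2 * (allAttrs A).card + (Z + 1) ^ 2 + 1 ≤ W
  log : ∀ i, Nat.clog 2 (D i).length ≤ Λ

variable {D : ∀ i, List (Tup dom (A i))} {z Z W Λ : ℕ} {T : JoinTree A}

theorem Bounds.one_le (hB : Bounds D z Z W Λ) : 1 ≤ W := by have := hB.work; omega

theorem Bounds.card_le (hB : Bounds D z Z W Λ) {S : Finset α} {i : Fin m} (h : S ⊆ A i) :
    S.card + (Z + 1) ^ 2 + 1 ≤ W := by
  have := Finset.card_le_card (h.trans (subset_allAttrs A i))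
  have := hB.work
  omega

theorem length_le_sum (D : ∀ i, List (Tup dom (A i))) (i : Fin m) :
    (D i).length ≤ ∑ i, (D i).length :=
  Finset.single_le_sum (f := fun i => (D i).length) (fun _ _ => Nat.zero_le _) (Finset.mem_univ i)

/-- `tbl` is sorted, has at most `q` rows, and its counts are those of the join of the relations
in `U`. -/
structure GoodTable (D : ∀ i, List (Tup dom (A i))) (S : Finset α) (U : List (Fin m)) (q : ℕ)
    (tbl : List ((∀ a, dom a) × ℕ)) : Prop where
  strict : StrictBy S tbl
  length_le : tbl.length ≤ q
  count : ∀ v, tableCount S tbl v = joinCount D U S v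

/-- `tbl` is the botjoin of `i`. -/
def IsBot (T : JoinTree A) (D : ∀ i, List (Tup dom (A i))) (i : Fin m)
    (tbl : List ((∀ a, dom a) × ℕ)) : Prop :=
  GoodTable D (T.sep i) (T.sub i) (D i).length tbl

/-- `tbl` is the topjoin of `i`. -/
def IsTop (T : JoinTree A) (D : ∀ i, List (Tup dom (A i))) (i : Fin m)
    (tbl : List ((∀ a, dom a) × ℕ)) : Prop :=
  ∀ p, T.parent i = some p → GoodTable D (T.sep i) (T.subCompl i) (D p).length tbl

/-! ### Correctness and cost of the botjoin and topjoin steps. -/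

theorem readRel_spec (hB : Bounds D z Z W Λ) (i : Fin m) :
    (readRel D i).Spec (· = (D i).map fun t => (extend (A i) t, (1, [])))
      (2 * (D i).length + 1) W := by
  refine (Spec.mapT (t := 1) hB.one_le _ fun t _ => ?_).le (by omega)
  refine Spec.tick_pure ?_ _
  have := hB.card_le (i := i) subset_rfl
  omega

/-- Sorting permutes the rows in a way that need not be known. Since the data of each row is a
function of its tuple, the permuted rows come from a permuted list of tuples, and the order drops
out of the final sums. -/
theorem exists_map_of_perm {V X : Type} {G : V → X} {r : List (V × X)} {vs : List V}
    (h : r.Perm (vs.map fun v => (v, G v))) :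
    ∃ vs' : List V, vs'.Perm vs ∧ r = vs'.map fun v => (v, G v) := by
  refine ⟨r.map Prod.fst, ?_, ?_⟩
  · simpa [Function.comp_def] using h.map Prod.fst
  · rw [List.map_map]
    conv_lhs => rw [← List.map_id r]
    refine List.map_congr_left fun x hx => ?_
    obtain ⟨v, -, rfl⟩ := List.mem_map.1 (h.mem_iff.1 hx)
    rfl

theorem tableCount_map {τ : Type} (S : Finset α) (e : τ → ∀ a, dom a) (h : τ → ℕ)
    (v : ∀ a, dom a) : ∀ l : List τ, tableCount S (l.map fun t => (e t, h t)) v =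
      (l.map fun t => if key S (e t) = key S v then h t else 0).sum
  | [] => rfl
  | t :: l => by
      rw [List.map_cons, tableCount_cons, tableCount_map S e h v l, List.map_cons, List.sum_cons]

/-- The keys of a botjoin are distinct, so a join never multiplies rows: each child costs one sort
of the same number of rows and one pass over its botjoin. -/
theorem joinChildren_spec (hW : ∀ c, (T.sep c).card + 1 ≤ W)
    {bot : Fin m → List ((∀ a, dom a) × ℕ)} {q : Fin m → ℕ}
    (rows : List ((∀ a, dom a) × (ℕ × List ℕ))) (hΛ : Nat.clog 2 rows.length ≤ Λ) :
    ∀ cs : List (Fin m), (∀ c ∈ cs, StrictBy (T.sep c) (bot c) ∧ (bot c).length ≤ q c) →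
    (joinChildren T bot cs rows).Spec
      (fun r => r.Perm (rows.map fun x => (x.1, (x.2.1,
        cs.map (fun c => tableCount (T.sep c) (bot c) x.1) ++ x.2.2))))
      (cs.length * (4 * ((rows.length + 1) * (Λ + 1))) + (cs.map q).sum + 1) W
  | [], _ => by
      rw [joinChildren]
      refine ((Spec.tick (w := 0) ?_).bind fun _ _ => Spec.pure ?_).le (by simp)
      · have := hW T.root; omega
      · simp
  | c :: cs, h => by
      have hc := h c (by simp)
      have hW1 : 1 ≤ W := by have := hW c; omega
      rw [joinChildren]
      refine ((joinChildren_spec hW rows hΛ cs fun c hc => h c (by simp [hc])).bind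
        (t' := 4 * ((rows.length + 1) * (Λ + 1)) + q c) fun r hr => ?_).le ?_
      · have hlen : r.length = rows.length := by rw [hr.length_eq, List.length_map]
        refine ((lookupJoin_spec (T.sep c) (hW c) r (bot c) hc.1 (Λ := Λ) (by rwa [hlen])).bind
          (t' := rows.length * 2 + 1) fun j hj => ?_).le ?_
        · have hlen' : j.length = rows.length := by rw [hj.length_eq, List.length_map, hlen]
          refine (Spec.mapT (t := 1) (g := fun r => (r.1.1, (r.1.2.1, countOf r.2 :: r.1.2.2)))
            hW1 j fun b _ =>
            Spec.tick_pure (w := 0) hW1 _).mono ?_ ?_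
          · rintro _ rfl
            refine (hj.map _).trans ?_
            rw [List.map_map]
            refine (hr.map _).trans ?_
            rw [List.map_map]
            refine List.Perm.of_eq (List.map_congr_left fun x _ => ?_)
            simp [countOf_lookup hc.1]
          · rw [hlen']
        · rw [hlen]
          have := hc.2
          nlinarith
      · simp only [List.length_cons, List.map_cons, List.sum_cons]
        nlinarith

/-- A row count of `q` rows, with the logarithmic factor. -/
def unit (q Λ : ℕ) : ℕ := (q + 1) * (Λ + 1)

theorem le_unit (q Λ : ℕ) : q * Λ + q + 1 ≤ unit q Λ := by unfold unit; nlinarith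

theorem size_tableCount_le (hB : Bounds D z Z W Λ) {S : Finset α} {U : List (Fin m)} {q : ℕ}
    {tbl : List ((∀ a, dom a) × ℕ)} (h : GoodTable D S U q tbl) (hU : U.Nodup) (v : ∀ a, dom a) :
    (tableCount S tbl v).size ≤ z := by
  rw [h.count]; exact hB.count U hU S v

theorem length_children_le_card (T : JoinTree A) (i : Fin m) : (T.children i).length ≤ m :=
  JoinTree.length_le_of_nodup (T.nodup_children i)

/-- The first term of the cost pays for the sorts of the rows of `i`, one per child and one for the
group-by; the second pays for reading the botjoins of the children. -/
theorem botStep_spec (hB : Bounds D z Z W Λ) {bot : Fin m → List ((∀ a, dom a) × ℕ)} {i : Fin m}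
    (hbot : ∀ c, T.parent c = some i → IsBot T D c (bot c)) :
    (botStep T D bot i).Spec (fun bot' => ∃ b, bot' = Function.update bot i b ∧ IsBot T D i b)
      (10 * (((T.nbrs i).length + 1) * unit (D i).length Λ) +
        ((T.nbrs i).map fun j => (D j).length).sum) W := by
  have hW1 := hB.one_le
  have hWs : ∀ c, (T.sep c).card + (Z + 1) ^ 2 + 1 ≤ W := fun c => hB.card_le (T.sep_subset c)
  have hWZ : (Z + 1) ^ 2 + 1 ≤ W := by have := hWs i; omega
  have hch : ∀ c ∈ T.children i, IsBot T D c (bot c) := fun c hc => hbot c (T.mem_children.1 hc)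
  have hsz : ∀ v, ∀ c ∈ T.children i, (tableCount (T.sep c) (bot c) v).size ≤ z :=
    fun v c hc => size_tableCount_le hB (hch c hc) (T.nodup_sub c) v
  have hlenm := length_children_le_card T i
  have hbig := hB.big
  rw [mul_add, mul_one] at hbig
  have hmul : (T.children i).length * z ≤ z * m := by
    rw [mul_comm z]; exact Nat.mul_le_mul_right _ hlenm
  have hz1 : 1 ≤ z := by simpa [joinCount] using hB.count [] List.nodup_nil ∅ fun _ => default
  set f : (∀ a, dom a) → Fin m → ℕ := fun v c => tableCount (T.sep c) (bot c) v with hf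
  unfold botStep
  refine ((readRel_spec hB i).bind (t' := ((T.children i).length * 7 + 8) * unit (D i).length Λ +
    ((T.children i).map fun j => (D j).length).sum) fun rows hrows => ((joinChildren_spec (q := fun c => (D c).length)
    (Λ := Λ) (W := W) (fun c => by have := hWs c; omega) rows (by rw [hrows, List.length_map]; exact hB.log i)
    (T.children i) fun c hc => ⟨(hch c hc).strict, (hch c hc).length_le⟩).bind
    (t' := ((T.children i).length * 3 + 7) * unit (D i).length Λ) fun rows' hrows' => ?_).le ?_).le ?_
  · subst hrows
    rw [List.map_map] at hrows'
    have hrows'' : rows'.Perm (((D i).map (extend (A i))).map fun v =>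
        (v, (1, (T.children i).map (f v)))) := by
      rw [List.map_map]
      refine hrows'.trans (List.Perm.of_eq (List.map_congr_left fun t _ => ?_))
      simp [hf]
    obtain ⟨vs, hvs, rfl⟩ := exists_map_of_perm hrows''
    have hlen : vs.length = (D i).length := by rw [hvs.length_eq, List.length_map]
    refine ((Spec.mapT (g := fun r => (r.1, ((T.children i).map (f r.1)).prod))
      (t := 3 * (T.children i).length + 1) hW1 _ fun r hr => ?_).bind
      (t' := 5 * unit (D i).length Λ) fun rows hrows => ?_).le ?_
    · obtain ⟨v, -, rfl⟩ := List.mem_map.1 hr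
      refine ((others_spec (Z := Z) (z := z) hWZ (f v) (T.children i) 1 (T.nodup_children i) (hsz v)
        ?_).bind fun x hx => Spec.pure ?_).le le_rfl
      · rw [Nat.size_one]; omega
      · rw [hx.2.1]
    · rw [List.map_map] at hrows
      have hrows' : rows = vs.map fun v => (v, ((T.children i).map (f v)).prod) := hrows
      subst hrows'
      refine ((groupBy_add_spec (T.sep i) (hWs i) _ ?_ (Λ := Λ) ?_).bind fun b hb =>
        (Spec.tick (w := 0) hW1).bind fun _ _ => Spec.pure ⟨b, rfl, ?_⟩).le ?_
      · rw [List.map_map]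
        -- A product over the children has at most `m z + 1` bits, and a sum over the rows of `i`
        -- adds at most as many bits as there are rows. This is the reason for the terms of `Z`.
        refine (size_sum_le (s := (T.children i).length * z + 1) _ fun x hx => ?_).trans ?_
        · obtain ⟨v, -, rfl⟩ := List.mem_map.1 hx
          refine (size_prod_le (s := z) _ fun y hy => ?_).trans (by simp)
          obtain ⟨c, hc, rfl⟩ := List.mem_map.1 hy
          exact hsz v c hc
        · rw [List.length_map, hlen]
          have := length_le_sum D i
          omega
      · rw [List.length_map, hlen]; exact hB.log i
      · rw [List.length_map, hlen]
        have := le_unit (D i).length Λ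
        omega
      · obtain ⟨⟨h1, h2⟩, h3⟩ := hb
        refine ⟨h1, by simpa [hlen] using h2, fun v => ?_⟩
        rw [h3, tableCount_map (T.sep i) (fun v => v), joinCount_sub, (hvs.map _).sum_eq,
          List.map_map]
        congr 1
        refine List.map_congr_left fun t _ => ?_
        simp only [Function.comp_apply]
        congr 2
        exact List.map_congr_left fun c hc => (hch c hc).count _
    · rw [List.length_map, hlen]
      have := le_unit (D i).length Λ
      have h5 := Nat.mul_le_mul_right (T.children i).length
        (show (D i).length ≤ unit (D i).length Λ by omega)
      have h6 : (D i).length + 1 ≤ unit (D i).length Λ := by omega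
      linarith
  · rw [hrows, List.length_map]
    have h1 := le_unit (D i).length Λ
    change (T.children i).length * (4 * unit (D i).length Λ) + _ + 1 + _ ≤ _
    nlinarith
  · have h1 := le_unit (D i).length Λ
    have h2 := T.length_children_le i
    have h3 := T.sum_children_le i fun j => (D j).length
    have h4 := Nat.mul_le_mul_right (unit (D i).length Λ) h2
    nlinarith

theorem distribute_spec (hW : ∀ c, (T.sep c).card + (Z + 1) ^ 2 + 1 ≤ W)
    (vs : List (∀ a, dom a)) (hΛ : Nat.clog 2 vs.length ≤ Λ) (h : (∀ a, dom a) → Fin m → ℕ) :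
    ∀ (cs : List (Fin m)) (top : Fin m → List ((∀ a, dom a) × ℕ)), cs.Nodup →
      (∀ c ∈ cs, (vs.map fun v => h v c).sum.size ≤ Z) →
      (distribute T cs (vs.map fun v => (v, cs.map (h v))) top).Spec
        (fun top' => (∀ c ∈ cs, Grouped (T.sep c) (vs.map fun v => (v, h v c)) (top' c) ∧
          ∀ u, tableCount (T.sep c) (top' c) u =
            tableCount (T.sep c) (vs.map fun v => (v, h v c)) u) ∧ ∀ c ∉ cs, top' c = top c)
        (cs.length * (5 * unit vs.length Λ) + 1) W
  | [], top, _, _ => by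
      rw [distribute]
      refine ((Spec.tick (w := 0) ?_).bind fun _ _ => Spec.pure ?_).le (by simp)
      · have := hW T.root; omega
      · simp
  | c :: cs, top, hnd, hs => by
      obtain ⟨hc, hnd⟩ := List.nodup_cons.1 hnd
      have hW1 : 1 ≤ W := by have := hW c; omega
      rw [distribute]
      refine ((Spec.mapT (t := 1) (g := fun r : (∀ a, dom a) × List ℕ => (r.1, r.2.headD 0)) hW1 _
        fun r _ => Spec.tick_pure (w := 0) hW1 _).bind
        fun col hcol => (Spec.mapT (t := 1) (g := fun r : (∀ a, dom a) × List ℕ => (r.1, r.2.tail))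
          hW1 _ fun r _ => Spec.tick_pure (w := 0) hW1 _).bind
        (t' := 4 * (vs.length * Λ) + vs.length + 2 + (cs.length * (5 * unit vs.length Λ) + 1))
        fun rest hrest => ?_).le ?_
      · rw [List.map_map] at hcol hrest
        have hcol' : col = vs.map fun v => (v, h v c) := hcol
        have hrest' : rest = vs.map fun v => (v, cs.map (h v)) := hrest
        subst hcol' hrest'
        refine ((groupBy_add_spec (T.sep c) (hW c) (vs.map fun v => (v, h v c))
          (by rw [List.map_map]; exact hs c (by simp)) (Λ := Λ) (by simpa using hΛ)).bind
          fun g hg => (distribute_spec hW vs hΛ h cs _ hnd fun c hc => hs c (by simp [hc])).mono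
          ?_ le_rfl).le (by simp)
        rintro top' ⟨h1, h2⟩
        refine ⟨fun c' hc' => ?_, fun c' hc' => ?_⟩
        · rcases List.mem_cons.1 hc' with rfl | hc'
          · rw [h2 c' hc, Function.update_self]
            exact hg
          · exact h1 c' hc'
        · simp only [List.mem_cons, not_or] at hc'
          rw [h2 c' hc'.2, Function.update_of_ne hc'.1]
      · simp only [List.length_map, List.length_cons]
        have := le_unit vs.length Λ
        nlinarith

/-- All the children are treated at once: `others` yields for each row the products omitting one
child, so the number of sorts is linear and not quadratic in the degree. -/
theorem topStep_spec (hB : Bounds D z Z W Λ) {bot top : Fin m → List ((∀ a, dom a) × ℕ)} {p : Fin m}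
    (hbot : ∀ c, T.parent c = some p → IsBot T D c (bot c)) (htop : IsTop T D p (top p)) :
    (topStep T D bot top p).Spec
      (fun top' => (∀ c, T.parent c = some p → IsTop T D c (top' c)) ∧
        ∀ c, T.parent c ≠ some p → top' c = top c)
      (12 * (((T.nbrs p).length + 1) * unit (D p).length Λ) +
        ((T.nbrs p).map fun j => (D j).length).sum) W := by
  have hW1 := hB.one_le
  have hWs : ∀ c, (T.sep c).card + (Z + 1) ^ 2 + 1 ≤ W := fun c => hB.card_le (T.sep_subset c)
  have hWZ : (Z + 1) ^ 2 + 1 ≤ W := by have := hWs p; omega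
  have hch : ∀ c ∈ T.children p, IsBot T D c (bot c) := fun c hc => hbot c (T.mem_children.1 hc)
  have hsz : ∀ v, ∀ c ∈ T.children p, (tableCount (T.sep c) (bot c) v).size ≤ z :=
    fun v c hc => size_tableCount_le hB (hch c hc) (T.nodup_sub c) v
  have hlenm := length_children_le_card T p
  have hbig := hB.big
  rw [mul_add, mul_one] at hbig
  have hmul : (T.children p).length * z ≤ z * m := by
    rw [mul_comm z]; exact Nat.mul_le_mul_right _ hlenm
  set f : (∀ a, dom a) → Fin m → ℕ := fun v c => tableCount (T.sep c) (bot c) v with hf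
  set pre : (∀ a, dom a) → ℕ := fun v => joinCount D (T.subCompl p) (T.sep p) v with hpre
  have hpz : ∀ v, (pre v).size ≤ z := fun v => hB.count _ (T.nodup_subCompl p) _ _
  have hu := le_unit (D p).length Λ
  have hsum : (((T.parent p).toList).map fun j => (D j).length).sum +
      ((T.children p).map fun j => (D j).length).sum =
      ((T.nbrs p).map fun j => (D j).length).sum := by simp [JoinTree.nbrs]
  -- The root and the other nodes differ only in the initial count of a row, `1` or the entry of the
  -- topjoin. Both equal `pre`, since the complement of the whole tree gives an empty product.
  have htail : ∀ rows : List ((∀ a, dom a) × (ℕ × List ℕ)),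
      rows.Perm ((D p).map fun t => (extend (A p) t, (pre (extend (A p) t), []))) →
      (do
        let rows ← joinChildren T bot (T.children p) rows
        let rows ← mapT (fun r : (∀ a, dom a) × (ℕ × List ℕ) => do
          let x ← others r.2.1 r.2.2
          pure (r.1, x.1)) rows
        distribute T (T.children p) rows top).Spec
      (fun top' => (∀ c, T.parent c = some p → IsTop T D c (top' c)) ∧
        ∀ c, T.parent c ≠ some p → top' c = top c)
      (((T.children p).length * 12 + 5) * unit (D p).length Λ +
        ((T.children p).map fun j => (D j).length).sum) W := by
    intro rows hrows
    have hl : rows.length = (D p).length := by rw [hrows.length_eq, List.length_map]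
    refine ((joinChildren_spec (q := fun c => (D c).length)
      (Λ := Λ) (W := W) (fun c => by have := hWs c; omega) rows (by rw [hl]; exact hB.log p)
      (T.children p) fun c hc => ⟨(hch c hc).strict, (hch c hc).length_le⟩).bind
      (t' := ((T.children p).length * 8 + 4) * unit (D p).length Λ) fun rows' hrows' => ?_).le ?_
    · have hrows'' : rows'.Perm (((D p).map (extend (A p))).map fun v =>
          (v, (pre v, (T.children p).map (f v)))) := by
        rw [List.map_map]
        refine hrows'.trans ((hrows.map _).trans ?_)
        rw [List.map_map]
        refine List.Perm.of_eq (List.map_congr_left fun t _ => ?_)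
        simp [hf]
      obtain ⟨vs, hvs, rfl⟩ := exists_map_of_perm hrows''
      have hlen : vs.length = (D p).length := by rw [hvs.length_eq, List.length_map]
      set h : (∀ a, dom a) → Fin m → ℕ :=
        fun v c => pre v * (((T.children p).erase c).map (f v)).prod with hh
      refine ((Spec.mapT (g := fun r => (r.1, (T.children p).map (h r.1)))
        (t := 3 * (T.children p).length + 1) hW1 _ fun r hr => ?_).bind
        (t' := (T.children p).length * (5 * unit (D p).length Λ) + 1) fun rows hrows => ?_).le ?_
      · obtain ⟨v, -, rfl⟩ := List.mem_map.1 hr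
        refine ((others_spec (Z := Z) (z := z) hWZ (f v) (T.children p) (pre v) (T.nodup_children p)
          (hsz v) ?_).bind fun x hx => Spec.pure ?_).le le_rfl
        · have := hpz v; omega
        · rw [hx.1]
      · rw [List.map_map] at hrows
        have hrows' : rows = vs.map fun v => (v, (T.children p).map (h v)) := hrows
        subst hrows'
        refine (distribute_spec hWs vs (Λ := Λ) (by rw [hlen]; exact hB.log p) h (T.children p) top
          (T.nodup_children p) fun c hc => ?_).mono ?_ (by rw [hlen])
        · refine (size_sum_le (s := z + ((T.children p).length * z + 1)) _ fun x hx => ?_).trans ?_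
          · obtain ⟨v, -, rfl⟩ := List.mem_map.1 hx
            refine (size_mul_le _ _).trans (Nat.add_le_add (hpz v) ?_)
            refine (size_prod_le (s := z) _ fun y hy => ?_).trans ?_
            · obtain ⟨c, hc, rfl⟩ := List.mem_map.1 hy
              exact hsz v c (List.mem_of_mem_erase hc)
            · rw [List.length_map]
              have := Nat.mul_le_mul_right z
                ((List.erase_sublist (a := c) (l := T.children p)).length_le)
              omega
          · rw [List.length_map, hlen]
            have := length_le_sum D p
            omega
        · rintro top' ⟨h1, h2⟩
          refine ⟨fun c hc p' hp' => ?_, fun c hc => h2 c (mt T.mem_children.1 hc)⟩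
          obtain rfl : p = p' := Option.some.inj (hc.symm.trans hp')
          obtain ⟨⟨g1, g2⟩, g3⟩ := h1 c (T.mem_children.2 hc)
          refine ⟨g1, by simpa [hlen] using g2, fun u => ?_⟩
          rw [g3, tableCount_map (T.sep c) (fun v => v), joinCount_subCompl D hc,
            (hvs.map _).sum_eq, List.map_map]
          congr 1
          refine List.map_congr_left fun t _ => ?_
          simp only [Function.comp_apply, hh, hpre]
          congr 3
          exact List.map_congr_left fun c' hc' => (hch c' (List.mem_of_mem_erase hc')).count _
      · rw [List.length_map, hlen]
        have h5 := Nat.mul_le_mul_right (T.children p).length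
          (show (D p).length ≤ unit (D p).length Λ by omega)
        have h6 : (D p).length + 1 ≤ unit (D p).length Λ := by omega
        linarith
    · rw [hl]
      change (T.children p).length * (4 * unit (D p).length Λ) + _ + 1 + _ ≤ _
      nlinarith
  unfold topStep
  refine ((readRel_spec hB p).bind (t' := 4 * unit (D p).length Λ +
    (((T.parent p).toList).map fun j => (D j).length).sum +
    (((T.children p).length * 12 + 5) * unit (D p).length Λ +
      ((T.children p).map fun j => (D j).length).sum)) fun rows hrows => ?_).le ?_
  · subst hrows
    split
    · rename_i hp
      refine ((Spec.tick (w := 0) hW1).bind fun _ _ => (Spec.pure (P := (· = _)) rfl).bind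
        fun rows hrows => htail rows ?_).le ?_
      · subst hrows
        refine List.Perm.of_eq (List.map_congr_left fun t _ => ?_)
        have : T.subCompl p = [] := by rw [(T.parent_eq_none p).1 hp, T.subCompl_root]
        simp only [hpre, this, joinCount]
      · omega
    · rename_i q hq
      have ht := htop q hq
      refine ((lookupJoin_spec (T.sep p) (by have := hWs p; omega) _ (top p) ht.strict (Λ := Λ)
        (by rw [List.length_map]; exact hB.log p)).bind (t' := (D p).length * 2 + 1 +
          (((T.children p).length * 12 + 5) * unit (D p).length Λ +
            ((T.children p).map fun j => (D j).length).sum))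
        fun j hj => ((Spec.mapT (t := 1) (g := fun r => (r.1.1, (countOf r.2, r.1.2.2))) hW1 j
          fun b _ => Spec.tick_pure (w := 0) hW1 _).bind fun rows hrows => htail rows ?_).le ?_).le ?_
      · subst hrows
        refine (hj.map _).trans ?_
        rw [List.map_map, List.map_map]
        refine List.Perm.of_eq (List.map_congr_left fun t _ => ?_)
        simp only [Function.comp_apply, countOf_lookup ht.strict, ht.count, hpre]
      · rw [hj.length_eq]; simp
      · have := ht.length_le
        simp only [hq, Option.toList_some, List.map_cons, List.map_nil, List.sum_cons, List.sum_nil,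
          List.length_map]
        omega
  · have h2 := T.length_children_le p
    have h4 := Nat.mul_le_mul_right (unit (D p).length Λ) h2
    nlinarith

theorem foldT_botStep_spec (hB : Bounds D z Z W Λ) :
    (foldT (botStep T D) T.postOrder fun _ => []).Spec (fun bot => ∀ i, IsBot T D i (bot i))
      (∑ i, (10 * (((T.nbrs i).length + 1) * unit (D i).length Λ) +
        ((T.nbrs i).map fun j => (D j).length).sum + 1) + 1) W := by
  have := Spec.foldT (f := botStep T D) (W := W) (cost := fun i =>
      10 * (((T.nbrs i).length + 1) * unit (D i).length Λ) +
        ((T.nbrs i).map fun j => (D j).length).sum) hB.one_le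
    (fun l bot => ∀ i ∈ l, IsBot T D i (bot i)) T.postOrder [] (fun _ => []) ?_ (by simp)
  · rw [T.sum_map_postOrder] at this
    exact this.mono (fun bot h i => h i (T.mem_postOrder i)) le_rfl
  · intro l i r hl bot hbot
    have hord := T.postOrder_pairwise
    rw [hl] at hord
    have hnd := T.nodup_postOrder
    rw [hl] at hnd
    refine (botStep_spec hB fun c hc => hbot c ?_).mono ?_ le_rfl
    · have hc' := T.mem_postOrder c
      rw [hl] at hc'
      rcases List.mem_append.1 hc' with h | h
      · exact h
      · have hlt := T.parent_pos hc
        rcases List.mem_cons.1 h with rfl | h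
        · exact absurd hlt (lt_irrefl _)
        · exact absurd hlt (lt_asymm
            ((List.pairwise_cons.1 (List.pairwise_append.1 hord).2.1).1 c h))
    · rintro _ ⟨b, rfl, hb⟩ j hj
      by_cases hji : j = i
      · subst hji; rwa [Function.update_self]
      · rw [Function.update_of_ne hji]
        exact hbot j (by simpa [hji] using hj)

/-- A topjoin is written while its parent is processed, so the invariant concerns the children of
the processed nodes. In the reversed order every parent precedes its children. -/
theorem foldT_topStep_spec (hB : Bounds D z Z W Λ) {bot : Fin m → List ((∀ a, dom a) × ℕ)}
    (hbot : ∀ i, IsBot T D i (bot i)) :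
    (foldT (topStep T D bot) T.postOrder.reverse fun _ => []).Spec
      (fun top => ∀ i, IsTop T D i (top i))
      (∑ i, (12 * (((T.nbrs i).length + 1) * unit (D i).length Λ) +
        ((T.nbrs i).map fun j => (D j).length).sum + 1) + 1) W := by
  have := Spec.foldT (f := topStep T D bot) (W := W) (cost := fun i =>
      12 * (((T.nbrs i).length + 1) * unit (D i).length Λ) +
        ((T.nbrs i).map fun j => (D j).length).sum) hB.one_le
    (fun l top => ∀ p ∈ l, ∀ i, T.parent i = some p → IsTop T D i (top i))
    T.postOrder.reverse [] (fun _ => []) ?_ (by simp)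
  · rw [List.map_reverse, List.sum_reverse, T.sum_map_postOrder] at this
    refine this.mono (fun top h i p hp => h p ?_ i hp p hp) le_rfl
    simp [T.mem_postOrder p]
  · intro l p r hl top htop
    have hord := List.pairwise_reverse.2 T.postOrder_pairwise
    rw [hl] at hord
    refine (topStep_spec hB (fun c _ => hbot c) fun q hq => htop q ?_ p hq q hq).mono ?_ le_rfl
    · have hc' := List.mem_reverse.2 (T.mem_postOrder q)
      rw [hl] at hc'
      rcases List.mem_append.1 hc' with h | h
      · exact h
      · have hlt := T.parent_pos hq
        rcases List.mem_cons.1 h with rfl | h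
        · exact absurd hlt (lt_irrefl _)
        · exact absurd hlt (lt_asymm
            ((List.pairwise_cons.1 (List.pairwise_append.1 hord).2.1).1 q h))
    · rintro top' ⟨h1, h2⟩ p' hp' i hi
      by_cases hpp : p' = p
      · subst hpp; exact h1 i hi
      · rw [h2 i (by rw [hi]; simpa using hpp)]
        exact htop p' (by simpa [hpp] using hp') i hi

/-- The multiplicity table of node `i` holds the upward tuple sensitivities. -/
theorem multTable_eq {bot top : Fin m → List ((∀ a, dom a) × ℕ)}
    (hbot : ∀ i, IsBot T D i (bot i)) (htop : ∀ i, IsTop T D i (top i)) (i : Fin m)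
    (t : Tup dom (A i)) : multTable T bot top i t =
      joinCount D (Finset.univ.erase i).toList (A i) (extend (A i) t) := by
  rw [multTable, joinCount_erase D T]
  congr 1
  · cases hi : T.parent i with
    | none =>
      have : T.subCompl i = [] := by rw [(T.parent_eq_none i).1 hi, T.subCompl_root]
      rw [if_pos rfl, this, joinCount]
    | some p => rw [if_neg (by simp), (htop i p hi).count]
  · congr 1
    exact List.map_congr_left fun c _ => (hbot c).count _

end Messages

end JoinLS

namespace JoinLS

open Timed

/-! ## Computing a GYO decomposition -/

section Gyo

variable {α : Type} [LinearOrder α] {ι : Type} [DecidableEq ι] {E : ι → Finset α} {W k : ℕ}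

/-- A complete GYO decomposition of the hyperedges in `L`: the ears in the order of their removal,
with their witnesses. -/
inductive GYOSeq (E : ι → Finset α) : List ι → List (ι × Option ι) → Prop
  | nil : GYOSeq E [] []
  | isolated (L : List ι) (j : ι) (P : List (ι × Option ι)) (hj : j ∈ L)
      (h : ∀ x ∈ L, x ≠ j → Disjoint (E j) (E x)) (hP : GYOSeq E (L.erase j) P) :
      GYOSeq E L ((j, none) :: P)
  | ear (L : List ι) (j w : ι) (P : List (ι × Option ι)) (hj : j ∈ L) (hw : w ∈ L) (hwj : w ≠ j)
      (h : ∀ x ∈ L, x ≠ j → E j ∩ E x ⊆ E w) (hP : GYOSeq E (L.erase j) P) :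
      GYOSeq E L ((j, some w) :: P)

theorem GYOSeq.length_eq {L : List ι} {P : List (ι × Option ι)} (h : GYOSeq E L P) :
    P.length = L.length := by
  induction h with
  | nil => rfl
  | isolated L j P hj _ _ ih =>
    have := List.length_pos_of_mem hj
    rw [List.length_cons, ih, List.length_erase_of_mem hj]; omega
  | ear L j w P hj _ _ _ _ ih =>
    have := List.length_pos_of_mem hj
    rw [List.length_cons, ih, List.length_erase_of_mem hj]; omega

theorem sharedPart_spec (hk : ∀ j, (E j).card ≤ k) (hW : 2 * k + 1 ≤ W) (e : Finset α)
    (he : e.card ≤ k) : ∀ l : List ι, (sharedPart E e l).Spec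
      (fun s => ∀ a, a ∈ s ↔ a ∈ e ∧ ∃ w ∈ l, a ∈ E w) (l.length + 1) W
  | [] => by
      rw [sharedPart]
      refine ((Spec.tick (w := 0) (by omega)).bind fun _ _ => Spec.pure ?_).le (by simp)
      simp
  | w :: l => by
      rw [sharedPart]
      refine ((Spec.tick (by have := hk w; omega)).bind fun _ _ =>
        (sharedPart_spec hk hW e he l).bind fun r hr => Spec.pure ?_).le (by simp; omega)
      intro a
      rw [Finset.mem_union, Finset.mem_inter, hr]
      simp only [List.mem_cons, exists_eq_or_imp]
      tauto

theorem findWitness_spec (hk : ∀ j, (E j).card ≤ k) (hW : 2 * k + 1 ≤ W) (s : Finset α)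
    (hs : s.card ≤ k) : ∀ l : List ι, (findWitness E s l).Spec (fun r => match r with
      | none => ∀ w ∈ l, ¬ s ⊆ E w
      | some w => w ∈ l ∧ s ⊆ E w) (l.length + 1) W
  | [] => by
      rw [findWitness]
      refine ((Spec.tick (w := 0) (by omega)).bind fun _ _ => Spec.pure ?_).le (by simp)
      simp
  | w :: l => by
      rw [findWitness]
      refine ((Spec.tick (by have := hk w; omega)).bind (t' := l.length + 1) fun _ _ => ?_).le
        (by simp; omega)
      split_ifs with h
      · exact (Spec.pure ⟨by simp, h⟩).le (by omega)
      · refine (findWitness_spec hk hW s hs l).mono ?_ le_rfl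
        intro r hr
        match r, hr with
        | none, hr => simpa [h] using hr
        | some x, ⟨h1, h2⟩ => exact ⟨by simp [h1], h2⟩

/-- A hyperedge is an ear precisely when the union of its shared parts is empty or fits into one
other hyperedge. Forming this union first replaces a quadratic comparison by two linear passes. -/
theorem earWitness_spec (hk : ∀ j, (E j).card ≤ k) (hW : 2 * k + 1 ≤ W) (j : ι) (l : List ι) :
    (earWitness E j l).Spec (fun r => match r with
      | none => (∃ x ∈ l, ¬ Disjoint (E j) (E x)) ∧ ∀ w ∈ l, ∃ x ∈ l, ¬ E j ∩ E x ⊆ E w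
      | some none => ∀ x ∈ l, Disjoint (E j) (E x)
      | some (some w) => w ∈ l ∧ ∀ x ∈ l, E j ∩ E x ⊆ E w) (2 * l.length + 2) W := by
  unfold earWitness
  refine ((sharedPart_spec hk hW (E j) (hk j) l).bind (t' := l.length + 1) fun s hs => ?_).le
    (by omega)
  split_ifs with h
  · refine (Spec.pure ?_).le (Nat.zero_le _)
    intro x hx
    refine Finset.disjoint_left.2 fun a ha ha' => ?_
    have := (hs a).2 ⟨ha, x, hx, ha'⟩
    simp [h] at this
  · have hcard : s.card ≤ k :=
      (Finset.card_le_card fun a ha => ((hs a).1 ha).1).trans (hk j)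
    refine ((findWitness_spec hk hW s hcard l).bind (t' := 0) fun w hw => ?_).le le_rfl
    match w, hw with
    | none, hw =>
      refine Spec.pure ⟨?_, fun w hwl => ?_⟩
      · obtain ⟨a, ha⟩ := Finset.nonempty_iff_ne_empty.2 h
        obtain ⟨h1, x, hx, h2⟩ := (hs a).1 ha
        exact ⟨x, hx, fun hd => Finset.disjoint_left.1 hd h1 h2⟩
      · obtain ⟨a, ha, haw⟩ := Finset.not_subset.1 (hw w hwl)
        obtain ⟨h1, x, hx, h2⟩ := (hs a).1 ha
        exact ⟨x, hx, fun hsub => haw (hsub (Finset.mem_inter.2 ⟨h1, h2⟩))⟩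
    | some w, ⟨hwl, hw⟩ =>
      refine Spec.pure ⟨hwl, fun x hx a ha => hw ((hs a).2 ?_)⟩
      exact ⟨(Finset.mem_inter.1 ha).1, x, hx, (Finset.mem_inter.1 ha).2⟩

/-- The removal of an ear `j` with witness `w` can turn only `w` into a new ear. -/
theorem IsEar.of_erase {s : Finset ι} {j w x : ι} (hw : w ∈ s) (hwj : w ≠ j)
    (h : ∀ y ∈ s, y ≠ j → E j ∩ E y ⊆ E w) (hxw : x ≠ w)
    (hx : IsEar E (s.erase j) x) : IsEar E s x := by
  obtain ⟨hxs, hx⟩ := hx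
  obtain ⟨hxj, hxs⟩ := Finset.mem_erase.1 hxs
  have hw' : w ∈ s.erase j := Finset.mem_erase.2 ⟨hwj, hw⟩
  -- What `x` shares with the removed ear it also shares with `w`, so a witness of `x` for the
  -- remaining hyperedges covers `j` as well.
  have hxj' : E x ∩ E j ⊆ E x ∩ E w := fun a ha => by
    obtain ⟨h1, h2⟩ := Finset.mem_inter.1 ha
    exact Finset.mem_inter.2 ⟨h1, h x hxs hxj (Finset.mem_inter.2 ⟨h2, h1⟩)⟩
  refine ⟨hxs, hx.imp (fun hd y hy hyx => ?_) ?_⟩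
  · by_cases hyj : y = j
    · subst hyj
      have := hd w hw' (Ne.symm hxw)
      rw [Finset.disjoint_iff_inter_eq_empty] at this ⊢
      exact Finset.subset_empty.1 (this ▸ hxj')
    · exact hd y (Finset.mem_erase.2 ⟨hyj, hy⟩) hyx
  · rintro ⟨u, hu, hux, hd⟩
    refine ⟨u, Finset.mem_of_mem_erase hu, hux, fun y hy hyx => ?_⟩
    by_cases hyj : y = j
    · subst hyj
      exact hxj'.trans (hd w hw' (Ne.symm hxw))
    · exact hd y (Finset.mem_erase.2 ⟨hyj, hy⟩) hyx

theorem IsEar.of_erase_isolated {s : Finset ι} {j x : ι}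
    (h : ∀ y ∈ s, y ≠ j → Disjoint (E j) (E y))
    (hx : IsEar E (s.erase j) x) : IsEar E s x := by
  obtain ⟨hxs, hx⟩ := hx
  obtain ⟨hxj, hxs⟩ := Finset.mem_erase.1 hxs
  have hd0 := (h x hxs hxj).symm
  refine ⟨hxs, hx.imp (fun hd y hy hyx => ?_) ?_⟩
  · by_cases hyj : y = j
    · exact hyj ▸ hd0
    · exact hd y (Finset.mem_erase.2 ⟨hyj, hy⟩) hyx
  · rintro ⟨u, hu, hux, hd⟩
    refine ⟨u, Finset.mem_of_mem_erase hu, hux, fun y hy hyx => ?_⟩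
    by_cases hyj : y = j
    · rw [hyj, Finset.disjoint_iff_inter_eq_empty.1 hd0]; exact Finset.empty_subset _
    · exact hd y (Finset.mem_erase.2 ⟨hyj, hy⟩) hyx

theorem toFinset_erase {L : List ι} (hL : L.Nodup) (j : ι) :
    (L.erase j).toFinset = L.toFinset.erase j := by
  ext x
  simp [hL.mem_erase_iff]

/-- The invariant is that every ear of `L` is among the candidates `cs`; when these run out, `L` has
no ear and, being acyclic, is empty. Each test lowers `cs.length + L.length`, since the removal of
an ear shortens `L` and adds at most one candidate. Twice the initial length is therefore enough
fuel. -/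
theorem gyo_spec (hk : ∀ j, (E j).card ≤ k) (hW : 2 * k + 1 ≤ W) {ℓ : ℕ} :
    ∀ (q : ℕ) (cs L : List ι), L.Nodup → L.length ≤ ℓ → cs.length + L.length ≤ q →
      (∀ j ∈ L, j ∉ cs → ¬ IsEar E L.toFinset j) → GYOAcyclic E L.toFinset →
      (gyo E q cs L).Spec (GYOSeq E L) (q * (3 * ℓ + 1) + 1) W
  | 0, cs, L, _, _, hq, _, _ => by
      rw [gyo]
      refine ((Spec.tick (w := 0) (by omega)).bind fun _ _ => Spec.pure ?_).le (by simp)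
      rw [List.eq_nil_of_length_eq_zero (show L.length = 0 by omega)]
      exact .nil
  | q + 1, [], L, _, _, _, hear, hac => by
      rw [gyo]
      refine ((Spec.tick (w := 0) (by omega)).bind fun _ _ => Spec.pure ?_).le (by omega)
      have : L = [] := by
        by_contra h
        obtain ⟨i, hi⟩ := hac.exists_isEar (by simpa using h)
        exact hear i (by simpa using hi.1) (by simp) hi
      rw [this]
      exact .nil
  | q + 1, j :: cs, L, hL, hℓ, hq, hear, hac => by
      rw [gyo]
      simp only [List.length_cons] at hq
      refine ((Spec.ticks (by omega)).bind (t' := 2 * ℓ + (q * (3 * ℓ + 1) + 1)) fun _ _ => ?_).le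
        (by rw [add_mul]; omega)
      split_ifs with hj
      · have hpos := List.length_pos_of_mem hj
        have hlen := List.length_erase_of_mem hj
        have hfin := toFinset_erase hL j
        have hmem : ∀ x, x ∈ L.erase j ↔ x ∈ L ∧ x ≠ j := fun x => by
          rw [hL.mem_erase_iff, and_comm]
        refine ((earWitness_spec hk hW j (L.erase j)).bind (t' := q * (3 * ℓ + 1) + 1)
          fun x hx => ?_).le (by omega)
        match x, hx with
        | none, ⟨h1, h2⟩ =>
          refine gyo_spec hk hW q cs L hL hℓ (by omega) (fun y hy hyc => ?_) hac
          by_cases hyj : y = j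
          · subst hyj
            rintro ⟨-, h | ⟨w, hw, hwy, h⟩⟩
            · obtain ⟨x, hx, hd⟩ := h1
              exact hd (h x (by simp [((hmem x).1 hx).1]) ((hmem x).1 hx).2)
            · obtain ⟨x, hx, hd⟩ := h2 w ((hmem w).2 ⟨by simpa using hw, hwy⟩)
              exact hd (h x (by simp [((hmem x).1 hx).1]) ((hmem x).1 hx).2)
          · exact hear y hy (by simp [hyj, hyc])
        | some none, h =>
          have h' : ∀ x ∈ L, x ≠ j → Disjoint (E j) (E x) := fun x hx hxj =>
            h x ((hmem x).2 ⟨hx, hxj⟩)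
          have hjear : IsEar E L.toFinset j := ⟨by simpa using hj, .inl fun x hx =>
            h' x (by simpa using hx)⟩
          refine ((gyo_spec hk hW q cs (L.erase j) (hL.erase j) (by omega) (by omega)
            (fun y hy hyc => ?_) (by rw [hfin]; exact hac.erase hjear)).bind fun P hP =>
              Spec.pure (GYOSeq.isolated L j P hj h' hP)).le le_rfl
          rw [hfin]
          refine fun hy' => hear y ((hmem y).1 hy).1 (by simp [((hmem y).1 hy).2, hyc]) ?_
          exact hy'.of_erase_isolated fun x hx => h' x (by simpa using hx)
        | some (some w), ⟨hw, h⟩ =>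
          have h' : ∀ x ∈ L, x ≠ j → E j ∩ E x ⊆ E w := fun x hx hxj =>
            h x ((hmem x).2 ⟨hx, hxj⟩)
          obtain ⟨hwL, hwj⟩ := (hmem w).1 hw
          have hjear : IsEar E L.toFinset j := ⟨by simpa using hj, .inr ⟨w, by simpa using hwL, hwj,
            fun x hx => h' x (by simpa using hx)⟩⟩
          refine ((gyo_spec hk hW q (w :: cs) (L.erase j) (hL.erase j) (by omega)
            (by simp only [List.length_cons]; omega)
            (fun y hy hyc => ?_) (by rw [hfin]; exact hac.erase hjear)).bind fun P hP =>
              Spec.pure (GYOSeq.ear L j w P hj hwL hwj h' hP)).le le_rfl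
          simp only [List.mem_cons, not_or] at hyc
          rw [hfin]
          refine fun hy' => hear y ((hmem y).1 hy).1 (by simp [((hmem y).1 hy).2, hyc.2]) ?_
          exact hy'.of_erase (by simpa using hwL) hwj (fun x hx => h' x (by simpa using hx)) hyc.1
      · refine (gyo_spec hk hW q cs L hL hℓ (by omega) (fun y hy hyc => hear y hy ?_) hac).le
          (by omega)
        simp only [List.mem_cons, not_or]
        exact ⟨by rintro rfl; exact hj hy, hyc⟩

end Gyo

/-! ## The largest entry of a multiplicity table -/

section Max

variable {α : Type} [LinearOrder α] {dom : α → Type} [∀ a, LinearOrder (dom a)]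
  [∀ a, Inhabited (dom a)] {m : ℕ} {A : Fin m → Finset α}

theorem prod_erase_update {ι M : Type} [DecidableEq ι] [CommMonoid M] {s : Finset ι} {e w : ι}
    (he : e ∈ s) (hw : w ∈ s) (hwe : w ≠ e) (φ : ι → M) :
    ∏ j ∈ s.erase e, Function.update φ w (φ w * φ e) j = ∏ j ∈ s, φ j := by
  have hw' : w ∈ s.erase e := Finset.mem_erase.2 ⟨hwe, hw⟩
  rw [Finset.prod_update_of_mem hw', ← Finset.mul_prod_erase s φ he,
    ← Finset.mul_prod_erase _ φ hw', Finset.sdiff_singleton_eq_erase, ← mul_assoc,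
    mul_comm (φ w)]

theorem sum_erase_update {ι : Type} [DecidableEq ι] {s : Finset ι} {e w : ι}
    (he : e ∈ s) (hw : w ∈ s) (hwe : w ≠ e) (φ : ι → ℕ) :
    ∑ j ∈ s.erase e, Function.update φ w (φ w + φ e) j = ∑ j ∈ s, φ j := by
  have hw' : w ∈ s.erase e := Finset.mem_erase.2 ⟨hwe, hw⟩
  rw [Finset.sum_update_of_mem hw', ← Finset.add_sum_erase s φ he,
    ← Finset.add_sum_erase _ φ hw', Finset.sdiff_singleton_eq_erase, ← add_assoc,
    add_comm (φ w)]

/-- The invariant of the search for the largest value of `F`: the function `F` is the product of the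
function `gb`, whose largest value is already known, and of the functions `g j`, whose largest
values for given values of the attributes in `A i ∩ A j` are listed in the tables that are left.
The numbers `e j` and `eb` bound the bit lengths of the values. -/
structure MaxInv (A : Fin m → Finset α) (i : Fin m) (F : (∀ a, dom a) → ℕ) (Z : ℕ) (q : Fin m → ℕ)
    (s : Finset (Fin m)) (st : MaxState m dom) (g : Fin m → (∀ a, dom a) → ℕ)
    (gb : (∀ a, dom a) → ℕ) (e : Fin m → ℕ) (eb : ℕ) : Prop where
  prod : ∀ v, gb v * ∏ j ∈ s, g j v = F v
  size_g : ∀ j ∈ s, ∀ v, (g j v).size ≤ e j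
  size_gb : ∀ v, (gb v).size ≤ eb
  size_sum : eb + ∑ j ∈ s, e j ≤ Z
  local_g : ∀ j ∈ s, ∀ v v', (∀ a ∈ st.reg j, v a = v' a) → g j v = g j v'
  local_gb : ∀ v v', (∀ a ∈ st.bestReg, v a = v' a) → gb v = gb v'
  subset_reg : ∀ j ∈ s, A i ∩ A j ⊆ st.reg j
  inter : ∀ j ∈ s, ∀ j' ∈ s, j ≠ j' → ∀ a ∈ st.reg j, a ∈ st.reg j' → a ∈ A i ∩ A j
  inter_best : ∀ j ∈ s, ∀ a ∈ st.reg j, a ∉ st.bestReg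
  row : ∀ j ∈ s, ∀ r ∈ st.tbl j, r.2 = g j r.1
  max : ∀ j ∈ s, ∀ v, g j v ≠ 0 →
    ∃ r ∈ st.tbl j, key (A i ∩ A j) r.1 = key (A i ∩ A j) v ∧ g j v ≤ r.2
  best : st.best.2 = gb st.best.1
  best_max : ∀ v, gb v ≤ st.best.2
  length_le : ∀ j ∈ s, (st.tbl j).length ≤ q j

variable {i : Fin m} {F : (∀ a, dom a) → ℕ} {Z W Λ : ℕ} {q : Fin m → ℕ}
  {s : Finset (Fin m)} {st : MaxState m dom} {g : Fin m → (∀ a, dom a) → ℕ}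
  {gb : (∀ a, dom a) → ℕ} {e : Fin m → ℕ} {eb : ℕ}

theorem MaxInv.size_row (h : MaxInv A i F Z q s st g gb e eb) {j : Fin m} (hj : j ∈ s)
    {r : (∀ a, dom a) × ℕ} (hr : r ∈ st.tbl j) : r.2.size ≤ Z := by
  rw [h.row j hj r hr]
  refine (h.size_g j hj _).trans (le_trans ?_ h.size_sum)
  exact (Finset.single_le_sum (f := e) (fun _ _ => Nat.zero_le _) hj).trans (Nat.le_add_left _ _)

theorem MaxInv.size_best (h : MaxInv A i F Z q s st g gb e eb) : st.best.2.size ≤ Z := by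
  rw [h.best]
  exact (h.size_gb _).trans (le_trans (Nat.le_add_right _ _) h.size_sum)

/-- An isolated factor shares no attributes with the remaining factors or with the partial result.
The maximum of the product is then the product of the maxima, and the two maximising assignments can
be glued. -/
theorem maxStep_none_spec (hW : (A i).card + (Z + 1) ^ 2 + 1 ≤ W)
    (h : MaxInv A i F Z q s st g gb e eb) {j : Fin m} (hj : j ∈ s)
    (hd : ∀ x ∈ s, x ≠ j → Disjoint (A i ∩ A j) (A i ∩ A x)) :
    (maxStep A i st (j, none)).Spec
      (fun st' => MaxInv A i F Z q (s.erase j) st' g (fun v => gb v * g j v) e (eb + e j))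
      (q j + 2) W := by
  have hprod : ∀ v, gb v * g j v * ∏ x ∈ s.erase j, g x v = F v := fun v => by
    rw [mul_assoc, Finset.mul_prod_erase s (fun x => g x v) hj, h.prod]
  have hsum : eb + e j + ∑ x ∈ s.erase j, e x ≤ Z := by
    rw [add_assoc, Finset.add_sum_erase s e hj]; exact h.size_sum
  have hsz : ∀ v, (gb v * g j v).size ≤ eb + e j := fun v =>
    (size_mul_le _ _).trans (Nat.add_le_add (h.size_gb v) (h.size_g j hj v))
  have hs : ∀ {x}, x ∈ s.erase j → x ∈ s := fun hx => Finset.mem_of_mem_erase hx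
  unfold maxStep
  refine ((bestRow_spec (Z := Z) (by omega) (st.tbl j) fun r hr => h.size_row hj hr).bind
    (t' := 1) fun b hb => ?_).le (by have := h.length_le j hj; omega)
  match b, hb with
  | none, hb =>
    have hb : st.tbl j = [] := hb
    have h0 : ∀ v, g j v = 0 := fun v => by
      by_contra hne
      obtain ⟨r, hr, -⟩ := h.max j hj v hne
      simp [hb] at hr
    -- An empty table means that the factor vanishes identically. The product is the constant `0`,
    -- which any assignment attains and which depends on no attribute, so `bestReg` need not grow.
    refine ((Spec.tick (w := 0) (by omega)).bind fun _ _ => Spec.pure ?_).le le_rfl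
    exact
      { prod := hprod
        size_g := fun x hx => h.size_g x (hs hx)
        size_gb := hsz
        size_sum := hsum
        local_g := fun x hx => h.local_g x (hs hx)
        local_gb := fun v v' _ => by simp [h0]
        subset_reg := fun x hx => h.subset_reg x (hs hx)
        inter := fun x hx y hy => h.inter x (hs hx) y (hs hy)
        inter_best := fun x hx => h.inter_best x (hs hx)
        row := fun x hx => h.row x (hs hx)
        max := fun x hx => h.max x (hs hx)
        best := by simp [h0]
        best_max := fun v => by simp [h0]
        length_le := fun x hx => h.length_le x (hs hx) }
  | some y, ⟨hy, hmax⟩ =>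
    have ha : arith st.best.2 y.2 ≤ (Z + 1) ^ 2 := by
      have h1 := h.size_best
      have h2 := h.size_row hj hy
      rw [arith, sq]; gcongr
    refine ((Spec.tick (by omega)).bind fun _ _ => Spec.pure ?_).le le_rfl
    have e1 : gb (st.bestReg.piecewise st.best.1 y.1) = st.best.2 := by
      rw [h.best]
      exact h.local_gb _ _ fun a ha => Finset.piecewise_eq_of_mem _ _ _ ha
    have e2 : g j (st.bestReg.piecewise st.best.1 y.1) = y.2 := by
      rw [h.row j hj y hy]
      exact h.local_g j hj _ _ fun a ha =>
        Finset.piecewise_eq_of_notMem _ _ _ (h.inter_best j hj a ha)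
    exact
      { prod := hprod
        size_g := fun x hx => h.size_g x (hs hx)
        size_gb := hsz
        size_sum := hsum
        local_g := fun x hx => h.local_g x (hs hx)
        local_gb := fun v v' hv => by
          simp only [Finset.mem_union] at hv
          rw [h.local_gb v v' fun a ha => hv a (.inl ha),
            h.local_g j hj v v' fun a ha => hv a (.inr ha)]
        subset_reg := fun x hx => h.subset_reg x (hs hx)
        inter := fun x hx y hy => h.inter x (hs hx) y (hs hy)
        inter_best := fun x hx a ha hb => by
          rcases Finset.mem_union.1 hb with hb | hb
          · exact h.inter_best x (hs hx) a ha hb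
          · have hxj := Finset.ne_of_mem_erase hx
            exact Finset.disjoint_left.1 (hd x (hs hx) hxj)
              (h.inter j hj x (hs hx) (Ne.symm hxj) a hb ha)
              (h.inter x (hs hx) j hj hxj a ha hb)
        row := fun x hx => h.row x (hs hx)
        max := fun x hx => h.max x (hs hx)
        best := by simp only [e1, e2]
        best_max := fun v => by
          refine Nat.mul_le_mul (h.best_max v) ?_
          by_cases hv : g j v = 0
          · omega
          · obtain ⟨r, hr, -, hle⟩ := h.max j hj v hv
            exact hle.trans (hmax r hr)
        length_le := fun x hx => h.length_le x (hs hx) }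

/-- Max-product elimination: the ear `j` meets the other factors only inside `A i ∩ A w`. For a
fixed row of `w`, its factor can thus be maximised separately among the rows that agree on `S`, and
the product becomes the new factor of `w`. Each row of `w` finds at most one partner, so the table
of `w` does not grow, and bit lengths move from `j` to `w` with their sum unchanged. -/
theorem maxStep_some_spec (hW : (A i).card + (Z + 1) ^ 2 + 1 ≤ W)
    (hΛ : ∀ j ∈ s, Nat.clog 2 (q j) ≤ Λ)
    (h : MaxInv A i F Z q s st g gb e eb) {j w : Fin m} (hj : j ∈ s) (hw : w ∈ s) (hwj : w ≠ j)
    (hd : ∀ x ∈ s, x ≠ j → (A i ∩ A j) ∩ (A i ∩ A x) ⊆ A i ∩ A w) :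
    (maxStep A i st (j, some w)).Spec
      (fun st' => MaxInv A i F Z q (s.erase j) st'
        (Function.update g w fun v => g w v * g j v) gb (Function.update e w (e w + e j)) eb)
      (4 * (unit (q j) Λ + unit (q w) Λ)) W := by
  have hs : ∀ {x}, x ∈ s.erase j → x ∈ s := fun hx => Finset.mem_of_mem_erase hx
  have hclog : ∀ x ∈ s, Nat.clog 2 (st.tbl x).length ≤ Λ := fun x hx =>
    (Nat.clog_mono_right 2 (h.length_le x hx)).trans (hΛ x hx)
  set S := A i ∩ A j ∩ A w with hS
  have hSj : S ⊆ A i ∩ A j := Finset.inter_subset_left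
  have hSw : S ⊆ A i ∩ A w := fun a ha => by
    simp only [hS, Finset.mem_inter] at ha ⊢; tauto
  have hScard : S.card ≤ (A i).card :=
    Finset.card_le_card (hSj.trans Finset.inter_subset_left)
  have hlj := h.length_le j hj
  have hlw := h.length_le w hw
  unfold maxStep
  refine ((groupBy_max_spec (Z := Z) S (by omega) (st.tbl j) (fun r hr => h.size_row hj hr)
    (hclog j hj)).bind (t' := 4 * ((st.tbl w).length * Λ) + (st.tbl w).length + (st.tbl j).length +
      2 + (2 * (st.tbl w).length + 1 + ((st.tbl w).length + 1))) fun msg hmsg => ?_).le ?_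
  · obtain ⟨⟨hm1, hm2⟩, hm3, hm4⟩ := hmsg
    refine ((lookupJoin_spec S (by omega) (st.tbl w) msg hm1 (hclog w hw)).bind
      (t' := 2 * (st.tbl w).length + 1 + ((st.tbl w).length + 1)) fun l hl => ?_).le (by omega)
    have hlen : l.length = (st.tbl w).length := by rw [hl.length_eq, List.length_map]
    have hmem : ∀ x ∈ l, x.1 ∈ st.tbl w ∧ x.2 = lookup S msg x.1.1 := by
      intro x hx
      obtain ⟨r, hr, rfl⟩ := List.mem_map.1 (hl.mem_iff.1 hx)
      exact ⟨hr, rfl⟩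
    have hlook : ∀ v y, lookup S msg v = some y → y ∈ st.tbl j ∧ y ∈ msg ∧ key S v = key S y.1 := by
      intro v y hy
      have h1 := List.mem_of_find?_eq_some hy
      exact ⟨hm3 y h1, h1, by simpa using List.find?_some hy⟩
    refine ((Spec.mapT (t := 1) (g := fun r => r.2.map fun y =>
      ((st.reg w).piecewise r.1.1 y.1, r.1.2 * y.2)) (W := W) (by omega) l fun x hx => ?_).bind
      (t' := (st.tbl w).length + 1) fun rows hrows => ?_).le (by rw [hlen]; omega)
    · obtain ⟨⟨r, o⟩, hxo⟩ : ∃ y, y = x := ⟨x, rfl⟩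
      subst hxo
      obtain ⟨hr, ho⟩ := hmem _ hx
      match o, ho with
      | none, _ => exact Spec.tick_pure (w := 0) (by omega) _
      | some y, ho =>
        have ha : arith r.2 y.2 ≤ (Z + 1) ^ 2 := by
          have h1 := h.size_row hw hr
          have h2 := h.size_row hj (hlook _ _ ho.symm).1
          rw [arith, sq]; gcongr
        exact Spec.tick_pure (by dsimp only; omega) _
    · have hrlen : rows.length = (st.tbl w).length := by rw [hrows, List.length_map, hlen]
      have hrmem : ∀ x, x ∈ rows.reduceOption ↔ ∃ r ∈ st.tbl w, ∃ y, lookup S msg r.1 = some y ∧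
          x = ((st.reg w).piecewise r.1 y.1, r.2 * y.2) := by
        intro x
        rw [List.reduceOption_mem_iff, hrows, List.mem_map]
        constructor
        · rintro ⟨⟨r, o⟩, hr, hx⟩
          obtain ⟨h1, h2⟩ := hmem _ hr
          obtain ⟨y, hy, hx⟩ := Option.map_eq_some_iff.1 hx
          exact ⟨r, h1, y, h2.symm.trans hy, hx.symm⟩
        · rintro ⟨r, hr, y, hy, rfl⟩
          refine ⟨(r, some y), hl.mem_iff.2 (List.mem_map.2 ⟨r, hr, by rw [hy]⟩), rfl⟩
      refine ((Spec.ticks (by omega)).bind fun _ _ => (Spec.tick (by omega)).bind fun _ _ =>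
        Spec.pure (P := fun st' => MaxInv A i F Z q (s.erase j) st'
        (Function.update g w fun v => g w v * g j v) gb
          (Function.update e w (e w + e j)) eb) ?_).le (by rw [hrlen])
      -- The row of `w` takes precedence in the glued assignment. Where it also assigns an attribute
      -- of the row of `j`, that attribute lies in `S`, and the two rows agree there.
      have hagree : ∀ r ∈ st.tbl w, ∀ y, lookup S msg r.1 = some y →
          ∀ a ∈ st.reg j, (st.reg w).piecewise r.1 y.1 a = y.1 a := by
        intro r hr y hy a ha
        by_cases haw : a ∈ st.reg w
        · rw [Finset.piecewise_eq_of_mem _ _ _ haw]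
          refine key_eq_iff.1 (hlook _ _ hy).2.2 a ?_
          have h1 := h.inter j hj w hw (Ne.symm hwj) a ha haw
          have h2 := h.inter w hw j hj hwj a haw ha
          simp only [hS, Finset.mem_inter] at h1 h2 ⊢
          tauto
        · rw [Finset.piecewise_eq_of_notMem _ _ _ haw]
      exact
        { prod := fun v => by
            rw [← h.prod v, ← prod_erase_update hj hw hwj fun x => g x v]
            congr 1
            refine Finset.prod_congr rfl fun x _ => ?_
            by_cases hxw : x = w
            · subst hxw; simp
            · simp [Function.update_of_ne hxw]
          size_g := fun x hx v => by
            by_cases hxw : x = w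
            · subst hxw
              rw [Function.update_self, Function.update_self]
              exact (size_mul_le _ _).trans (Nat.add_le_add (h.size_g x hw v) (h.size_g j hj v))
            · rw [Function.update_of_ne hxw, Function.update_of_ne hxw]
              exact h.size_g x (hs hx) v
          size_gb := h.size_gb
          size_sum := by rw [sum_erase_update hj hw hwj]; exact h.size_sum
          local_g := fun x hx v v' hv => by
            by_cases hxw : x = w
            · subst hxw
              simp only [Function.update_self, Finset.mem_union] at hv ⊢
              rw [h.local_g x hw v v' fun a ha => hv a (.inl ha),
                h.local_g j hj v v' fun a ha => hv a (.inr ha)]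
            · simp only [Function.update_of_ne hxw] at hv ⊢
              exact h.local_g x (hs hx) v v' hv
          local_gb := h.local_gb
          subset_reg := fun x hx => by
            by_cases hxw : x = w
            · subst hxw
              simp only [Function.update_self]
              exact (h.subset_reg x hw).trans Finset.subset_union_left
            · simp only [Function.update_of_ne hxw]
              exact h.subset_reg x (hs hx)
          inter := fun x hx y hy hxy a hax hay => by
            have hxj := Finset.ne_of_mem_erase hx
            have hyj := Finset.ne_of_mem_erase hy
            by_cases hxw : x = w
            · subst hxw
              simp only [Function.update_self, Function.update_of_ne (Ne.symm hxy),
                Finset.mem_union] at hax hay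
              rcases hax with hax | hax
              · exact h.inter x hw y (hs hy) hxy a hax hay
              -- An attribute that `w` has just acquired from `j` and that `y` also assigns is
              -- shared by the hyperedges `j` and `y`; by the ear property it belongs to the
              -- hyperedge of `w`.
              · exact hd y (hs hy) hyj (Finset.mem_inter.2
                  ⟨h.inter j hj y (hs hy) (Ne.symm hyj) a hax hay,
                    h.inter y (hs hy) j hj hyj a hay hax⟩)
            · by_cases hyw : y = w
              · subst hyw
                simp only [Function.update_self, Function.update_of_ne hxw,
                  Finset.mem_union] at hax hay
                rcases hay with hay | hay
                · exact h.inter x (hs hx) y hw hxy a hax hay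
                · exact h.inter x (hs hx) j hj hxj a hax hay
              · simp only [Function.update_of_ne hxw, Function.update_of_ne hyw] at hax hay
                exact h.inter x (hs hx) y (hs hy) hxy a hax hay
          inter_best := fun x hx a ha => by
            by_cases hxw : x = w
            · subst hxw
              simp only [Function.update_self, Finset.mem_union] at ha
              exact ha.elim (h.inter_best x hw a) (h.inter_best j hj a)
            · simp only [Function.update_of_ne hxw] at ha
              exact h.inter_best x (hs hx) a ha
          row := fun x hx r hr => by
            by_cases hxw : x = w
            · subst hxw
              simp only [Function.update_self] at hr ⊢
              obtain ⟨r', hr', y, hy, rfl⟩ := (hrmem _).1 hr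
              rw [h.row x hw r' hr', h.row j hj y (hlook _ _ hy).1]
              change g x r'.1 * g j y.1 = g x ((st.reg x).piecewise r'.1 y.1) *
                g j ((st.reg x).piecewise r'.1 y.1)
              congr 1
              · exact h.local_g x hw _ _ fun a ha => (Finset.piecewise_eq_of_mem _ _ _ ha).symm
              · exact h.local_g j hj _ _ fun a ha => (hagree r' hr' y hy a ha).symm
            · simp only [Function.update_of_ne hxw] at hr ⊢
              exact h.row x (hs hx) r hr
          max := fun x hx v hv => by
            by_cases hxw : x = w
            · subst hxw
              simp only [Function.update_self] at hv ⊢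
              obtain ⟨hv1, hv2⟩ := mul_ne_zero_iff.1 hv
              obtain ⟨r, hr, hr1, hr2⟩ := h.max x hw v hv1
              obtain ⟨y, hy, hy1, hy2⟩ := h.max j hj v hv2
              obtain ⟨y', hy', hy1', hy2'⟩ := hm4 y hy
              have hk : key S r.1 = key S y'.1 := by
                rw [key_eq_mono hSw hr1, hy1', key_eq_mono hSj hy1]
              -- The group of `r` contains `y'`, so the lookup succeeds, and as the keys of `msg`
              -- are distinct it returns the count of `y'`.
              obtain ⟨z, hz⟩ : ∃ z, lookup S msg r.1 = some z := by
                cases hz : lookup S msg r.1 with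
                | some z => exact ⟨z, rfl⟩
                | none => simpa [hk] using List.find?_eq_none.1 hz y' hy'
              obtain ⟨-, hz1, hz2⟩ := hlook _ _ hz
              have hzy : z.2 = y'.2 := by
                rw [← tableCount_eq_of_mem hm1 hz1 (v := r.1) hz2.symm,
                  tableCount_eq_of_mem hm1 hy' (v := r.1) hk.symm]
              refine ⟨_, (hrmem _).2 ⟨r, hr, z, hz, rfl⟩, ?_, ?_⟩
              · rw [← hr1]
                exact key_eq_iff.2 fun a ha =>
                  Finset.piecewise_eq_of_mem _ _ _ (h.subset_reg x hw ha)
              · exact Nat.mul_le_mul hr2 (hzy ▸ hy2.trans hy2')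
            · simp only [Function.update_of_ne hxw] at hv ⊢
              exact h.max x (hs hx) v hv
          best := h.best
          best_max := h.best_max
          length_le := fun x hx => by
            by_cases hxw : x = w
            · subst hxw
              simp only [Function.update_self]
              exact (List.reduceOption_length_le rows).trans (hrlen.trans_le hlw)
            · simp only [Function.update_of_ne hxw]
              exact h.length_le x (hs hx) }
  · have h1 := le_unit (q j) Λ
    have h2 := le_unit (q w) Λ
    have h3 := Nat.mul_le_mul_right Λ hlj
    have h4 := Nat.mul_le_mul_right Λ hlw
    omega

theorem foldT_maxStep_spec (hW : (A i).card + (Z + 1) ^ 2 + 1 ≤ W) {Qs : ℕ}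
    {L : List (Fin m)} {P : List (Fin m × Option (Fin m))}
    (hP : GYOSeq (fun j => A i ∩ A j) L P) : ∀ {st : MaxState m dom}
    {g : Fin m → (∀ a, dom a) → ℕ} {gb : (∀ a, dom a) → ℕ} {e : Fin m → ℕ} {eb : ℕ}, L.Nodup →
    (∀ j ∈ L, Nat.clog 2 (q j) ≤ Λ ∧ q j ≤ Qs) → MaxInv A i F Z q L.toFinset st g gb e eb →
    (foldT (maxStep A i) P st).Spec
      (fun st' => st'.best.2 = F st'.best.1 ∧ ∀ v, F v ≤ st'.best.2)
      (P.length * (8 * unit Qs Λ + 1) + 1) W := by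
  have hun : ∀ {a}, a ≤ Qs → unit a Λ ≤ unit Qs Λ := fun h => by unfold unit; gcongr
  induction hP with
  | nil =>
    intro st g gb e eb _ _ h
    rw [foldT]
    refine ((Spec.tick (w := 0) (by omega)).bind fun _ _ => Spec.pure ?_).le (by simp)
    have hF : ∀ v, F v = gb v := fun v => by have := h.prod v; simpa using this.symm
    simp only [hF]
    exact ⟨h.best, h.best_max⟩
  | isolated L j P hj hd _ ih =>
    intro st g gb e eb hL hq h
    rw [foldT]
    refine ((Spec.tick (w := 0) (by omega)).bind fun _ _ => (maxStep_none_spec hW h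
      (by simpa using hj) fun x hx => hd x (by simpa using hx)).bind fun st' h' =>
        ih (hL.erase j) (fun x hx => hq x (List.mem_of_mem_erase hx))
          (by rw [toFinset_erase hL]; exact h')).le ?_
    have h1 := hq j hj
    have h2 := le_unit Qs Λ
    simp only [List.length_cons, add_mul, one_mul]
    omega
  | ear L j w P hj hw hwj hd _ ih =>
    intro st g gb e eb hL hq h
    rw [foldT]
    refine ((Spec.tick (w := 0) (by omega)).bind fun _ _ => (maxStep_some_spec hW
      (fun x hx => (hq x (by simpa using hx)).1) h
      (by simpa using hj) (by simpa using hw) hwj fun x hx => hd x (by simpa using hx)).bind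
        fun st' h' => ih (hL.erase j) (fun x hx => hq x (List.mem_of_mem_erase hx))
          (by rw [toFinset_erase hL]; exact h')).le ?_
    have h1 := hun (hq j hj).2
    have h2 := hun (hq w hw).2
    simp only [List.length_cons, add_mul, one_mul]
    omega

variable {D : ∀ i, List (Tup dom (A i))} {z : ℕ} {T : JoinTree A}

/-- The sensitivity at `i` is a product of one count per neighbour, each depending on `A i ∩ A j`
only, and the search starts with the constant factor `1`. Every ear touches at most two tables,
which are bounded together through the total size of the neighbours; the quadratic term pays for the
GYO decomposition. -/
theorem nodeMax_spec (hB : Bounds D z Z W Λ) (hT : T.NbrsAcyclic)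
    {bot top : Fin m → List ((∀ a, dom a) × ℕ)}
    (hbot : ∀ i, IsBot T D i (bot i)) (htop : ∀ i, IsTop T D i (top i)) (i : Fin m) :
    (nodeMax T bot top i).Spec
      (fun r => r.2 = joinCount D (Finset.univ.erase i).toList (A i) r.1 ∧
        ∀ v, joinCount D (Finset.univ.erase i).toList (A i) v ≤ r.2)
      (8 * (((T.nbrs i).length + 1) * unit ((T.nbrs i).map fun j => (D j).length).sum Λ) +
        6 * ((T.nbrs i).length + 1) ^ 2) W := by
  have hWA := hB.card_le (i := i) subset_rfl
  set S : Fin m → Finset α := fun j => A i ∩ A j with hS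
  set tbl : Fin m → List ((∀ a, dom a) × ℕ) :=
    fun j => if T.parent i = some j then top i else bot j with htbl
  -- `U j` is the component of the tree without `i` that contains the neighbour `j`: the complement
  -- of the subtree of `i` if `j` is the parent, the subtree of `j` otherwise.
  set U : Fin m → List (Fin m) :=
    fun j => if T.parent i = some j then T.subCompl i else T.sub j with hU
  have hgood : ∀ j ∈ T.nbrs i, GoodTable D (S j) (U j) (D j).length (tbl j) := by
    intro j hj
    by_cases hp : T.parent i = some j
    · simp only [htbl, hU, if_pos hp, hS, ← T.sep_eq hp]
      exact htop i j hp
    · have hj' : T.parent j = some i := (T.mem_nbrs.1 hj).resolve_left hp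
      simp only [htbl, hU, if_neg hp, hS]
      rw [Finset.inter_comm, ← T.sep_eq hj']
      exact hbot j
  have hUn : ∀ j, (U j).Nodup := fun j => by
    simp only [hU]; split_ifs
    · exact T.nodup_subCompl i
    · exact T.nodup_sub j
  have hF : ∀ v, joinCount D (Finset.univ.erase i).toList (A i) v =
      1 * ∏ j ∈ (T.nbrs i).toFinset, joinCount D (U j) (S j) v := by
    intro v
    rw [joinCount_erase D T, one_mul, List.prod_toFinset _ (T.nodup_nbrs i), JoinTree.nbrs,
      List.map_append, List.prod_append]
    congr 1
    · cases hp : T.parent i with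
      | none =>
        have : T.subCompl i = [] := by rw [(T.parent_eq_none i).1 hp, T.subCompl_root]
        rw [this]; rfl
      | some p => simp [hU, hS, hp, T.sep_eq hp]
    · congr 1
      refine List.map_congr_left fun c hc => ?_
      have hc' := T.mem_children.1 hc
      have hne : T.parent i ≠ some c := fun hp =>
        lt_asymm (T.parent_pos hp) (T.parent_pos hc')
      simp only [hU, hS, if_neg hne]
      rw [T.sep_eq hc', Finset.inter_comm]
  have hlen : (T.nbrs i).length ≤ m := (T.length_nbrs_lt i).le
  unfold nodeMax
  refine ((Spec.ticks hB.one_le).bind fun _ _ => (gyo_spec (k := (allAttrs A).card)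
    (W := W) (E := S) (ℓ := (T.nbrs i).length) (fun j => ?_) ?_ _ (T.nbrs i) (T.nbrs i) (T.nodup_nbrs i) le_rfl
    (by omega) (fun j hj hj' => absurd hj hj') ((hT i).inter_left _)).bind (t' := (T.nbrs i).length *
      (8 * unit ((T.nbrs i).map fun j => (D j).length).sum Λ + 1) + 1) fun P hP =>
      ((foldT_maxStep_spec (Z := Z) (W := W) (Λ := Λ)
        (F := joinCount D (Finset.univ.erase i).toList (A i)) (q := fun j => (D j).length)
        (Qs := ((T.nbrs i).map fun j => (D j).length).sum)
        (g := fun j => joinCount D (U j) (S j)) (gb := fun _ => 1) (e := fun _ => z) (eb := 1)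
        hWA hP (T.nodup_nbrs i)
        (fun j hj => ⟨hB.log j, List.single_le_sum (fun _ _ => Nat.zero_le _) _
          (List.mem_map_of_mem hj)⟩) ?_).bind fun st hst => Spec.pure hst).le ?_).le ?_
  · exact Finset.card_le_card (Finset.inter_subset_left.trans (subset_allAttrs A i))
  · have := hB.work; omega
  · exact
      { prod := fun v => (hF v).symm
        size_g := fun j _ v => hB.count _ (hUn j) _ _
        size_gb := fun v => by simp
        size_sum := by
          rw [Finset.sum_const, smul_eq_mul, List.toFinset_card_of_nodup (T.nodup_nbrs i)]
          have h1 := Nat.mul_le_mul_right z hlen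
          have h2 := hB.big
          rw [mul_add, mul_one, mul_comm z m] at h2
          omega
        local_g := fun j _ v v' hv => joinCount_congr D _ (fun _ _ => rfl)
          fun k _ a ha => hv a (Finset.mem_inter.1 ha).1
        local_gb := fun _ _ _ => rfl
        subset_reg := fun _ _ => subset_rfl
        inter := fun _ _ _ _ _ _ ha _ => ha
        inter_best := fun _ _ _ _ => Finset.notMem_empty _
        row := fun j hj r hr => by
          have hg := hgood j (by simpa using hj)
          rw [← hg.count]
          exact (tableCount_eq_of_mem hg.strict hr rfl).symm
        max := fun j hj v hv => by
          have hg := hgood j (by simpa using hj)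
          rw [← hg.count] at hv
          by_contra hcon
          push Not at hcon
          refine hv (tableCount_eq_zero fun r hr hk => ?_)
          have := hcon r hr hk
          rw [← hg.count, tableCount_eq_of_mem hg.strict hr hk] at this
          exact lt_irrefl _ this
        best := rfl
        best_max := fun _ => le_rfl
        length_le := fun j hj => (hgood j (by simpa using hj)).length_le }
  · rw [hP.length_eq, add_zero]
  · nlinarith

end Max

end JoinLS

namespace JoinLS

open Timed

/-! ## The algorithm -/

section Algorithm

variable {α : Type} [LinearOrder α] {dom : α → Type} [∀ a, LinearOrder (dom a)]
  [∀ a, Inhabited (dom a)] {m : ℕ} {A : Fin m → Finset α}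
  {D : ∀ i, List (Tup dom (A i))} {z Z W Λ q : ℕ} {T : JoinTree A}

/-- The sensitivity of the projection of `v` to the attributes of relation `i`. -/
noncomputable def sensCount (D : ∀ i, List (Tup dom (A i))) (i : Fin m) (v : ∀ a, dom a) : ℕ :=
  joinCount D (Finset.univ.erase i).toList (A i) v

theorem sensCount_extend_restrict (i : Fin m) (v : ∀ a, dom a) :
    sensCount D i (extend (A i) ((A i).restrict v)) = sensCount D i v :=
  joinCount_congr D _ (fun _ _ => rfl) fun _ _ _ ha =>
    extend_restrict _ _ (Finset.mem_inter.1 ha).1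

/-- If there are fewer than `m - 1` tuples, then two relations are empty. -/
theorem sensCount_eq_zero (h : ¬ m ≤ (∑ i, (D i).length) + 1) (i : Fin m) (v : ∀ a, dom a) :
    sensCount D i v = 0 := by
  obtain ⟨j, hj, hj0⟩ : ∃ j ∈ Finset.univ.erase i, D j = [] := by
    by_contra hcon
    push Not at hcon
    have h1 : ∑ _j ∈ Finset.univ.erase i, 1 ≤ ∑ j ∈ Finset.univ.erase i, (D j).length :=
      Finset.sum_le_sum fun j hj => List.length_pos_of_ne_nil (hcon j hj)
    have h2 : ∑ j ∈ Finset.univ.erase i, (D j).length ≤ ∑ j, (D j).length :=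
      Finset.sum_le_sum_of_subset (Finset.erase_subset _ _)
    simp only [Finset.sum_const, smul_eq_mul, mul_one,
      Finset.card_erase_of_mem (Finset.mem_univ i), Finset.card_univ, Fintype.card_fin] at h1
    omega
  exact joinCount_eq_zero D hj0 (Finset.mem_toList.2 hj) _ _

theorem selectMax_spec (hB : Bounds D z Z W Λ) (hT : T.NbrsAcyclic)
    {bot top : Fin m → List ((∀ a, dom a) × ℕ)}
    (hbot : ∀ i, IsBot T D i (bot i)) (htop : ∀ i, IsTop T D i (top i)) :
    (selectMax T bot top).Spec
      (fun b => b.2.2 = sensCount D b.1 b.2.1 ∧ ∀ i v, sensCount D i v ≤ b.2.2)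
      (∑ i, (8 * (((T.nbrs i).length + 1) * unit ((T.nbrs i).map fun j => (D j).length).sum Λ) +
        6 * ((T.nbrs i).length + 1) ^ 2 + 2) + 1) W := by
  have hsz : ∀ i v, (sensCount D i v).size ≤ Z := fun i v => by
    have h1 := hB.count _ (Finset.nodup_toList (Finset.univ.erase i)) (A i) v
    have h2 := hB.big
    rw [mul_add, mul_one] at h2
    unfold sensCount
    omega
  unfold selectMax
  have := Spec.foldT (W := W) (cost := fun i =>
      8 * (((T.nbrs i).length + 1) * unit ((T.nbrs i).map fun j => (D j).length).sum Λ) +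
        6 * ((T.nbrs i).length + 1) ^ 2 + 1) (f := fun b i => do
    let r ← nodeMax T bot top i
    tick (arith b.2.2 r.2)
    if b.2.2 < r.2 then pure (i, r) else pure b) hB.one_le
    -- The initial value `0` need not be the sensitivity of the initial tuple. At the end it must
    -- be: if the maximum is `0`, all sensitivities are.
    (fun l b => (b.2.2 = 0 ∨ b.2.2 = sensCount D b.1 b.2.1) ∧ ∀ i ∈ l, ∀ v, sensCount D i v ≤ b.2.2)
    T.postOrder [] (T.root, ((fun _ => default), 0)) ?_ (by simp)
  · rw [T.sum_map_postOrder] at this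
    refine this.mono (fun b hb => ?_) le_rfl
    have h2 : ∀ i v, sensCount D i v ≤ b.2.2 := fun i => hb.2 i (T.mem_postOrder i)
    refine ⟨hb.1.elim (fun h0 => ?_) id, h2⟩
    have := h2 b.1 b.2.1
    omega
  · intro l i r _ b hb
    refine ((nodeMax_spec hB hT hbot htop i).bind (t' := 1) fun x hx => ?_).le le_rfl
    have hx1 : x.2 = sensCount D i x.1 := hx.1
    have hx2 : ∀ v, sensCount D i v ≤ x.2 := hx.2
    have ha : arith b.2.2 x.2 ≤ (Z + 1) ^ 2 := by
      have h1 : b.2.2.size ≤ Z := by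
        rcases hb.1 with h | h
        · simp [h]
        · rw [h]; exact hsz _ _
      have h2 : x.2.size ≤ Z := by rw [hx1]; exact hsz _ _
      rw [arith, sq]; gcongr
    refine ((Spec.tick (by have := hB.work; omega)).bind (t' := 0) fun _ _ => ?_).le le_rfl
    split_ifs with hlt
    · refine Spec.pure ⟨.inr hx1, fun j hj v => ?_⟩
      simp only [List.nil_append, List.mem_append, List.mem_singleton] at hj
      rcases hj with hj | rfl
      · exact (hb.2 j hj v).trans hlt.le
      · exact hx2 v
    · refine Spec.pure ⟨hb.1, fun j hj v => ?_⟩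
      simp only [List.nil_append, List.mem_append, List.mem_singleton] at hj
      rcases hj with hj | rfl
      · exact hb.2 j hj v
      · exact (hx2 v).trans (not_lt.1 hlt)

/-- The conditions on the degrees under which the algorithm takes `O(q n log n)` steps. -/
structure DegreeBound (T : JoinTree A) (n q : ℕ) : Prop where
  deg : ∀ i, (T.nbrs i).length + 1 ≤ q
  deg_nbrs : ∀ j, ((T.nbrs j).map fun i => (T.nbrs i).length + 1).sum ≤ q
  sum_deg : ∑ i, ((T.nbrs i).length + 1) ≤ q * (n + 1)
  sum_sq : m ≤ n + 1 → ∑ i, ((T.nbrs i).length + 1) ^ 2 ≤ q * (n + 1)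

/-! ### Summing the costs over the nodes. -/

theorem sum_deg_mul_length_le (hq : DegreeBound T (∑ i, (D i).length) q) :
    ∑ i, ((T.nbrs i).length + 1) * (D i).length ≤ q * ∑ i, (D i).length := by
  rw [Finset.mul_sum]
  exact Finset.sum_le_sum fun i _ => Nat.mul_le_mul_right _ (hq.deg i)

theorem sum_deg_mul_unit_le (hq : DegreeBound T (∑ i, (D i).length) q) :
    ∑ i, ((T.nbrs i).length + 1) * unit (D i).length Λ ≤
      2 * (q * (∑ i, (D i).length + 1) * (Λ + 1)) := by
  have h : ∀ i, ((T.nbrs i).length + 1) * unit (D i).length Λ =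
      (((T.nbrs i).length + 1) * (D i).length + ((T.nbrs i).length + 1)) * (Λ + 1) := fun i => by
    unfold unit; ring
  simp_rw [h]
  rw [← Finset.sum_mul, Finset.sum_add_distrib, ← mul_assoc]
  refine Nat.mul_le_mul_right _ ?_
  have h1 := sum_deg_mul_length_le hq
  have h2 := hq.sum_deg
  linarith

theorem sum_nbrs_length_le (hq : DegreeBound T (∑ i, (D i).length) q) :
    ∑ i, ((T.nbrs i).map fun j => (D j).length).sum ≤ q * (∑ i, (D i).length + 1) := by
  rw [T.sum_nbrs_comm fun _ j => (D j).length]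
  have h : ∀ j, ((T.nbrs j).map fun _ => (D j).length).sum ≤
      ((T.nbrs j).length + 1) * (D j).length := fun j => by
    simp [add_mul]
  refine (Finset.sum_le_sum fun j _ => h j).trans ((sum_deg_mul_length_le hq).trans ?_)
  exact Nat.mul_le_mul_left _ (Nat.le_succ _)

/-- After exchanging the sums, a tuple of `j` is charged `deg i + 1` times for each neighbour `i` of
`j`. This is the quantity bounded by `deg_nbrs`. -/
theorem sum_deg_mul_unit_nbrs_le (hq : DegreeBound T (∑ i, (D i).length) q) :
    ∑ i, ((T.nbrs i).length + 1) * unit ((T.nbrs i).map fun j => (D j).length).sum Λ ≤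
      2 * (q * (∑ i, (D i).length + 1) * (Λ + 1)) := by
  have h : ∀ i, ((T.nbrs i).length + 1) * unit ((T.nbrs i).map fun j => (D j).length).sum Λ =
      (((T.nbrs i).map fun j => ((T.nbrs i).length + 1) * (D j).length).sum +
        ((T.nbrs i).length + 1)) * (Λ + 1) := fun i => by
    rw [List.sum_map_mul_left]; unfold unit; ring
  simp_rw [h]
  rw [← Finset.sum_mul, Finset.sum_add_distrib, ← mul_assoc,
    T.sum_nbrs_comm fun i j => ((T.nbrs i).length + 1) * (D j).length]
  refine Nat.mul_le_mul_right _ ?_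
  have h1 : ∑ j, ((T.nbrs j).map fun i => ((T.nbrs i).length + 1) * (D j).length).sum ≤
      q * ∑ i, (D i).length := by
    rw [Finset.mul_sum]
    refine Finset.sum_le_sum fun j _ => ?_
    rw [List.sum_map_mul_right]
    exact Nat.mul_le_mul_right _ (hq.deg_nbrs j)
  have h2 := hq.sum_deg
  linarith

theorem lsAcyclicJoin_spec (hB : Bounds D z Z W Λ) (hT : T.NbrsAcyclic)
    (hq : DegreeBound T (∑ i, (D i).length) q) :
    (lsAcyclicJoin T D).Spec
      (fun out => out.ls = sensCount D out.rel (extend _ out.tuple) ∧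
        (∀ i v, sensCount D i v ≤ out.ls) ∧
        ∀ i t, multTable T out.bot out.top i t = sensCount D i (extend _ t))
      (78 * (q * (∑ i, (D i).length + 1) * (Λ + 1))) W := by
  set n := ∑ i, (D i).length with hn
  set X := q * (n + 1) * (Λ + 1) with hX
  have hqX : q * (n + 1) ≤ X := Nat.le_mul_of_pos_right _ (Nat.succ_pos _)
  have hq1 : 1 ≤ q := le_trans (Nat.le_add_left _ _) (hq.deg T.root)
  have hnX : n + 1 ≤ X := (Nat.le_mul_of_pos_left _ hq1).trans hqX
  have hmX : m ≤ X := by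
    refine le_trans ?_ (hq.sum_deg.trans hqX)
    calc m = ∑ _i : Fin m, 1 := by simp
      _ ≤ _ := Finset.sum_le_sum fun i _ => Nat.le_add_left _ _
  have hu := sum_deg_mul_unit_le (Λ := Λ) hq
  have hl := (sum_nbrs_length_le hq).trans hqX
  have hv := sum_deg_mul_unit_nbrs_le (Λ := Λ) hq
  rw [← hn, ← hX] at hu hv
  have hfin : ∀ bot top : Fin m → List ((∀ a, dom a) × ℕ), (∀ i, IsBot T D i (bot i)) →
      (∀ i, IsTop T D i (top i)) → ∀ b : Fin m × ((∀ a, dom a) × ℕ),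
      (b.2.2 = sensCount D b.1 b.2.1 ∧ ∀ i v, sensCount D i v ≤ b.2.2) →
      (do
        tick (A b.1).card
        pure (⟨b.2.2, b.1, (A b.1).restrict b.2.1, bot, top⟩ : Output A dom)).Spec
      (fun out => out.ls = sensCount D out.rel (extend _ out.tuple) ∧
        (∀ i v, sensCount D i v ≤ out.ls) ∧
        ∀ i t, multTable T out.bot out.top i t = sensCount D i (extend _ t)) 1 W := by
    intro bot top hbot htop b hb
    refine ((Spec.tick ?_).bind fun _ _ => Spec.pure ⟨?_, hb.2, multTable_eq hbot htop⟩).le le_rfl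
    · have := hB.card_le (i := b.1) subset_rfl; omega
    · simp only [sensCount_extend_restrict]; exact hb.1
  unfold lsAcyclicJoin
  refine ((foldT_botStep_spec hB).bind fun bot hbot => (foldT_topStep_spec hB hbot).bind
    fun top htop => (Spec.ticks hB.one_le).bind (t' := 24 * X + 2) fun _ _ => ?_).le ?_
  · split_ifs with hm
    -- Of the `24 X`, the joins take `16 X`, the GYO decompositions `6 X` and the loop over the
    -- nodes `2 X`. The bound for the decompositions uses `m ≤ n + 1`, the condition just tested.
    · refine ((selectMax_spec hB hT hbot htop).bind fun b hb => hfin bot top hbot htop b hb).le ?_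
      have hs := (hq.sum_sq hm).trans hqX
      rw [Finset.sum_add_distrib, Finset.sum_add_distrib, ← Finset.mul_sum, ← Finset.mul_sum]
      simp only [Finset.sum_const, Finset.card_univ, Fintype.card_fin, smul_eq_mul]
      omega
    · refine ((Spec.pure (P := (· = _)) rfl).bind fun b hb => hfin bot top hbot htop b ?_).le
        (by omega)
      subst hb
      simp only [sensCount_eq_zero hm]
      simp
  · simp only [Finset.sum_add_distrib, ← Finset.mul_sum]
    simp only [Finset.sum_const, Finset.card_univ, Fintype.card_fin, smul_eq_mul]
    rw [← hn]
    omega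

/-! ### The bounds in terms of the sizes of the query and of the database -/

/-- A count is at most `n ^ m`; the crude `n ≤ 2 ^ n` already gives polynomially many bits. -/
theorem size_joinCount_le {n : ℕ} (hn : ∀ j, (D j).length ≤ n) {U : List (Fin m)} (hU : U.Nodup)
    (S : Finset α) (v : ∀ a, dom a) : (joinCount D U S v).size ≤ n * m + 1 := by
  rw [Nat.size_le]
  calc joinCount D U S v ≤ n ^ U.length := joinCount_le D hn U S v
    _ ≤ (2 ^ n) ^ U.length := Nat.pow_le_pow_left Nat.lt_two_pow_self.le _
    _ = 2 ^ (n * U.length) := (pow_mul _ _ _).symm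
    _ ≤ 2 ^ (n * m) := Nat.pow_le_pow_right (by norm_num)
        (Nat.mul_le_mul_left _ (JoinTree.length_le_of_nodup hU))
    _ < 2 ^ (n * m + 1) := Nat.pow_lt_pow_right (by norm_num) (Nat.lt_succ_self _)

theorem bounds_of_sizes (D : ∀ i, List (Tup dom (A i))) {n : ℕ} (hn : n = ∑ i, (D i).length) :
    Bounds D (n * m + 1) ((n * m + 1) * (m + 1) + n + 2)
      (2 * (allAttrs A).card + ((n * m + 1) * (m + 1) + n + 2 + 1) ^ 2 + 1) (Nat.clog 2 n) where
  count U hU S v := size_joinCount_le (fun j => hn ▸ length_le_sum D j) hU S v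
  big := by rw [hn]
  work := le_rfl
  log i := Nat.clog_mono_right 2 (hn ▸ length_le_sum D i)

/-- The degrees sum to at most `2 m`, and adding one per node gives `3 m`. For the squares one
factor is bounded by `m`, which the guard `m ≤ n + 1` turns into `n + 1`. -/
theorem degreeBound_card (T : JoinTree A) (n : ℕ) : DegreeBound T n (3 * m) := by
  have hsum : ∑ i, ((T.nbrs i).length + 1) ≤ 3 * m := by
    rw [Finset.sum_add_distrib]
    have := T.sum_length_nbrs_le
    simp only [Finset.sum_const, Finset.card_univ, Fintype.card_fin, smul_eq_mul]
    omega
  refine ⟨fun i => ?_, fun j => ?_, ?_, fun hm => ?_⟩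
  · have := T.length_nbrs_lt i; omega
  · refine le_trans ?_ hsum
    rw [← List.sum_toFinset _ (T.nodup_nbrs j)]
    exact Finset.sum_le_sum_of_subset (Finset.subset_univ _)
  · exact hsum.trans (Nat.le_mul_of_pos_right _ (Nat.succ_pos _))
  · calc ∑ i, ((T.nbrs i).length + 1) ^ 2 ≤ ∑ i, m * ((T.nbrs i).length + 1) := by
          refine Finset.sum_le_sum fun i _ => ?_
          rw [sq]
          exact Nat.mul_le_mul_right _ (T.length_nbrs_lt i)
      _ = m * ∑ i, ((T.nbrs i).length + 1) := by rw [Finset.mul_sum]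
      _ ≤ m * (3 * m) := Nat.mul_le_mul_left _ hsum
      _ = 3 * m * m := mul_comm _ _
      _ ≤ _ := Nat.mul_le_mul_left _ hm

/-- The square of `d + 1` arises from `deg_nbrs`: up to `d` neighbours, each weighted by up to `d +
1`. The assumption `m ≤ n` absorbs the cost that occurs at every node regardless of tuples. -/
theorem degreeBound_of_degree_le (T : JoinTree A) {n d : ℕ} (hd : ∀ i, (T.nbrs i).length ≤ d)
    (hm : m ≤ n) : DegreeBound T n ((d + 1) ^ 2) := by
  have h1 : d + 1 ≤ (d + 1) ^ 2 := Nat.le_self_pow (by norm_num) _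
  have hmn : m * (d + 1) ^ 2 ≤ (d + 1) ^ 2 * (n + 1) := by
    rw [mul_comm]; exact Nat.mul_le_mul_left _ (by omega)
  refine ⟨fun i => ?_, fun j => ?_, ?_, fun _ => ?_⟩
  · have := hd i; omega
  · calc ((T.nbrs j).map fun i => (T.nbrs i).length + 1).sum
        ≤ ((T.nbrs j).map fun _ => d + 1).sum :=
          List.sum_le_sum fun i _ => Nat.succ_le_succ (hd i)
      _ = (T.nbrs j).length * (d + 1) := by simp
      _ ≤ (d + 1) * (d + 1) := Nat.mul_le_mul_right _ ((hd j).trans (Nat.le_succ _))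
      _ = (d + 1) ^ 2 := (sq _).symm
  · refine le_trans ?_ hmn
    calc ∑ i, ((T.nbrs i).length + 1) ≤ ∑ _i : Fin m, (d + 1) ^ 2 :=
          Finset.sum_le_sum fun i _ => (Nat.succ_le_succ (hd i)).trans h1
      _ = m * (d + 1) ^ 2 := by simp
  · refine le_trans ?_ hmn
    calc ∑ i, ((T.nbrs i).length + 1) ^ 2 ≤ ∑ _i : Fin m, (d + 1) ^ 2 :=
          Finset.sum_le_sum fun i _ => Nat.pow_le_pow_left (Nat.succ_le_succ (hd i)) 2
      _ = m * (d + 1) ^ 2 := by simp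

/-- For `n ≥ 2` the additive constants are absorbed by `n + 1 ≤ 2 n` and by `log n ≥ log 2 > 0.69`,
which gives the factor `5` for the logarithm. -/
theorem mul_clog_le {n : ℕ} (hn : 2 ≤ n) :
    (((n + 1) * (Nat.clog 2 n + 1) : ℕ) : ℝ) ≤ 10 * (n * Real.log n) := by
  have hn' : (2 : ℝ) ≤ n := by exact_mod_cast hn
  have hlog2 : (0.69 : ℝ) < Real.log 2 := lt_trans (by norm_num) Real.log_two_gt_d9
  have hlog : Real.log 2 ≤ Real.log n := Real.log_le_log (by norm_num) hn'
  have h1 : Nat.clog 2 n ≤ Nat.log 2 n + 1 := by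
    refine Nat.clog_le_of_le_pow ?_
    exact (Nat.lt_pow_succ_log_self (by norm_num) n).le
  have h2 : (Nat.log 2 n : ℝ) * Real.log 2 ≤ Real.log n := by
    rw [← Real.log_pow]
    refine Real.log_le_log (by positivity) ?_
    exact_mod_cast Nat.pow_log_le_self 2 (by omega)
  have h1' : (Nat.clog 2 n : ℝ) ≤ Nat.log 2 n + 1 := by exact_mod_cast h1
  have h3 : (Nat.clog 2 n : ℝ) + 1 ≤ 5 * Real.log n := by
    have h0 : (0 : ℝ) ≤ Nat.log 2 n := Nat.cast_nonneg _
    nlinarith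
  push_cast
  calc ((n : ℝ) + 1) * (Nat.clog 2 n + 1) ≤ (2 * n) * (5 * Real.log n) := by
        refine mul_le_mul (by linarith) h3 (by positivity) (by positivity)
    _ = _ := by ring

/-- Numbers have `O(M ^ 3)` bits, so a step costs `O(M ^ 6)`, and there are `O(M ^ 3)` steps; hence
the exponent `9`. -/
theorem work_bound {m k n M : ℕ} (hm : 1 ≤ m) (hM : M = m + k + n) :
    (2 * k + ((n * m + 1) * (m + 1) + n + 2 + 1) ^ 2 + 1) *
      (78 * (3 * m * (n + 1) * (Nat.clog 2 n + 1))) ≤ 100000 * M ^ 9 := by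
  have hM1 : 1 ≤ M := by omega
  have hmM : m ≤ M := by omega
  have hnM : n ≤ M := by omega
  have hc : Nat.clog 2 n ≤ M := (Nat.clog_le_of_le_pow Nat.lt_two_pow_self.le).trans hnM
  have hp1 : M ≤ M ^ 3 := Nat.le_self_pow (by norm_num) _
  have hp2 : 1 ≤ M ^ 3 := Nat.one_le_pow _ _ hM1
  have hp3 : M ≤ M ^ 6 := Nat.le_self_pow (by norm_num) _
  have hp4 : 1 ≤ M ^ 6 := Nat.one_le_pow _ _ hM1
  have hp5 : 1 ≤ M ^ 2 := Nat.one_le_pow _ _ hM1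
  have h1 : n * m + 1 ≤ 2 * M ^ 2 := by
    have := Nat.mul_le_mul hnM hmM
    rw [← sq] at this
    omega
  have h2 : (n * m + 1) * (m + 1) ≤ 4 * M ^ 3 := by
    calc (n * m + 1) * (m + 1) ≤ (2 * M ^ 2) * (2 * M) := Nat.mul_le_mul h1 (by omega)
      _ = 4 * M ^ 3 := by ring
  have h3 : ((n * m + 1) * (m + 1) + n + 2 + 1) ^ 2 ≤ 64 * M ^ 6 := by
    calc _ ≤ (8 * M ^ 3) ^ 2 := Nat.pow_le_pow_left (by omega) 2
      _ = 64 * M ^ 6 := by ring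
  have h4 : 3 * m * (n + 1) * (Nat.clog 2 n + 1) ≤ 3 * M * (2 * M) * (2 * M) :=
    Nat.mul_le_mul (Nat.mul_le_mul (by omega) (by omega)) (by omega)
  calc _ ≤ (67 * M ^ 6) * (78 * (3 * M * (2 * M) * (2 * M))) :=
        Nat.mul_le_mul (by omega) (Nat.mul_le_mul_left _ h4)
    _ = 62712 * M ^ 9 := by ring
    _ ≤ _ := Nat.mul_le_mul_right _ (by norm_num)

end Algorithm

end JoinLS

/-! ### The main theorem. -/

open JoinLS in
theorem mainTheorem5 :
    -- the join that defines the multiplicity table of a node is acyclic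
    (∀ (α : Type) [DecidableEq α] (m : ℕ) (A : Fin m → Finset α) (T : JoinTree A),
      T.NbrsAcyclic → ∀ i, GYOAcyclic (fun j => A i ∩ A j) (T.nbrs i).toFinset) ∧
    -- the algorithm is correct, and its running time
    (∃ (C : ℝ) (c : ℕ), ∀ (α : Type) [LinearOrder α] (dom : α → Type)
      [∀ a, LinearOrder (dom a)] [∀ a, Inhabited (dom a)]
      (m : ℕ) (A : Fin m → Finset α) (T : JoinTree A), T.NbrsAcyclic →
        ∀ (D : ∀ i, List (Tup dom (A i))) (n : ℕ), n = ∑ i, (D i).length →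
        ∀ run : Timed (Output A dom), run = lsAcyclicJoin T D →
        ∀ bag : ∀ i, Multiset (Tup dom (A i)), (∀ i, bag i = (D i : Multiset (Tup dom (A i)))) →
          IsLocalSensitivity bag run.val.ls ∧
          tupleSens bag run.val.rel run.val.tuple = run.val.ls ∧
          (∀ i t, multTable T run.val.bot run.val.top i t = upSens bag i t) ∧
          (2 ≤ n → (run.steps : ℝ) ≤ C * m * n * Real.log n) ∧
          (∀ d : ℕ, (∀ i, (T.nbrs i).length ≤ d) → 2 ≤ n → m ≤ n →
            (run.steps : ℝ) ≤ C * (d + 1) ^ 2 * n * Real.log n) ∧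
          ((run.work : ℝ) ≤ C * ((m : ℝ) + (allAttrs A).card + n) ^ c)) ∧
    -- path queries are doubly acyclic, with a join tree of degree at most two
    (∀ m : ℕ, 1 ≤ m → DoublyAcyclic (pathQuery m) ∧
      ∃ T : JoinTree (pathQuery m), T.NbrsAcyclic ∧ ∀ i, (T.nbrs i).length ≤ 2) := by
  -- One constant serves all three bounds: the step bounds need `2340` and `780`, the work bound
  -- `62712`.
  refine ⟨fun α _ m A T hT i => (hT i).inter_left _, ⟨100000, 9, ?_⟩, fun m hm =>
    ⟨⟨(pathTree m hm).gyoAcyclic_univ, pathTree m hm, nbrsAcyclic_pathTree hm⟩, pathTree m hm,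
      nbrsAcyclic_pathTree hm, length_nbrs_pathTree hm⟩⟩
  intro α _ dom _ _ m A T hT D n hn run hrun bag hbag
  have hB := bounds_of_sizes D hn
  -- The specification is kept for an arbitrary `q`, since the same run is estimated twice, with `q
  -- = 3 m` and with `q = (d + 1) ^ 2`.
  have hspec : ∀ {q}, DegreeBound T n q → _ := fun {q} hq =>
    lsAcyclicJoin_spec (q := q) hB hT (by rw [← hn]; exact hq)
  rw [← hrun, ← hn] at hspec
  have h := hspec (degreeBound_card T n)
  obtain ⟨h1, h2, h3⟩ := h.val
  have hup : ∀ i t, upSens bag i t = sensCount D i (extend _ t) :=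
    upSens_eq_joinCount D bag hbag
  have hsens : tupleSens bag run.val.rel run.val.tuple = run.val.ls := by
    rw [tupleSens_eq_upSens, hup, h1]
  have hm : 1 ≤ m := Nat.one_le_of_lt T.root.2
  refine ⟨⟨⟨_, _, hsens⟩, ?_⟩, hsens, fun i t => ?_, fun hn2 => ?_, fun d hd hn2 hmn => ?_, ?_⟩
  · rintro _ ⟨i, t, rfl⟩
    rw [tupleSens_eq_upSens, hup]
    exact h2 i _
  · rw [h3, hup]
  · have hlog := mul_clog_le hn2
    have hs : (run.steps : ℝ) ≤ 234 * m * ((((n + 1) * (Nat.clog 2 n + 1) : ℕ)) : ℝ) := by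
      have := h.steps
      calc (run.steps : ℝ) ≤ ((78 * (3 * m * (n + 1) * (Nat.clog 2 n + 1)) : ℕ) : ℝ) := by
            exact_mod_cast this
        _ = _ := by push_cast; ring
    have hpos : 0 ≤ (n : ℝ) * Real.log n := mul_nonneg (Nat.cast_nonneg _) (Real.log_natCast_nonneg _)
    calc (run.steps : ℝ) ≤ 234 * m * (10 * (n * Real.log n)) :=
          hs.trans (mul_le_mul_of_nonneg_left hlog (by positivity))
      _ ≤ 100000 * (m * (n * Real.log n)) := by
          have : 0 ≤ (m : ℝ) * (n * Real.log n) := mul_nonneg (Nat.cast_nonneg _) hpos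
          linarith
      _ = _ := by ring
  · have hlog := mul_clog_le hn2
    have hs : (run.steps : ℝ) ≤
        78 * ((d : ℝ) + 1) ^ 2 * ((((n + 1) * (Nat.clog 2 n + 1) : ℕ)) : ℝ) := by
      have := (hspec (degreeBound_of_degree_le T hd hmn)).steps
      calc (run.steps : ℝ) ≤ ((78 * ((d + 1) ^ 2 * (n + 1) * (Nat.clog 2 n + 1)) : ℕ) : ℝ) := by
            exact_mod_cast this
        _ = _ := by push_cast; ring
    have hpos : 0 ≤ (n : ℝ) * Real.log n := mul_nonneg (Nat.cast_nonneg _) (Real.log_natCast_nonneg _)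
    calc (run.steps : ℝ) ≤ 78 * ((d : ℝ) + 1) ^ 2 * (10 * (n * Real.log n)) :=
          hs.trans (mul_le_mul_of_nonneg_left hlog (by positivity))
      _ ≤ 100000 * (((d : ℝ) + 1) ^ 2 * (n * Real.log n)) := by
          have : 0 ≤ ((d : ℝ) + 1) ^ 2 * (n * Real.log n) := mul_nonneg (by positivity) hpos
          linarith
      _ = _ := by ring
  · have hw := (h.work.trans (Nat.mul_le_mul_left _ h.steps)).trans
      (work_bound (k := (allAttrs A).card) (n := n) hm rfl)
    exact_mod_cast hw
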